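/- Fix $q\in(0,1)$, $c\in(1,q^{-1})$ and put $$\kappa_0=\Big(\tfrac{1-qc}{c-q}\Big)^2,\quad z_c(\kappa)=\tfrac{1+q\sqrt\kappa}{q+\sqrt\kappa},\quad p_2=\tfrac{qc}{1-qc},\quad \sigma_2=\sqrt{p_2(1+p_2)},\quad h_2(\kappa)=\kappa p_2+\tfrac{q}{c-q}.$$ With principal branches of logarithms and powers, let $S_2(\kappa,z)=\log(1-q/z)-\kappa\log(1-qz)-h_2(\kappa)\log z$, $\bar S_2(\kappa,z)=S_2(\kappa,z)-S_2(\kappa,c)$, $G_2(z)=-\log(1-qz)-p_2\log z$, $\bar G_2(z)=G_2(z)-G_2(c)$, and $E_{s}(z)=(1-qz)^{sN-\lfloor sN\rfloor}$. For $x>0$, $\theta\in(0,\pi)$, $R>x$ and small $r\ge 0$ let $C(x,\theta,R,r)$ be the closed contour made of the oriented segments from $\zeta^-$ to $z^-$, from $z^-$ to $z^+$ and from $z^+$ to $\zeta^+$, followed by the counterclockwise arc of $\{|z|=R\}$ from $\zeta^+$ to $\zeta^-$, where $z^\pm=x+re^{\pm \mathsf i\theta}$ and $\zeta^\pm$ is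 the point where the ray $\{x+ue^{\pm \mathsf i\theta}:u\ge0\}$ meets $\{|z|=R\}$. Call $(\theta,R)$ admissible for $\kappa$ if $\theta\in(\pi/4,\pi/2)$, $R>q^{-1}$, and there is $\psi:(0,\infty)\to(0,\infty)$ such that for every $\varepsilon>0$ one has $\operatorname{Re}[S_2(\kappa,z)-S_2(\kappa,c)]\le-\psi(\varepsilon)$ for all $z\in C(c,\theta,R,0)$ with $|z-c|\ge\varepsilon$. Let $\mathcal T\subset(\kappa_0,1)$ be a finite set. Then every $\kappa\in\mathcal T$ has an admissible pair. Moreover, let $(\theta_\kappa,R_\kappa)$ be any admissible pair for $\kappa$, for each $\kappa\in\mathcal T$, and set $\Gamma_{\kappa,N}=C(c,\theta_\kappa,R_\kappa,\sec(\theta_\kappa)N^{-1/2})$, $\gamma_\kappa=\{|z|=z_c(\kappa)\}$ (positively oriented), $\tilde\gamma_N=C(c,\pi/2,\sqrt{c^2+N^{-1/6}},0)$. For $s,t\in\mathcal T$ and $x,y\in\mathbb R$ put $$F^N_{11}(z,w)=e^{N\bar S_2(s,z)+N\bar S_2(t,w)-\sigma_2xN^{1/2}\log(z/c)-\sigma_2yN^{1/2}\log(w/c)},$$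 $$F^N_{12}(z,w)=e^{N\bar S_2(s,z)-N\bar S_2(t,w)-\sigma_2xN^{1/2}\log(z/c)+\sigma_2yN^{1/2}\log(w/c)},$$ $$F^N_{22}(z,w)=e^{-N\bar S_2(s,z)-N\bar S_2(t,w)+\sigma_2xN^{1/2}\log(z/c)+\sigma_2yN^{1/2}\log(w/c)},$$ $$H^N_{11}(z,w)=\sigma_2N^{1/2}\frac{(z-w)(1-c/z)(1-c/w)E_s(z)E_t(w)}{(z^2-1)(w^2-1)(zw-1)E_s(c)E_t(c)},$$ $$H^N_{12}(z,w)=\sigma_2N^{1/2}\frac{(zw-1)(z-c)E_s(z)E_t(c)}{z(z-w)(z^2-1)(w-c)E_t(w)E_s(c)},$$ $$H^N_{22}(z,w)=\sigma_2N^{1/2}\frac{(z-w)E_s(c)E_t(c)}{(zw-1)(z-c)(w-c)E_s(z)E_t(w)},$$ and define $$K^N_{11}(s,x;t,y)=\frac1{(2\pi \mathsf i)^2}\oint_{\Gamma_{s,N}}dz\oint_{\Gamma_{t,N}}dw\,F^N_{11}H^N_{11},$$ $$\begin{aligned}K^N_{12}(s,x;t,y)=&\frac1{(2\pi \mathsf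 i)^2}\oint_{\Gamma_{s,N}}dz\oint_{\gamma_t}dw\,F^N_{12}H^N_{12}+\frac{\sigma_2N^{1/2}}{2\pi \mathsf i}\oint_{\Gamma_{s,N}}dz\frac{F^N_{12}(z,c)(zc-1)E_s(z)}{z(z^2-1)E_s(c)}\\&-\frac{\mathbf 1\{s>t\}\sigma_2N^{1/2}}{2\pi \mathsf i}\oint_{\tilde\gamma_N}dz\,e^{(s-t)N\bar G_2(z)+\sigma_2(y-x)N^{1/2}\log(z/c)}\frac{E_s(z)E_t(c)}{zE_t(z)E_s(c)},\end{aligned}$$ $$\begin{aligned}K^N_{22}(s,x;t,y)=&\frac1{(2\pi \mathsf i)^2}\oint_{\gamma_s}dz\oint_{\gamma_t}dw\,F^N_{22}H^N_{22}+\frac{\sigma_2N^{1/2}}{2\pi \mathsf i}\oint_{\gamma_s}dz\frac{F^N_{22}(z,c)E_s(c)}{(cz-1)E_s(z)}\\&-\frac{\sigma_2N^{1/2}}{2\pi \mathsf i}\oint_{\gamma_t}dw\frac{F^N_{22}(c,w)E_t(c)}{(cw-1)E_t(w)}.\end{aligned}$$ (These are the entries of the $2\times2$ kernel $K^N$, whose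 remaining entry is $K^N_{21}(s,x;t,y)=-K^N_{12}(t,y;s,x)$.) If $x_N\to x$ and $y_N\to y$ are convergent sequences of real numbers, then for all $s,t\in\mathcal T$ $$\lim_{N\to\infty}K^N_{11}(s,x_N;t,y_N)=0,\qquad \lim_{N\to\infty}K^N_{22}(s,x_N;t,y_N)=0,$$ $$\lim_{N\to\infty}K^N_{12}(s,x_N;t,y_N)=K^{\mathrm{BM}}(s-\kappa_0,x;t-\kappa_0,y),$$ where $$K^{\mathrm{BM}}(s,x;t,y)=\frac{e^{-x^2/2s}}{\sqrt{2\pi s}}-\mathbf 1\{s>t\}\frac{e^{-(x-y)^2/2(s-t)}}{\sqrt{2\pi(s-t)}}.$$ -/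

import Mathlib

open Filter Topology

noncomputable section

namespace TopCurve

/-! ### Parameters -/

/-- `κ₀ = ((1 - qc)/(c - q))²`. -/
def kappa0 (q c : ℝ) : ℝ := ((1 - q * c) / (c - q)) ^ 2

/-- `z_c(κ) = (1 + q√κ)/(q + √κ)`. -/
def zc (q κ : ℝ) : ℝ := (1 + q * √κ) / (q + √κ)

/-- `p₂ = qc/(1 - qc)`. -/
def p2 (q c : ℝ) : ℝ := q * c / (1 - q * c)

/-- `σ₂ = √(p₂(1 + p₂))`. -/
def sigma2 (q c : ℝ) : ℝ := √(p2 q c * (1 + p2 q c))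

/-- `h₂(κ) = κ p₂ + q/(c - q)`. -/
def h2 (q c κ : ℝ) : ℝ := κ * p2 q c + q / (c - q)

/-! ### The functions `S₂` and `G₂` (principal branch of the logarithm) -/

/-- `S₂(κ, z) = log(1 - q/z) - κ log(1 - qz) - h₂(κ) log z`. -/
def S2 (q c κ : ℝ) (z : ℂ) : ℂ :=
  Complex.log (1 - q / z) - κ * Complex.log (1 - q * z) - h2 q c κ * Complex.log z

/-- `S̄₂(κ, z) = S₂(κ, z) - S₂(κ, c)`. -/
def S2bar (q c κ : ℝ) (z : ℂ) : ℂ := S2 q c κ z - S2 q c κ c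

/-- `G₂(z) = - log(1 - qz) - p₂ log z`. -/
def G2 (q c : ℝ) (z : ℂ) : ℂ :=
  -Complex.log (1 - q * z) - p2 q c * Complex.log z

/-- `Ḡ₂(z) = G₂(z) - G₂(c)`. -/
def G2bar (q c : ℝ) (z : ℂ) : ℂ := G2 q c z - G2 q c c

/-! ### The contours `C(x, θ, R, r)`

For `R > x > 0` and `0 < θ < π`, the ray `{x + t e^{iθ} : t ≥ 0}` meets the zero-centered circle
of radius `R` exactly once, at `t = rayLength x θ R`. -/

/-- The nonnegative root `t` of `|x + t e^{iθ}| = R`. -/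
def rayLength (x θ R : ℝ) : ℝ :=
  -(x * Real.cos θ) + √(R ^ 2 - x ^ 2 * Real.sin θ ^ 2)

/-- The point `x + t e^{iθ}`. -/
def rayPoint (x θ t : ℝ) : ℂ := x + t * Complex.exp (θ * Complex.I)

/-- `ζ⁺`, where the ray in direction `e^{iθ}` meets the circle `|z| = R`. -/
def zetaPlus (x θ R : ℝ) : ℂ := rayPoint x θ (rayLength x θ R)

/-- `ζ⁻`, where the ray in direction `e^{-iθ}` meets the circle `|z| = R`. -/
def zetaMinus (x θ R : ℝ) : ℂ := rayPoint x (-θ) (rayLength x θ R)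

/-- The point `R e^{iφ}`. -/
def circlePoint (R φ : ℝ) : ℂ := R * Complex.exp (φ * Complex.I)

/-- The set of points of the contour `C(x, θ, R, r)`: the segments from `ζ⁻` to
`z⁻ = x + r e^{-iθ}`, from `z⁻` to `z⁺ = x + r e^{iθ}` and from `z⁺` to `ζ⁺`, and the
counterclockwise arc of the circle `|z| = R` from `ζ⁺` to `ζ⁻ = conj ζ⁺`. -/
def contourSet (x θ R r : ℝ) : Set ℂ :=
  segment ℝ (zetaMinus x θ R) (rayPoint x (-θ) r) ∪
  segment ℝ (rayPoint x (-θ) r) (rayPoint x θ r) ∪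
  segment ℝ (rayPoint x θ r) (zetaPlus x θ R) ∪
  circlePoint R '' Set.Icc (zetaPlus x θ R).arg (2 * Real.pi - (zetaPlus x θ R).arg)

/-- `∫ f(z) dz` along the oriented segment from `a` to `b`. -/
def segmentIntegral (f : ℂ → ℂ) (a b : ℂ) : ℂ :=
  ∫ t in (0 : ℝ)..1, f (a + t * (b - a)) * (b - a)

/-- `∫ f(z) dz` along the arc `φ ↦ R e^{iφ}`, `φ` from `α` to `β`. -/
def arcIntegral (f : ℂ → ℂ) (R α β : ℝ) : ℂ :=
  ∫ φ in α..β, f (circlePoint R φ) * (circlePoint R φ * Complex.I)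

/-- `∮ f(z) dz` along the oriented contour `C(x, θ, R, r)`. -/
def contourIntegral (x θ R r : ℝ) (f : ℂ → ℂ) : ℂ :=
  segmentIntegral f (zetaMinus x θ R) (rayPoint x (-θ) r) +
  segmentIntegral f (rayPoint x (-θ) r) (rayPoint x θ r) +
  segmentIntegral f (rayPoint x θ r) (zetaPlus x θ R) +
  arcIntegral f R (zetaPlus x θ R).arg (2 * Real.pi - (zetaPlus x θ R).arg)

/-- The admissible pairs `(θ, R)` for a given `κ`: `θ ∈ (π/4, π/2)`, `R > q⁻¹`, and on the contour
`C(c, θ, R, 0)` the function `Re S₂(κ, ·)` is smaller than `Re S₂(κ, c)`, by a positive amount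
`ψ(ε)` at distance at least `ε` from `c`. -/
def IsDescentPair (q c κ θ R : ℝ) : Prop :=
  θ ∈ Set.Ioo (Real.pi / 4) (Real.pi / 2) ∧ q⁻¹ < R ∧
  ∃ ψ : ℝ → ℝ, ∀ ε : ℝ, 0 < ε → 0 < ψ ε ∧
    ∀ z ∈ contourSet c θ R 0, ε ≤ ‖z - c‖ → (S2 q c κ z - S2 q c κ c).re ≤ -ψ ε

/-- `∮ f(z) dz` over `Γ_{κ,N} = C(c, θ, R, sec(θ) N^{-1/2})`, for `θ = θ_κ`, `R = R_κ`. -/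
def intGamma (c θ R : ℝ) (N : ℕ) (f : ℂ → ℂ) : ℂ :=
  contourIntegral c θ R ((Real.cos θ)⁻¹ * (N : ℝ) ^ (-(1 / 2) : ℝ)) f

/-- `∮ f(z) dz` over `γ_κ`, the positively oriented zero-centered circle of radius `z_c(κ)`. -/
def intSmall (q κ : ℝ) (f : ℂ → ℂ) : ℂ := ∮ z in C(0, zc q κ), f z

/-- `∮ f(z) dz` over `γ̃_N = C(c, π/2, √(c² + N^{-1/6}), 0)`. -/
def intTilde (c : ℝ) (N : ℕ) (f : ℂ → ℂ) : ℂ :=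
  contourIntegral c (Real.pi / 2) √(c ^ 2 + (N : ℝ) ^ (-(1 / 6) : ℝ)) 0 f

/-! ### The prelimit kernel -/

/-- `σ₂ N^{1/2}`. -/
def scale (q c : ℝ) (N : ℕ) : ℝ := sigma2 q c * √N

/-- `(1 - qz)^{sN - ⌊sN⌋}`, principal branch. -/
def fracPow (q s : ℝ) (N : ℕ) (z : ℂ) : ℂ :=
  (1 - q * z) ^ ((s * N - ⌊s * N⌋ : ℝ) : ℂ)

def F11 (q c : ℝ) (N : ℕ) (s x t y : ℝ) (z w : ℂ) : ℂ :=
  Complex.exp (N * S2bar q c s z + N * S2bar q c t w) *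
  Complex.exp (-(scale q c N * x * Complex.log (z / c)) - scale q c N * y * Complex.log (w / c))

def F12 (q c : ℝ) (N : ℕ) (s x t y : ℝ) (z w : ℂ) : ℂ :=
  Complex.exp (N * S2bar q c s z - N * S2bar q c t w) *
  Complex.exp (-(scale q c N * x * Complex.log (z / c)) + scale q c N * y * Complex.log (w / c))

def F22 (q c : ℝ) (N : ℕ) (s x t y : ℝ) (z w : ℂ) : ℂ :=
  Complex.exp (-(N * S2bar q c s z) - N * S2bar q c t w) *
  Complex.exp (scale q c N * x * Complex.log (z / c) + scale q c N * y * Complex.log (w / c))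

def H11 (q c : ℝ) (N : ℕ) (s t : ℝ) (z w : ℂ) : ℂ :=
  scale q c N *
    (((z - w) * (1 - c / z) * (1 - c / w) * fracPow q s N z * fracPow q t N w) /
      ((z ^ 2 - 1) * (w ^ 2 - 1) * (z * w - 1) * fracPow q s N c * fracPow q t N c))

def H12 (q c : ℝ) (N : ℕ) (s t : ℝ) (z w : ℂ) : ℂ :=
  scale q c N *
    (((z * w - 1) * (z - c) * fracPow q s N z * fracPow q t N c) /
      (z * (z - w) * (z ^ 2 - 1) * (w - c) * fracPow q t N w * fracPow q s N c))

def H22 (q c : ℝ) (N : ℕ) (s t : ℝ) (z w : ℂ) : ℂ :=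
  scale q c N *
    (((z - w) * fracPow q s N c * fracPow q t N c) /
      ((z * w - 1) * (z - c) * (w - c) * fracPow q s N z * fracPow q t N w))

/-- In the kernels below, `θ κ` and `R κ` are the angle and the radius of `Γ_{κ,N}`. -/
def I11 (q c : ℝ) (θ R : ℝ → ℝ) (N : ℕ) (s x t y : ℝ) : ℂ :=
  1 / (2 * Real.pi * Complex.I) ^ 2 *
    intGamma c (θ s) (R s) N fun z => intGamma c (θ t) (R t) N fun w =>
      F11 q c N s x t y z w * H11 q c N s t z w

def I12 (q c : ℝ) (θ R : ℝ → ℝ) (N : ℕ) (s x t y : ℝ) : ℂ :=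
  1 / (2 * Real.pi * Complex.I) ^ 2 *
    intGamma c (θ s) (R s) N fun z => intSmall q t fun w =>
      F12 q c N s x t y z w * H12 q c N s t z w

def I22 (q c : ℝ) (N : ℕ) (s x t y : ℝ) : ℂ :=
  1 / (2 * Real.pi * Complex.I) ^ 2 *
    intSmall q s fun z => intSmall q t fun w =>
      F22 q c N s x t y z w * H22 q c N s t z w

def R12 (q c : ℝ) (θ R : ℝ → ℝ) (N : ℕ) (s x t y : ℝ) : ℂ :=
  -(if t < s then 1 else 0) * scale q c N / (2 * Real.pi * Complex.I) *
    (intTilde c N fun z =>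
      Complex.exp (((s - t) * N : ℝ) * G2bar q c z) *
      Complex.exp (scale q c N * (-x + y) * Complex.log (z / c)) *
      ((fracPow q s N z * fracPow q t N c) / (z * fracPow q t N z * fracPow q s N c))) +
  scale q c N / (2 * Real.pi * Complex.I) *
    (intGamma c (θ s) (R s) N fun z =>
      (F12 q c N s x t y z c * (z * c - 1) * fracPow q s N z) /
        (z * (z ^ 2 - 1) * fracPow q s N c))

def R22 (q c : ℝ) (N : ℕ) (s x t y : ℝ) : ℂ :=
  scale q c N / (2 * Real.pi * Complex.I) *
    (intSmall q s fun z =>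
      (F22 q c N s x t y z c * fracPow q s N c) / ((c * z - 1) * fracPow q s N z)) -
  scale q c N / (2 * Real.pi * Complex.I) *
    (intSmall q t fun w =>
      (F22 q c N s x t y c w * fracPow q t N c) / ((c * w - 1) * fracPow q t N w))

/-- The `2 × 2` matrix kernel `K^N(s, x; t, y)`; the indices `1, 2` are `0, 1` here. -/
def kernel (q c : ℝ) (θ R : ℝ → ℝ) (N : ℕ) (s x t y : ℝ) : Matrix (Fin 2) (Fin 2) ℂ :=
  !![I11 q c θ R N s x t y, I12 q c θ R N s x t y + R12 q c θ R N s x t y;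
     -I12 q c θ R N t y s x - R12 q c θ R N t y s x, I22 q c N s x t y + R22 q c N s x t y]

/-- The Gaussian heat kernel `p_s(x) = e^{-x²/(2s)} / √(2πs)`. -/
def heatKernel (s x : ℝ) : ℝ := Real.exp (-x ^ 2 / (2 * s)) / √(2 * Real.pi * s)

/-- `K^BM(s, x; t, y) = p_s(x) - 1{s > t} p_{s-t}(x - y)`. -/
def kernelBM (s x t y : ℝ) : ℝ :=
  heatKernel s x - (if t < s then 1 else 0) * heatKernel (s - t) (x - y)

end TopCurve

end

noncomputable section

namespace TopCurve

/-! ### Segment and arc integrals -/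

/-! This is steepest descent at one real saddle. The constant `h2` is what makes `c` a critical
point of `S2 q c κ`, and the second derivative there is `(σ₂² / c²) (κ - κ₀)` (`S2deriv_self`,
`hasDerivAt_S2deriv`). For `κ > κ₀` it is positive, so `Re S₂` has a strict maximum at `c` in the
vertical direction, and still along every ray whose angle lies between `π/4` and `π/2`. The
admissible contours consist of two such rays and a circular arc where `Re S̄₂` is bounded above by a
negative constant.

On `Γ_{κ,N}` the modulus of the exponential is therefore Gaussian of width `N^{-1/2}`, with total
mass `O(N^{-1/2})`, uniformly for bounded `x` (`exists_norm_intGamma_le`). On the circle of radius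
`z_c(κ)` the sign is the opposite one: `Re S̄₂ ≥ δ > 0` (`exists_le_S2bar_re_circle`), so `exp(-N
S̄₂)` is exponentially small. Every kernel term carries a single factor `N^{1/2}`. Two integrals
over contours `Γ` leave `O(N^{-1/2})`, and any integral over a small circle is negligible. This
removes `I11`, `I12`, `I22` and `R22`.

Only the two single integrals in `R12` survive, since one factor `N^{-1/2}` exactly cancels the
prefactor. With `z = c + iv/√N` the integrand tends to `exp(-A v²/2 - iσ₂xv/c) / c`, where `A` is
`(σ₂² / c²)(s - κ₀)` for `Γ` and `(σ₂² / c²)(s - t)` for `γ̃_N`, and where `x - y` replaces `x` in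
the second case. The Fourier transform of a Gaussian turns this into a heat kernel
(`tendsto_laplace_vertical`, `tendsto_segmentIntegral_heatKernel`). Before that, Cauchy's theorem
near `c` straightens `Γ` into a vertical segment (`intGamma_eq_vertical_add`), and the remaining
pieces are exponentially small (`exists_tail_bound`).

Existence of admissible pairs (`exists_isDescentPair`) reduces to the sign of a polynomial,
`rayNumerator`, along a ray; at the start of the ray the sign condition is exactly `κ₀ < κ`. -/

lemma segmentIntegral_ray (f : ℂ → ℂ) (p d : ℂ) (u₁ u₂ : ℝ) :
    segmentIntegral f (p + u₁ * d) (p + u₂ * d) = ∫ u in u₁..u₂, f (p + u * d) * d := by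
  -- The scaled form of the substitution needs no `u₁ ≠ u₂`, so degenerate segments are covered.
  have h := intervalIntegral.smul_integral_comp_mul_add (a := 0) (b := 1)
    (fun u : ℝ => f (p + u * d) * d) (u₂ - u₁) u₁
  simp only [mul_zero, zero_add, mul_one, sub_add_cancel] at h
  rw [← h, segmentIntegral, ← intervalIntegral.integral_smul]
  congr 1
  ext t
  simp only [Complex.real_smul, Complex.ofReal_sub, Complex.ofReal_add, Complex.ofReal_mul]
  rw [show p + u₁ * d + t * (p + u₂ * d - (p + u₁ * d)) =
    p + ((u₂ - u₁ : ℂ) * t + u₁) * d by ring]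
  ring

/-- No integrability is assumed, because a non-integrable integrand has integral `0`. Hence iterated
contour integrals can be bounded without any regularity of the inner integral in the outer variable.
-/
lemma norm_segmentIntegral_le {f : ℂ → ℂ} {a b : ℂ} {C : ℝ}
    (h : ∀ z ∈ segment ℝ a b, ‖f z‖ ≤ C) : ‖segmentIntegral f a b‖ ≤ C * ‖b - a‖ := by
  have h1 := intervalIntegral.norm_integral_le_of_norm_le_const (a := (0 : ℝ)) (b := 1)
    (C := C * ‖b - a‖) (f := fun t : ℝ => f (a + t * (b - a)) * (b - a)) (fun t ht => ?_)
  · simpa [segmentIntegral] using h1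
  · rw [Set.uIoc_of_le zero_le_one] at ht
    rw [norm_mul]
    gcongr
    apply h
    rw [segment_eq_image']
    exact ⟨t, ⟨ht.1.le, ht.2⟩, by simp⟩

lemma norm_circlePoint {R : ℝ} (hR : 0 ≤ R) (φ : ℝ) : ‖circlePoint R φ‖ = R := by
  rw [circlePoint, norm_mul, Complex.norm_exp_ofReal_mul_I, mul_one, Complex.norm_real,
    Real.norm_of_nonneg hR]

/-- The parameter interval has length `2π - 2α ≤ 4π`; a crude constant suffices. -/
lemma norm_arcIntegral_le {f : ℂ → ℂ} {R α C : ℝ} (hR : 0 ≤ R) (hα : |α| ≤ Real.pi)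
    (h : ∀ z ∈ circlePoint R '' Set.Icc α (2 * Real.pi - α), ‖f z‖ ≤ C) :
    ‖arcIntegral f R α (2 * Real.pi - α)‖ ≤ C * R * (4 * Real.pi) := by
  have h' := abs_le.1 hα
  have hle : α ≤ 2 * Real.pi - α := by linarith [h'.2]
  have hC : 0 ≤ C := (norm_nonneg _).trans (h _ ⟨α, ⟨le_rfl, hle⟩, rfl⟩)
  have h1 := intervalIntegral.norm_integral_le_of_norm_le_const (a := α) (b := 2 * Real.pi - α)
    (C := C * R) (f := fun φ : ℝ => f (circlePoint R φ) * (circlePoint R φ * Complex.I))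
    (fun φ hφ => ?_)
  · refine h1.trans ?_
    gcongr
    rw [abs_of_nonneg (by linarith)]
    linarith [h'.1]
  · rw [Set.uIoc_of_le hle] at hφ
    rw [norm_mul, norm_mul, norm_circlePoint hR, Complex.norm_I, mul_one]
    gcongr
    exact h _ ⟨φ, ⟨hφ.1.le, hφ.2⟩, rfl⟩

/-- Inside a disc of holomorphy, segment integrals are differences of a primitive. -/
lemma exists_segmentIntegral_eq_sub {f : ℂ → ℂ} {c : ℂ} {δ : ℝ}
    (hf : DifferentiableOn ℂ f (Metric.ball c δ)) :
    ∃ F : ℂ → ℂ, ∀ a ∈ Metric.ball c δ, ∀ b ∈ Metric.ball c δ,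
      segmentIntegral f a b = F b - F a := by
  obtain ⟨F, hF⟩ := hf.isExactOn_ball
  refine ⟨F, fun a ha b hb => ?_⟩
  have hmem : ∀ t ∈ Set.uIcc (0 : ℝ) 1, a + t * (b - a) ∈ Metric.ball c δ := by
    intro t ht
    rw [Set.uIcc_of_le zero_le_one] at ht
    have := (convex_ball c δ).add_smul_sub_mem ha hb ht
    simpa using this
  have hline : ∀ t : ℝ, HasDerivAt (fun t : ℝ => a + (t : ℂ) * (b - a)) (b - a) t := by
    intro t
    simpa using ((Complex.ofRealCLM.hasDerivAt (x := t)).mul_const (b - a)).const_add a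
  have h := intervalIntegral.integral_eq_sub_of_hasDerivAt (a := (0 : ℝ)) (b := 1)
    (f := fun t : ℝ => F (a + t * (b - a)))
    (f' := fun t : ℝ => f (a + t * (b - a)) * (b - a)) ?_ ?_
  · simpa [segmentIntegral] using h
  · intro t ht
    exact (hF _ (hmem t ht)).comp t (hline t)
  · apply ContinuousOn.intervalIntegrable
    refine ContinuousOn.mul ?_ continuousOn_const
    exact hf.continuousOn.comp (fun t _ => (hline t).continuousAt.continuousWithinAt) hmem

/-! ### Second order Taylor expansion -/

/-- Subtracting the quadratic term leaves a function whose derivative is `o(|w - c|)`; the mean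
value inequality on the disc of radius `|z - c|` then gains one more power. -/
lemma eventually_norm_sub_quadratic_le {f f' : ℂ → ℂ} {c A : ℂ}
    (hf : ∀ᶠ z in 𝓝 c, HasDerivAt f (f' z) z) (hf' : HasDerivAt f' A c) (h0 : f' c = 0)
    {η : ℝ} (hη : 0 < η) :
    ∀ᶠ z in 𝓝 c, ‖f z - f c - A / 2 * (z - c) ^ 2‖ ≤ η * ‖z - c‖ ^ 2 := by
  have h1 := hf'.isLittleO.def hη
  simp only [h0, sub_zero, smul_eq_mul] at h1
  obtain ⟨δ, hδ, hball⟩ := Metric.eventually_nhds_iff_ball.1 (hf.and h1)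
  refine Metric.eventually_nhds_iff_ball.2 ⟨δ, hδ, fun z hz => ?_⟩
  have hsub : Metric.closedBall c ‖z - c‖ ⊆ Metric.ball c δ := by
    apply Metric.closedBall_subset_ball
    rwa [← dist_eq_norm]
  have hd : ∀ w ∈ Metric.closedBall c ‖z - c‖,
      HasDerivWithinAt (fun w => f w - A / 2 * (w - c) ^ 2) (f' w - A * (w - c))
        (Metric.closedBall c ‖z - c‖) w := by
    intro w hw
    have h2 : HasDerivAt (fun w : ℂ => A / 2 * (w - c) ^ 2) (A / 2 * (2 * (w - c))) w := by
      simpa using (((hasDerivAt_id w).sub_const c).pow 2).const_mul (A / 2)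
    exact (((hball w (hsub hw)).1.sub h2).congr_deriv (by ring)).hasDerivWithinAt
  have h3 := (convex_closedBall c ‖z - c‖).norm_image_sub_le_of_norm_hasDerivWithin_le
    (C := η * ‖z - c‖) hd ?_ (Metric.mem_closedBall_self (norm_nonneg _))
    (show z ∈ Metric.closedBall c ‖z - c‖ by simp [dist_eq_norm])
  · calc _ = ‖f z - A / 2 * (z - c) ^ 2 - (f c - A / 2 * (c - c) ^ 2)‖ := by
          congr 1; ring
      _ ≤ _ := h3
      _ = _ := by ring
  · intro w hw
    have h4 := (hball w (hsub hw)).2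
    rw [mul_comm (w - c) A] at h4
    refine h4.trans ?_
    gcongr
    simpa [dist_eq_norm] using hw

/-- This makes the factor carrying `x` at most `exp(O(√N |z - c|))`, which the Gaussian decay
absorbs. -/
lemma log_norm_div_le {c : ℝ} (hc : 0 < c) {z : ℂ} (hz : c ≤ ‖z‖) :
    |Real.log ‖z / c‖| ≤ ‖z - c‖ / c := by
  have h1 : 1 ≤ ‖z / c‖ := by
    rw [norm_div, Complex.norm_real, Real.norm_of_nonneg hc.le, le_div_iff₀ hc]
    linarith
  rw [abs_of_nonneg (Real.log_nonneg h1)]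
  refine (Real.log_le_sub_one_of_pos (by linarith)).trans ?_
  have h2 : ‖z - c‖ / c = ‖z / c - 1‖ := by
    have hc' : (c : ℂ) ≠ 0 := by exact_mod_cast hc.ne'
    rw [show z / c - 1 = (z - c) / c by field_simp, norm_div, Complex.norm_real,
      Real.norm_of_nonneg hc.le]
  rw [h2]
  have := norm_sub_norm_le (z / c) 1
  simpa using this

/-! ### The Laplace method on a vertical segment -/

lemma integral_cexp_neg_sq_sub {A : ℝ} (hA : 0 < A) (b : ℝ) :
    ∫ v : ℝ, Complex.exp (-(A / 2) * v ^ 2 - b * (v * Complex.I)) =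
      (√(2 * Real.pi / A) * Real.exp (-b ^ 2 / (2 * A)) : ℝ) := by
  have h := fourierIntegral_gaussian (b := (A / 2 : ℂ)) (by simpa using hA) (-b : ℂ)
  have hA' : (A : ℂ) ≠ 0 := by exact_mod_cast hA.ne'
  calc _ = ∫ v : ℝ, Complex.exp (Complex.I * (-b : ℂ) * v) * Complex.exp (-(A / 2 : ℂ) * v ^ 2) := by
        congr 1; ext v; rw [← Complex.exp_add]; congr 1; ring
    _ = _ := by
        rw [h]
        push_cast
        congr 1
        · rw [show (Real.pi / (A / 2 : ℂ)) = ((2 * Real.pi / A : ℝ) : ℂ) by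
            push_cast; field_simp, Real.sqrt_eq_rpow, Complex.ofReal_cpow (by positivity)]
          norm_num
        · congr 1
          field_simp
          ring

lemma tendsto_sqrt_natCast_atTop : Tendsto (fun N : ℕ => √(N : ℝ)) atTop atTop :=
  Real.tendsto_sqrt_atTop.comp tendsto_natCast_atTop_atTop

lemma tendsto_mul_clog {c : ℝ} (hc : 0 < c) (v : ℝ) :
    Tendsto (fun N : ℕ => (√(N : ℝ) : ℂ) *
      Complex.log ((c + (v / √(N : ℝ) : ℝ) * Complex.I) / c)) atTop
      (𝓝 (v * Complex.I / c)) := by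
  have hc' : (c : ℂ) ≠ 0 := by exact_mod_cast hc.ne'
  have h : HasFDerivAt (fun y : ℝ => Complex.log ((c + (y : ℂ) * Complex.I) / c))
      (ContinuousLinearMap.toSpanSingleton ℝ (Complex.I / c)) 0 := by
    have h1 : HasDerivAt (fun y : ℝ => (c + (y : ℂ) * Complex.I) / c) (Complex.I / c) 0 := by
      simpa using (((Complex.ofRealCLM.hasDerivAt (x := 0)).mul_const Complex.I).const_add
        (c : ℂ)).div_const (c : ℂ)
    have h2 := h1.clog_real (by simp [hc'])
    simpa [hc'] using h2.hasFDerivAt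
  have h3 := h.lim v (c := fun N : ℕ => √(N : ℝ)) (l := atTop)
    (by simpa [abs_of_nonneg] using tendsto_sqrt_natCast_atTop)
  simp only [zero_add, Complex.ofReal_zero, zero_mul, add_zero, div_self hc', Complex.log_one,
    sub_zero, ContinuousLinearMap.toSpanSingleton_apply, smul_eq_mul, Complex.real_smul] at h3
  convert h3 using 3
  · congr 3; push_cast; ring
  · ring

lemma norm_exp_weight {c : ℝ} (n a : ℝ) (φ : ℂ → ℂ) (z : ℂ) :
    ‖Complex.exp (n * φ z - a * Complex.log (z / c))‖ =
      Real.exp (n * (φ z).re - a * Real.log ‖z / c‖) := by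
  rw [Complex.norm_exp]
  simp [Complex.log_re]

/-- The half-length `ℓ N` may be constant or shrink, as long as it is long on the scale `N^{-1/2}`.
The local bound with constant `A / 4` keeps half of the quadratic decay and yields the dominating
function; the sharp expansion gives the pointwise limit. -/
theorem tendsto_laplace_vertical {φ : ℂ → ℂ} {A c σ δ M x : ℝ} {g : ℕ → ℂ → ℂ} {g₀ : ℂ}
    {ℓ xs : ℕ → ℝ} (hc : 0 < c) (hA : 0 < A) (hδ : 0 ≤ δ)
    (hφ : ∀ η > 0, ∀ᶠ z in 𝓝 (c : ℂ), ‖φ z - A / 2 * (z - c) ^ 2‖ ≤ η * ‖z - c‖ ^ 2)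
    (hφδ : ∀ z ∈ Metric.closedBall (c : ℂ) δ,
      ‖φ z - A / 2 * (z - c) ^ 2‖ ≤ A / 4 * ‖z - c‖ ^ 2)
    (hℓ : ∀ᶠ N in atTop, ℓ N ≤ δ) (hℓ' : Tendsto (fun N : ℕ => ℓ N * √(N : ℝ)) atTop atTop)
    (hx : Tendsto xs atTop (𝓝 x))
    (hg : ∀ N, ∀ z ∈ Metric.closedBall (c : ℂ) δ, ‖g N z‖ ≤ M)
    (hg₀ : ∀ v : ℝ, Tendsto (fun N : ℕ => g N (c + (v / √(N : ℝ) : ℝ) * Complex.I)) atTop (𝓝 g₀))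
    (hcont : ∀ N : ℕ, ContinuousOn (fun z => Complex.exp ((N : ℝ) * φ z -
      (σ * √(N : ℝ) * xs N : ℝ) * Complex.log (z / c)) * g N z) (Metric.closedBall (c : ℂ) δ)) :
    Tendsto (fun N : ℕ => (√(N : ℝ) : ℂ) * ∫ v in (-ℓ N)..(ℓ N),
      Complex.exp ((N : ℝ) * φ (c + v * Complex.I) -
        (σ * √(N : ℝ) * xs N : ℝ) * Complex.log ((c + v * Complex.I) / c)) *
        g N (c + v * Complex.I)) atTop
      (𝓝 ((√(2 * Real.pi / A) * Real.exp (-(σ * x / c) ^ 2 / (2 * A)) : ℝ) * g₀)) := by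
  set F : ℕ → ℂ → ℂ := fun N z => Complex.exp ((N : ℝ) * φ z -
      (σ * √(N : ℝ) * xs N : ℝ) * Complex.log (z / c)) * g N z with hF
  obtain ⟨X, hX⟩ : ∃ X, ∀ N, |xs N| ≤ X := by
    obtain ⟨X, hX⟩ := hx.norm.bddAbove_range
    exact ⟨X, fun N => hX ⟨N, rfl⟩⟩
  have hX0 : 0 ≤ X := (abs_nonneg _).trans (hX 0)
  set K : ℝ := |σ| * X / c with hK
  have hpos : ∀ᶠ N : ℕ in atTop, (0 : ℝ) < √(N : ℝ) :=
    tendsto_sqrt_natCast_atTop.eventually_gt_atTop 0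
  have hnorm : ∀ v : ℝ, ‖((c : ℂ) + v * Complex.I) - c‖ = |v| := by intro v; simp
  have hM : 0 ≤ M := (norm_nonneg _).trans (hg 0 c (Metric.mem_closedBall_self hδ))
  have hmem : ∀ (N : ℕ) (v : ℝ), ℓ N ≤ δ → 0 < √(N : ℝ) →
      v ∈ Set.Ioc (-(ℓ N * √(N : ℝ))) (ℓ N * √(N : ℝ)) →
      (c : ℂ) + (v / √(N : ℝ) : ℝ) * Complex.I ∈ Metric.closedBall (c : ℂ) δ := by
    intro N v hN hNpos hv
    rw [Metric.mem_closedBall, dist_eq_norm, hnorm, abs_div, abs_of_pos hNpos,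
      div_le_iff₀ hNpos]
    exact (abs_le.2 ⟨hv.1.le, hv.2⟩).trans (by gcongr)
  -- After rescaling `v` by `√N`, the integral is extended to the whole line by an indicator so that
  -- dominated convergence applies.
  have key : Tendsto (fun N : ℕ => ∫ v : ℝ, (Set.Ioc (-(ℓ N * √(N : ℝ))) (ℓ N * √(N : ℝ))).indicator
      (fun v : ℝ => F N (c + (v / √(N : ℝ) : ℝ) * Complex.I)) v) atTop
      (𝓝 (∫ v : ℝ, Complex.exp (-(A / 2) * v ^ 2 - (σ * x / c : ℝ) * (v * Complex.I)) * g₀)) := by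
    apply MeasureTheory.tendsto_integral_filter_of_dominated_convergence
      (fun v : ℝ => Real.exp (2 * K ^ 2 / A) * Real.exp (-(A / 8) * v ^ 2) * M)
    · filter_upwards [hℓ, hpos] with N hN hNpos
      rw [aestronglyMeasurable_indicator_iff measurableSet_Ioc]
      refine ContinuousOn.aestronglyMeasurable ?_ measurableSet_Ioc
      refine (hcont N).comp (Continuous.continuousOn (by fun_prop)) fun v hv => ?_
      exact hmem N v hN hNpos hv
    · filter_upwards [hℓ, hpos] with N hN hNpos
      refine Eventually.of_forall fun v => ?_
      rw [Set.indicator_apply]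
      split_ifs with hv
      · have hz := hmem N v hN hNpos hv
        set z : ℂ := c + (v / √(N : ℝ) : ℝ) * Complex.I with hzdef
        have hzc : ‖z - c‖ = |v| / √(N : ℝ) := by
          rw [hzdef, hnorm, abs_div, abs_of_pos hNpos]
        have hsq : √(N : ℝ) ^ 2 = N := Real.sq_sqrt (Nat.cast_nonneg N)
        rw [hF]
        simp only
        rw [norm_mul, norm_exp_weight, ← Real.exp_add]
        refine mul_le_mul (Real.exp_le_exp.2 ?_) (hg N z hz) (norm_nonneg _) (Real.exp_pos _).le
        have h1 : (φ z).re ≤ -(A / 4) * (v / √(N : ℝ)) ^ 2 := by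
          have h2 := (Complex.re_le_norm _).trans (hφδ z hz)
          have h3 : ((A : ℂ) / 2 * (z - c) ^ 2).re = -(A / 2) * (v / √(N : ℝ)) ^ 2 := by
            rw [hzdef, show (A : ℂ) / 2 * (c + (v / √(N : ℝ) : ℝ) * Complex.I - c) ^ 2 =
              ((A / 2 * (v / √(N : ℝ)) ^ 2 : ℝ) : ℂ) * Complex.I ^ 2 by push_cast; ring,
              Complex.I_sq, mul_neg_one, Complex.neg_re, Complex.ofReal_re]
            ring
          rw [Complex.sub_re, h3, hzc, ← abs_of_pos hNpos, ← abs_div, sq_abs,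
            abs_of_pos hNpos] at h2
          linarith
        have h4 : (N : ℝ) * (φ z).re ≤ -(A / 4) * v ^ 2 := by
          have := mul_le_mul_of_nonneg_left h1 (Nat.cast_nonneg (α := ℝ) N)
          rwa [div_pow, hsq, show (N : ℝ) * (-(A / 4) * (v ^ 2 / N)) = -(A / 4) * v ^ 2 by
            have : (N : ℝ) ≠ 0 := by rw [← hsq]; positivity
            field_simp] at this
        have h5 : -(σ * √(N : ℝ) * xs N * Real.log ‖z / c‖) ≤ K * |v| := by
          refine (neg_le_abs _).trans ?_
          have hcz : c ≤ ‖z‖ := by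
            refine le_trans (le_of_eq ?_) (Complex.re_le_norm z)
            simp [hzdef]
          have h6 := log_norm_div_le hc hcz
          rw [hzc] at h6
          rw [abs_mul, abs_mul, abs_mul, abs_of_pos hNpos]
          calc |σ| * √(N : ℝ) * |xs N| * |Real.log ‖z / c‖|
              ≤ |σ| * √(N : ℝ) * X * (|v| / √(N : ℝ) / c) := by gcongr; exact hX N
            _ = K * |v| := by rw [hK]; field_simp
        -- Half of the available decay `A / 4` pays for the linear term, by completing the square.
        have h7 : K * |v| ≤ A / 8 * v ^ 2 + 2 * K ^ 2 / A := by
          rw [← sq_abs v, ← sub_nonneg]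
          have : A / 8 * |v| ^ 2 + 2 * K ^ 2 / A - K * |v| = (A * |v| - 4 * K) ^ 2 / (8 * A) := by
            field_simp; ring
          rw [this]; positivity
        linarith
      · simpa using by positivity
    · exact ((integrable_exp_neg_mul_sq (by positivity)).const_mul _).mul_const M
    · refine Eventually.of_forall fun v => ?_
      have hz : Tendsto (fun N : ℕ => (c : ℂ) + (v / √(N : ℝ) : ℝ) * Complex.I) atTop
          (𝓝 (c : ℂ)) := by
        have h1 : Tendsto (fun N : ℕ => v / √(N : ℝ)) atTop (𝓝 0) :=
          tendsto_sqrt_natCast_atTop.const_div_atTop v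
        have h2 : Continuous fun y : ℝ => (c : ℂ) + (y : ℂ) * Complex.I := by fun_prop
        exact (h2.tendsto' 0 c (by simp)).comp h1
      have hφlim : Tendsto (fun N : ℕ => ((N : ℝ) : ℂ) * φ (c + (v / √(N : ℝ) : ℝ) * Complex.I))
          atTop (𝓝 (-(A / 2) * v ^ 2)) := by
        rw [Metric.tendsto_atTop']
        intro ε hε
        -- The `+ 1` covers `v = 0` and makes the final inequality strict.
        have hη : 0 < ε / (v ^ 2 + 1) := by positivity
        obtain ⟨n, hn⟩ := eventually_atTop.1 ((hz.eventually (hφ _ hη)).and hpos)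
        refine ⟨n, fun N hN => ?_⟩
        obtain ⟨h1, hNpos⟩ := hn N hN.le
        have hsq : √(N : ℝ) ^ 2 = N := Real.sq_sqrt (Nat.cast_nonneg N)
        have hN0 : (0 : ℝ) < N := by rw [← hsq]; positivity
        have hN0' : ((N : ℝ) : ℂ) ≠ 0 := by exact_mod_cast hN0.ne'
        rw [hnorm, sq_abs, div_pow, hsq] at h1
        have h2 : (A : ℂ) / 2 * (c + (v / √(N : ℝ) : ℝ) * Complex.I - c) ^ 2 =
            -(A / 2) * v ^ 2 / (N : ℝ) := by
          rw [show (A : ℂ) / 2 * (c + (v / √(N : ℝ) : ℝ) * Complex.I - c) ^ 2 =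
            A / 2 * (((v / √(N : ℝ)) ^ 2 : ℝ) : ℂ) * Complex.I ^ 2 by push_cast; ring,
            Complex.I_sq, div_pow, hsq]
          push_cast; ring
        rw [h2] at h1
        have h3 : ((N : ℝ) : ℂ) * φ (c + (v / √(N : ℝ) : ℝ) * Complex.I) - -(A / 2) * v ^ 2 =
            (N : ℝ) * (φ (c + (v / √(N : ℝ) : ℝ) * Complex.I) - -(A / 2) * v ^ 2 / (N : ℝ)) := by
          field_simp
        rw [dist_eq_norm, h3, norm_mul, Complex.norm_real, Real.norm_of_nonneg hN0.le]
        calc (N : ℝ) * _ ≤ N * (ε / (v ^ 2 + 1) * (v ^ 2 / N)) := by gcongr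
          _ = ε * (v ^ 2 / (v ^ 2 + 1)) := by field_simp
          _ < ε * 1 := by
              gcongr
              rw [div_lt_one (by positivity)]
              linarith
          _ = ε := mul_one ε
      have hlog := tendsto_mul_clog hc v
      have hxc : Tendsto (fun N : ℕ => ((σ * xs N : ℝ) : ℂ)) atTop (𝓝 ((σ * x : ℝ) : ℂ)) :=
        (Complex.continuous_ofReal.tendsto _).comp (hx.const_mul σ)
      have hlim := ((Complex.continuous_exp.tendsto _).comp
        (hφlim.sub (hxc.mul hlog))).mul (hg₀ v)
      have heq : (-(A / 2 : ℂ)) * v ^ 2 - (σ * x / c : ℝ) * (v * Complex.I) =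
          -(A / 2) * v ^ 2 - ((σ * x : ℝ) : ℂ) * (v * Complex.I / c) := by
        push_cast; ring
      rw [heq]
      refine hlim.congr' ?_
      filter_upwards [hℓ'.eventually_gt_atTop |v|] with N hN
      have hv : v ∈ Set.Ioc (-(ℓ N * √(N : ℝ))) (ℓ N * √(N : ℝ)) :=
        ⟨(abs_lt.1 hN).1, (abs_lt.1 hN).2.le⟩
      rw [Set.indicator_of_mem hv]
      simp only [hF, Function.comp_apply]
      congr 3
      push_cast; ring
  rw [MeasureTheory.integral_mul_const, integral_cexp_neg_sq_sub hA] at key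
  refine key.congr' ?_
  filter_upwards [hpos, hℓ'.eventually_gt_atTop 0] with N hNpos hNℓ
  rw [MeasureTheory.integral_indicator measurableSet_Ioc,
    ← intervalIntegral.integral_of_le (by linarith)]
  rw [intervalIntegral.integral_comp_div (fun v : ℝ => F N (c + (v : ℂ) * Complex.I)) hNpos.ne',
    neg_div, mul_div_cancel_right₀ _ hNpos.ne', Complex.real_smul]

/-! ### Parameters and the domain of holomorphy -/

/-- The standing assumptions `0 < q < 1 < c < q⁻¹`. -/
structure IsParam (q c : ℝ) : Prop where
  q_pos : 0 < q
  q_lt_one : q < 1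
  one_lt : 1 < c
  mul_lt_one : q * c < 1

/-- A domain around `c` and both rays of the contours, on which the integrands are holomorphic. -/
def regularDomain (q : ℝ) : Set ℂ := {z | 1 < z.re ∧ (z.im ≠ 0 ∨ q * z.re < 1)}

namespace IsParam

variable {q c : ℝ}

lemma c_pos (h : IsParam q c) : 0 < c := by linarith [h.one_lt]

lemma sub_pos (h : IsParam q c) : 0 < c - q := by linarith [h.one_lt, h.q_lt_one]

lemma one_sub_pos (h : IsParam q c) : 0 < 1 - q * c := by linarith [h.mul_lt_one]

lemma lt_inv (h : IsParam q c) : c < q⁻¹ := by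
  rw [lt_inv_comm₀ h.c_pos h.q_pos, inv_eq_one_div, lt_div_iff₀ h.c_pos]
  exact h.mul_lt_one

lemma p2_pos (h : IsParam q c) : 0 < p2 q c := div_pos (mul_pos h.q_pos h.c_pos) h.one_sub_pos

lemma sigma2_pos (h : IsParam q c) : 0 < sigma2 q c := Real.sqrt_pos.2 (mul_pos h.p2_pos (by linarith [h.p2_pos]))

lemma sigma2_sq (h : IsParam q c) : sigma2 q c ^ 2 = q * c / (1 - q * c) ^ 2 := by
  rw [sigma2, Real.sq_sqrt (mul_pos h.p2_pos (by linarith [h.p2_pos])).le, p2]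
  have := h.one_sub_pos.ne'
  field_simp
  ring

lemma kappa0_pos (h : IsParam q c) : 0 < kappa0 q c := pow_pos (div_pos h.one_sub_pos h.sub_pos) 2

lemma mem_regularDomain (h : IsParam q c) : (c : ℂ) ∈ regularDomain q :=
  ⟨by simpa using h.one_lt, Or.inr (by simpa using h.mul_lt_one)⟩

end IsParam

/-- The condition `1 < Re z` avoids `0`, `±1` and the cuts of `log z` and `log (1 - q / z)`; the
second condition avoids the cut `[q⁻¹, ∞)` of `log (1 - q z)`. The large arcs leave this domain, but
they are only ever estimated in modulus. -/
lemma isOpen_regularDomain (q : ℝ) : IsOpen (regularDomain q) := by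
  refine (isOpen_lt continuous_const Complex.continuous_re).inter (IsOpen.union ?_ ?_)
  · exact isOpen_ne_fun Complex.continuous_im continuous_const
  · exact isOpen_lt (continuous_const.mul Complex.continuous_re) continuous_const

section Domain

variable {q c : ℝ} {z : ℂ}

lemma one_lt_norm_of_mem (hz : z ∈ regularDomain q) : 1 < ‖z‖ :=
  hz.1.trans_le (Complex.re_le_norm z)

lemma ne_zero_of_mem (hz : z ∈ regularDomain q) : z ≠ 0 :=
  norm_pos_iff.1 (by linarith [one_lt_norm_of_mem hz])

lemma mem_slitPlane_of_mem (hz : z ∈ regularDomain q) : z ∈ Complex.slitPlane :=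
  Or.inl (by linarith [hz.1])

lemma one_sub_mul_mem_slitPlane (hq : 0 < q) (hz : z ∈ regularDomain q) :
    1 - q * z ∈ Complex.slitPlane := by
  rcases hz.2 with h | h
  · right
    simpa using ⟨hq.ne', h⟩
  · left
    simpa using h

lemma one_sub_div_mem_slitPlane (hq : 0 < q) (hq1 : q < 1) (hz : z ∈ regularDomain q) :
    1 - q / z ∈ Complex.slitPlane := by
  left
  have h1 : ‖(q : ℂ) / z‖ < 1 := by
    rw [norm_div, Complex.norm_real, Real.norm_of_nonneg hq.le,
      div_lt_one (by linarith [one_lt_norm_of_mem hz])]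
    linarith [one_lt_norm_of_mem hz]
  have := Complex.re_le_norm ((q : ℂ) / z)
  simp only [Complex.sub_re, Complex.one_re]
  linarith

lemma sq_sub_one_ne_zero (hz : 1 < ‖z‖) : z ^ 2 - 1 ≠ 0 := by
  intro h0
  have h1 : ‖z‖ ^ 2 = 1 := by rw [← norm_pow, sub_eq_zero.1 h0, norm_one]
  nlinarith

end Domain

/-! ### Derivatives of `S₂` and `G₂` -/

/-- The derivative of `S₂(κ, ·)`. -/
def S2deriv (q c κ : ℝ) (z : ℂ) : ℂ := q / (z * (z - q)) + κ * (q / (1 - q * z)) - h2 q c κ / z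

/-- The derivative of `G₂`. -/
def G2deriv (q c : ℝ) (z : ℂ) : ℂ := q / (1 - q * z) - p2 q c / z

section Deriv

variable {q c κ : ℝ} {z : ℂ}

lemma hasDerivAt_log_one_sub_mul (hq : 0 < q) (hz : z ∈ regularDomain q) :
    HasDerivAt (fun z : ℂ => Complex.log (1 - q * z)) (-(q / (1 - q * z))) z := by
  have h1 : HasDerivAt (fun z : ℂ => 1 - q * z) (-q) z := by
    simpa using ((hasDerivAt_id z).const_mul (q : ℂ)).const_sub 1
  simpa [neg_div] using h1.clog (one_sub_mul_mem_slitPlane hq hz)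

lemma hasDerivAt_log_one_sub_div (hq : 0 < q) (hq1 : q < 1) (hz : z ∈ regularDomain q) :
    HasDerivAt (fun z : ℂ => Complex.log (1 - q / z)) (q / (z * (z - q))) z := by
  have hz0 := ne_zero_of_mem hz
  have h1 : HasDerivAt (fun z : ℂ => 1 - q / z) (q / z ^ 2) z := by
    have := ((hasDerivAt_inv hz0).const_mul (q : ℂ)).const_sub 1
    simpa [div_eq_mul_inv] using this
  have h2 := h1.clog (one_sub_div_mem_slitPlane hq hq1 hz)
  have h3 : 1 - (q : ℂ) / z ≠ 0 := Complex.slitPlane_ne_zero (one_sub_div_mem_slitPlane hq hq1 hz)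
  have h4 : z - q ≠ 0 := by
    intro h0
    apply h3
    rw [← sub_eq_zero.1 h0, div_self hz0, sub_self]
  refine h2.congr_deriv ?_
  field_simp

lemma hasDerivAt_S2 (h : IsParam q c) (hz : z ∈ regularDomain q) :
    HasDerivAt (S2 q c κ) (S2deriv q c κ z) z := by
  have h1 := hasDerivAt_log_one_sub_div h.q_pos h.q_lt_one hz
  have h2 := (hasDerivAt_log_one_sub_mul h.q_pos hz).const_mul (κ : ℂ)
  have h3 := (Complex.hasDerivAt_log (mem_slitPlane_of_mem hz)).const_mul (TopCurve.h2 q c κ : ℂ)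
  refine ((h1.sub h2).sub h3).congr_deriv ?_
  rw [S2deriv]
  ring

lemma hasDerivAt_G2 (h : IsParam q c) (hz : z ∈ regularDomain q) :
    HasDerivAt (G2 q c) (G2deriv q c z) z := by
  have h2 := hasDerivAt_log_one_sub_mul h.q_pos hz
  have h3 := (Complex.hasDerivAt_log (mem_slitPlane_of_mem hz)).const_mul (p2 q c : ℂ)
  refine (h2.neg.sub h3).congr_deriv ?_
  rw [G2deriv]
  ring

lemma IsParam.ofReal_ne (h : IsParam q c) :
    (c : ℂ) ≠ 0 ∧ (c : ℂ) - q ≠ 0 ∧ 1 - (q : ℂ) * c ≠ 0 := by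
  refine ⟨?_, ?_, ?_⟩
  · exact_mod_cast h.c_pos.ne'
  · exact_mod_cast h.sub_pos.ne'
  · exact_mod_cast h.one_sub_pos.ne'

lemma S2deriv_self (h : IsParam q c) : S2deriv q c κ c = 0 := by
  obtain ⟨h1, h2, h3⟩ := h.ofReal_ne
  simp only [S2deriv, TopCurve.h2, p2]
  push_cast
  field_simp
  ring

lemma G2deriv_self (h : IsParam q c) : G2deriv q c c = 0 := by
  obtain ⟨h1, h2, h3⟩ := h.ofReal_ne
  simp only [G2deriv, p2]
  push_cast
  field_simp
  ring

/-- This is where `κ₀` comes from: it is the value of `κ` at which the critical point `c`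
degenerates. -/
lemma hasDerivAt_S2deriv (h : IsParam q c) :
    HasDerivAt (S2deriv q c κ) ((sigma2 q c ^ 2 / c ^ 2 * (κ - kappa0 q c) : ℝ) : ℂ) c := by
  obtain ⟨h1, h2, h3⟩ := h.ofReal_ne
  have d1 : HasDerivAt (fun z : ℂ => z * (z - q)) (1 * ((c : ℂ) - q) + c * 1) c :=
    (hasDerivAt_id (c : ℂ)).mul ((hasDerivAt_id (c : ℂ)).sub_const (q : ℂ))
  have d2 : HasDerivAt (fun z : ℂ => 1 - q * z) (-q) c := by
    simpa using ((hasDerivAt_id (c : ℂ)).const_mul (q : ℂ)).const_sub 1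
  have e1 := (hasDerivAt_const (c : ℂ) (q : ℂ)).div d1 (mul_ne_zero h1 h2)
  have e2 := ((hasDerivAt_const (c : ℂ) (q : ℂ)).div d2 h3).const_mul (κ : ℂ)
  have e3 := (hasDerivAt_const (c : ℂ) (TopCurve.h2 q c κ : ℂ)).div (hasDerivAt_id (c : ℂ)) h1
  refine ((e1.add e2).sub e3).congr_deriv ?_
  rw [h.sigma2_sq]
  simp only [id, TopCurve.h2, p2, kappa0]
  push_cast
  generalize (c : ℂ) = C at *
  generalize (q : ℂ) = Q at *
  generalize (κ : ℂ) = K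
  have e : (0 * (C * (C - Q)) - Q * (1 * (C - Q) + C * 1)) / (C * (C - Q)) ^ 2 =
      -(Q * (2 * C - Q)) / (C * (C - Q)) ^ 2 := by ring
  rw [e]
  field_simp
  ring

lemma hasDerivAt_G2deriv (h : IsParam q c) :
    HasDerivAt (G2deriv q c) ((sigma2 q c ^ 2 / c ^ 2 : ℝ) : ℂ) c := by
  obtain ⟨h1, h2, h3⟩ := h.ofReal_ne
  have d2 : HasDerivAt (fun z : ℂ => 1 - q * z) (-q) c := by
    simpa using ((hasDerivAt_id (c : ℂ)).const_mul (q : ℂ)).const_sub 1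
  have e2 := (hasDerivAt_const (c : ℂ) (q : ℂ)).div d2 h3
  have e3 := (hasDerivAt_const (c : ℂ) (p2 q c : ℂ)).div (hasDerivAt_id (c : ℂ)) h1
  refine (e2.sub e3).congr_deriv ?_
  rw [h.sigma2_sq]
  simp only [id, p2]
  push_cast
  field_simp
  ring

lemma eventually_S2bar_quadratic (h : IsParam q c) {η : ℝ} (hη : 0 < η) :
    ∀ᶠ z in 𝓝 (c : ℂ), ‖S2bar q c κ z -
      (sigma2 q c ^ 2 / c ^ 2 * (κ - kappa0 q c) : ℝ) / 2 * (z - c) ^ 2‖ ≤ η * ‖z - c‖ ^ 2 :=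
  eventually_norm_sub_quadratic_le
    (((isOpen_regularDomain q).eventually_mem h.mem_regularDomain).mono
      fun _ hz => hasDerivAt_S2 h hz) (hasDerivAt_S2deriv h) (S2deriv_self h) hη

lemma eventually_G2bar_quadratic (h : IsParam q c) {η : ℝ} (hη : 0 < η) :
    ∀ᶠ z in 𝓝 (c : ℂ), ‖G2bar q c z -
      (sigma2 q c ^ 2 / c ^ 2 : ℝ) / 2 * (z - c) ^ 2‖ ≤ η * ‖z - c‖ ^ 2 :=
  eventually_norm_sub_quadratic_le
    (((isOpen_regularDomain q).eventually_mem h.mem_regularDomain).mono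
      fun _ hz => hasDerivAt_G2 h hz) (hasDerivAt_G2deriv h) (G2deriv_self h) hη

lemma S2bar_re (z : ℂ) : (S2bar q c κ z).re =
    (Real.log ‖1 - q / z‖ - κ * Real.log ‖1 - q * z‖ - h2 q c κ * Real.log ‖z‖) -
    (Real.log ‖1 - (q : ℂ) / c‖ - κ * Real.log ‖1 - (q : ℂ) * c‖ -
      h2 q c κ * Real.log ‖(c : ℂ)‖) := by
  simp [S2bar, S2, Complex.log_re]

lemma G2bar_re (z : ℂ) : (G2bar q c z).re =
    (-Real.log ‖1 - q * z‖ - p2 q c * Real.log ‖z‖) -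
    (-Real.log ‖1 - (q : ℂ) * c‖ - p2 q c * Real.log ‖(c : ℂ)‖) := by
  simp [G2bar, G2, Complex.log_re]

end Deriv

/-! ### The factor `E_s` -/

section FracPow

variable {q c s : ℝ} {z : ℂ} {N : ℕ}

lemma norm_fracPow : ‖fracPow q s N z‖ = ‖1 - q * z‖ ^ Int.fract (s * N) := by
  rw [fracPow, Complex.norm_cpow_real]
  rfl

/-- The exponent is a fractional part, hence in `[0, 1)`, and this gives bounds uniform in `N`. -/
lemma norm_fracPow_le {B : ℝ} (hB : ‖1 - q * z‖ ≤ B) : ‖fracPow q s N z‖ ≤ max 1 B := by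
  rw [norm_fracPow]
  have h0 := Int.fract_nonneg (s * N)
  calc ‖1 - q * z‖ ^ Int.fract (s * N) ≤ (max 1 B) ^ Int.fract (s * N) := by
        gcongr
        exact hB.trans (le_max_right _ _)
    _ ≤ (max 1 B) ^ (1 : ℝ) :=
        Real.rpow_le_rpow_of_exponent_le (le_max_left _ _) (Int.fract_lt_one _).le
    _ = _ := Real.rpow_one _

lemma le_norm_fracPow {B : ℝ} (hB0 : 0 < B) (hB : B ≤ ‖1 - q * z‖) :
    min 1 B ≤ ‖fracPow q s N z‖ := by
  rw [norm_fracPow]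
  have h0 := Int.fract_nonneg (s * N)
  have hm : 0 < min 1 B := lt_min one_pos hB0
  calc min 1 B = (min 1 B) ^ (1 : ℝ) := (Real.rpow_one _).symm
    _ ≤ (min 1 B) ^ Int.fract (s * N) :=
        Real.rpow_le_rpow_of_exponent_ge hm (min_le_left _ _) (Int.fract_lt_one _).le
    _ ≤ _ := by
        gcongr
        exact (min_le_right _ _).trans hB

lemma fracPow_ne_zero (hq : 0 < q) (hz : z ∈ regularDomain q) : fracPow q s N z ≠ 0 := by
  rw [fracPow, Complex.cpow_ne_zero_iff]
  exact Or.inl (Complex.slitPlane_ne_zero (one_sub_mul_mem_slitPlane hq hz))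

lemma differentiableOn_fracPow (hq : 0 < q) :
    DifferentiableOn ℂ (fracPow q s N) (regularDomain q) := fun _ hz =>
  DifferentiableAt.differentiableWithinAt <|
    ((differentiableAt_const 1).sub (differentiableAt_id.const_mul (q : ℂ))).cpow_const
      (one_sub_mul_mem_slitPlane hq hz)

/-- The exponent oscillates with `N`, so `E_s` itself need not converge. In the quotient it
multiplies a difference of logarithms that tends to `0`, and it is bounded by `1`. -/
lemma tendsto_fracPow_div (h : IsParam q c) {zs : ℕ → ℂ} (hz : Tendsto zs atTop (𝓝 (c : ℂ))) :
    Tendsto (fun N => fracPow q s N (zs N) / fracPow q s N c) atTop (𝓝 1) := by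
  have hlog : Tendsto (fun N => Complex.log (1 - q * zs N) - Complex.log (1 - q * c)) atTop
      (𝓝 0) := by
    have h1 := (hasDerivAt_log_one_sub_mul h.q_pos h.mem_regularDomain).continuousAt.tendsto.comp hz
    simpa using h1.sub_const (Complex.log (1 - q * c))
  have h2 : Tendsto (fun N : ℕ => ((s * N - ⌊s * N⌋ : ℝ) : ℂ) *
      (Complex.log (1 - q * zs N) - Complex.log (1 - q * c))) atTop (𝓝 0) := by
    refine squeeze_zero_norm (fun N => ?_) (tendsto_zero_iff_norm_tendsto_zero.1 hlog)
    rw [norm_mul, Complex.norm_real]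
    refine mul_le_of_le_one_left (norm_nonneg _) ?_
    rw [Int.self_sub_floor, Real.norm_of_nonneg (Int.fract_nonneg (s * N))]
    exact (Int.fract_lt_one (s * N)).le
  have h3 := (Complex.continuous_exp.tendsto 0).comp h2
  rw [Complex.exp_zero] at h3
  refine h3.congr' ?_
  filter_upwards [hz.eventually ((isOpen_regularDomain q).eventually_mem h.mem_regularDomain)]
    with N hN
  rw [fracPow, fracPow, Complex.cpow_def_of_ne_zero
    (Complex.slitPlane_ne_zero (one_sub_mul_mem_slitPlane h.q_pos hN)),
    Complex.cpow_def_of_ne_zero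
    (Complex.slitPlane_ne_zero (one_sub_mul_mem_slitPlane h.q_pos h.mem_regularDomain)),
    ← Complex.exp_sub, Function.comp_apply]
  congr 1
  ring

end FracPow

/-! ### The small circles -/

section Small

variable {q c κ : ℝ}

lemma sqrt_mul_zc_sub (hq : 0 < q) : √κ * (zc q κ - q) = 1 - q * zc q κ := by
  have : 0 < q + √κ := by positivity
  rw [zc]
  field_simp
  ring

lemma one_lt_zc (h : IsParam q c) (hκ1 : κ < 1) : 1 < zc q κ := by
  have h1 : √κ < 1 := by simpa using (Real.sqrt_lt_sqrt_iff_of_pos one_pos).2 hκ1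
  have : 0 < q + √κ := by linarith [h.q_pos, Real.sqrt_nonneg κ]
  rw [zc, lt_div_iff₀ this]
  nlinarith [h.q_lt_one]

lemma one_sub_lt_sqrt (h : IsParam q c) (hκ : kappa0 q c < κ) :
    1 - q * c < √κ * (c - q) := by
  rw [← div_lt_iff₀ h.sub_pos]
  exact Real.lt_sqrt_of_sq_lt hκ

lemma zc_lt (h : IsParam q c) (hκ : kappa0 q c < κ) : zc q κ < c := by
  have h1 := one_sub_lt_sqrt h hκ
  have : 0 < q + √κ := by linarith [h.q_pos, Real.sqrt_nonneg κ]
  rw [zc, div_lt_iff₀ this]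
  linarith

/-- The derivative factors through `c - x` and `(1 - qx)(1 - qc) - κ(x - q)(c - q)`. The second
factor is negative from `z_c(κ)` on, because `z_c(κ)` solves `1 - qx = √κ (x - q)` while `1 - qc <
√κ (c - q)`. -/
lemma strictAntiOn_S2_real (h : IsParam q c) (hκ : kappa0 q c < κ) (hκ1 : κ < 1) :
    StrictAntiOn (fun x : ℝ => Real.log (1 - q / x) - κ * Real.log (1 - q * x) -
      h2 q c κ * Real.log x) (Set.Icc (zc q κ) c) := by
  have hz := one_lt_zc h hκ1
  have hq := h.q_pos
  have hκ0 : 0 < κ := h.kappa0_pos.trans hκ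
  have hpos : ∀ x ∈ Set.Icc (zc q κ) c, 0 < x ∧ 0 < x - q ∧ 0 < 1 - q * x := by
    intro x hx
    refine ⟨by linarith [hx.1], by linarith [hx.1, h.q_lt_one], ?_⟩
    nlinarith [hx.2, h.mul_lt_one]
  have hd : ∀ x ∈ Set.Icc (zc q κ) c, HasDerivAt (fun x : ℝ => Real.log (1 - q / x) -
      κ * Real.log (1 - q * x) - h2 q c κ * Real.log x)
      (q / x ^ 2 / (1 - q / x) - κ * (-q / (1 - q * x)) - h2 q c κ * x⁻¹) x := by
    intro x hx
    obtain ⟨h1, h2, h3⟩ := hpos x hx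
    have d1 : HasDerivAt (fun x : ℝ => 1 - q / x) (q / x ^ 2) x := by
      simpa [div_eq_mul_inv] using ((hasDerivAt_inv h1.ne').const_mul q).const_sub 1
    have d2 : HasDerivAt (fun x : ℝ => 1 - q * x) (-q) x := by
      simpa using ((hasDerivAt_id x).const_mul q).const_sub 1
    have h4 : 1 - q / x ≠ 0 := by
      rw [one_sub_div h1.ne']
      positivity
    exact ((d1.log h4).sub ((d2.log h3.ne').const_mul κ)).sub
      ((Real.hasDerivAt_log h1.ne').const_mul _)
  refine strictAntiOn_of_deriv_neg (convex_Icc _ _)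
    (fun x hx => (hd x hx).continuousAt.continuousWithinAt) fun x hx => ?_
  rw [interior_Icc] at hx
  have hx' := Set.Ioo_subset_Icc_self hx
  obtain ⟨h1, h2, h3⟩ := hpos x hx'
  have hc := h.one_sub_pos
  have hcq := h.sub_pos
  rw [(hd x hx').deriv]
  have h4 : 1 - q / x ≠ 0 := by
    rw [one_sub_div h1.ne']
    positivity
  have key : (1 - q * x) * (1 - q * c) < κ * ((x - q) * (c - q)) := by
    have e1 : 1 - q * x ≤ √κ * (x - q) := by
      have := sqrt_mul_zc_sub (κ := κ) hq
      nlinarith [hx.1, Real.sqrt_nonneg κ]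
    calc (1 - q * x) * (1 - q * c) < (1 - q * x) * (√κ * (c - q)) := by
          gcongr; exact one_sub_lt_sqrt h hκ
      _ ≤ (√κ * (x - q)) * (√κ * (c - q)) := by gcongr
      _ = (√κ * √κ) * ((x - q) * (c - q)) := by ring
      _ = _ := by rw [Real.mul_self_sqrt hκ0.le]
  have e : q / x ^ 2 / (1 - q / x) - κ * (-q / (1 - q * x)) - TopCurve.h2 q c κ * x⁻¹ =
      q * (c - x) / (x * ((x - q) * (c - q)) * ((1 - q * x) * (1 - q * c))) *
        ((1 - q * x) * (1 - q * c) - κ * ((x - q) * (c - q))) := by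
    rw [one_sub_div h1.ne', TopCurve.h2, p2]
    field_simp
    ring
  rw [e]
  apply mul_neg_of_pos_of_neg _ (by linarith)
  have := hx.2
  have : 0 < c - x := by linarith
  positivity

/-- On the circle of radius `z_c(κ)` the real part of `S̄₂` is bounded below by a positive
constant. -/
lemma exists_le_S2bar_re_circle (h : IsParam q c) (hκ : kappa0 q c < κ) (hκ1 : κ < 1) :
    ∃ δ > 0, ∀ w : ℂ, ‖w‖ = zc q κ → δ ≤ (S2bar q c κ w).re := by
  set r := zc q κ with hr
  have hr1 : 1 < r := one_lt_zc h hκ1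
  have hrc : r < c := zc_lt h hκ
  have hq := h.q_pos
  have hκ0 : 0 < κ := h.kappa0_pos.trans hκ
  have hanti := strictAntiOn_S2_real h hκ hκ1 ⟨le_rfl, hrc.le⟩ ⟨hrc.le, le_rfl⟩ hrc
  simp only at hanti
  rw [← hr] at hanti
  have hrq : 0 < r - q := by linarith [h.q_lt_one]
  have h1qr : 0 < 1 - q * r := by nlinarith [h.mul_lt_one]
  refine ⟨_, _root_.sub_pos.2 hanti, fun w hw => ?_⟩
  have hc1 : ‖1 - (q : ℂ) / c‖ = 1 - q / c := by
    have : (1 - (q : ℂ) / c) = ((1 - q / c : ℝ) : ℂ) := by push_cast; rfl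
    rw [this, Complex.norm_real, Real.norm_of_nonneg]
    rw [one_sub_div h.c_pos.ne']
    exact (div_pos h.sub_pos h.c_pos).le
  have hc2 : ‖1 - (q : ℂ) * c‖ = 1 - q * c := by
    have : (1 - (q : ℂ) * c) = ((1 - q * c : ℝ) : ℂ) := by push_cast; rfl
    rw [this, Complex.norm_real, Real.norm_of_nonneg h.one_sub_pos.le]
  have hc3 : ‖(c : ℂ)‖ = c := by rw [Complex.norm_real, Real.norm_of_nonneg h.c_pos.le]
  rw [S2bar_re, hc1, hc2, hc3, hw]
  suffices Real.log (1 - q / r) - κ * Real.log (1 - q * r) ≤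
      Real.log ‖1 - q / w‖ - κ * Real.log ‖1 - q * w‖ by linarith
  have hw0 : w ≠ 0 := norm_pos_iff.1 (by rw [hw]; linarith)
  have hnormsq : w.re ^ 2 + w.im ^ 2 = r ^ 2 := by
    rw [← hw, Complex.sq_norm, Complex.normSq_apply]; ring
  have hre : w.re ≤ r := hw ▸ Complex.re_le_norm w
  -- On the circle, `|w - q|²` and `|1 - qw|²` exceed their values at `w = r` by the same amount
  -- `τ`.
  set τ : ℝ := 2 * q * (r - w.re) with hτ
  have hτ0 : 0 ≤ τ := by have : 0 ≤ r - w.re := by linarith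
                         positivity
  have hX : ‖w - q‖ ^ 2 = (r - q) ^ 2 + τ := by
    rw [Complex.sq_norm, Complex.normSq_apply]
    simp only [Complex.sub_re, Complex.sub_im, Complex.ofReal_re, Complex.ofReal_im]
    rw [hτ]; linear_combination hnormsq
  have hκy : (1 - q * r) ^ 2 = κ * (r - q) ^ 2 := by
    rw [← sqrt_mul_zc_sub hq, ← hr, mul_pow, Real.sq_sqrt hκ0.le]
  have hY : ‖1 - q * w‖ ^ 2 = κ * (r - q) ^ 2 + τ := by
    rw [← hκy, Complex.sq_norm, Complex.normSq_apply]
    simp only [Complex.sub_re, Complex.sub_im, Complex.one_re, Complex.one_im, Complex.mul_re,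
      Complex.mul_im, Complex.ofReal_re, Complex.ofReal_im]
    rw [hτ]; linear_combination q ^ 2 * hnormsq
  have e1 : Real.log ‖1 - q / w‖ = Real.log ((r - q) ^ 2 + τ) / 2 - Real.log r := by
    rw [one_sub_div hw0, norm_div, hw, ← hX, Real.log_div, Real.log_pow]
    · push_cast; ring
    · have : 0 < ‖w - q‖ ^ 2 := by rw [hX]; positivity
      intro h0
      rw [h0] at this
      norm_num at this
    · linarith
  have e2 : Real.log ‖1 - q * w‖ = Real.log (κ * (r - q) ^ 2 + τ) / 2 := by
    rw [← hY, Real.log_pow]; push_cast; ring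
  have e3 : Real.log (1 - q / r) = Real.log ((r - q) ^ 2) / 2 - Real.log r := by
    rw [one_sub_div (by linarith), Real.log_div hrq.ne' (by linarith), Real.log_pow]
    push_cast; ring
  have e4 : Real.log (1 - q * r) = Real.log (κ * (r - q) ^ 2) / 2 := by
    rw [← hκy, Real.log_pow]; push_cast; ring
  rw [e1, e2, e3, e4]
  have hx0 : 0 < (r - q) ^ 2 := by positivity
  -- Thanks to `(1 - qr)² = κ(r - q)²` this is Bernoulli's inequality `(1 + τ/(κX))^κ ≤ 1 + τ/X`
  -- with `X = (r - q)²`, where `κ ≤ 1` is needed. So the minimum over the circle is at `w = r`, and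
  -- the real monotonicity finishes.
  have key : κ * (Real.log (κ * (r - q) ^ 2 + τ) - Real.log (κ * (r - q) ^ 2)) ≤
      Real.log ((r - q) ^ 2 + τ) - Real.log ((r - q) ^ 2) := by
    rw [← Real.log_div (by positivity) (by positivity), ← Real.log_div (by positivity) hx0.ne',
      ← Real.log_rpow (by positivity)]
    refine Real.log_le_log (by positivity) ?_
    have hb := rpow_one_add_le_one_add_mul_self (s := τ / (κ * (r - q) ^ 2)) (p := κ)
      ((by norm_num : (-1 : ℝ) ≤ 0).trans (by positivity)) hκ0.le hκ1.le
    convert hb using 1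
    · congr 1; field_simp
    · field_simp
  linarith

end Small

/-! ### Points on rays -/

section Ray

variable {q c κ x θ φ u R : ℝ}

lemma rayPoint_re : (rayPoint x θ u).re = x + u * Real.cos θ := by
  simp [rayPoint, Complex.exp_ofReal_mul_I_re]

lemma rayPoint_im : (rayPoint x θ u).im = u * Real.sin θ := by
  simp [rayPoint, Complex.exp_ofReal_mul_I_im]

lemma rayPoint_zero : rayPoint x θ 0 = x := by simp [rayPoint]

lemma norm_rayPoint_sub (hu : 0 ≤ u) : ‖rayPoint x θ u - x‖ = u := by
  rw [rayPoint, add_sub_cancel_left, norm_mul, Complex.norm_exp_ofReal_mul_I, mul_one,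
    Complex.norm_real, Real.norm_of_nonneg hu]

lemma exists_rayPoint_of_mem_segment {u₁ u₂ : ℝ} (hu : u₁ ≤ u₂) {z : ℂ}
    (hz : z ∈ segment ℝ (rayPoint x θ u₁) (rayPoint x θ u₂)) :
    ∃ u ∈ Set.Icc u₁ u₂, z = rayPoint x θ u := by
  rw [segment_eq_image'] at hz
  obtain ⟨t, ht, rfl⟩ := hz
  refine ⟨u₁ + t * (u₂ - u₁), ⟨?_, ?_⟩, ?_⟩
  · nlinarith [ht.1]
  · nlinarith [ht.2]
  · simp only [rayPoint, Complex.real_smul]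
    push_cast
    ring

lemma rayLength_pos (hc : 0 < c) (hR : c < R) : 0 < rayLength c θ R := by
  have h1 : c * Real.cos θ < √(R ^ 2 - c ^ 2 * Real.sin θ ^ 2) := by
    refine Real.lt_sqrt_of_sq_lt ?_
    have := Real.sin_sq_add_cos_sq θ
    nlinarith
  rw [rayLength]
  linarith

lemma rayLength_le (hc : 0 ≤ c) (hθ : 0 ≤ Real.cos θ) (hR : 0 ≤ R) : rayLength c θ R ≤ R := by
  have h1 : √(R ^ 2 - c ^ 2 * Real.sin θ ^ 2) ≤ R := by
    refine Real.sqrt_le_iff.2 ⟨hR, ?_⟩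
    nlinarith [mul_nonneg (sq_nonneg c) (sq_nonneg (Real.sin θ))]
  rw [rayLength]
  nlinarith [mul_nonneg hc hθ]

lemma le_norm_rayPoint (hu : 0 ≤ u) (hθ : 0 ≤ Real.cos θ) : c ≤ ‖rayPoint c θ u‖ := by
  refine le_trans ?_ (Complex.re_le_norm _)
  rw [rayPoint_re]
  nlinarith [mul_nonneg hu hθ]

end Ray

/-! ### Descent along rays

With `a = c - q`, `b = q⁻¹ - c` and `ρ = cos θ`, the real part of `S₂(κ, c + u e^{iθ})` is
`rayExponent a b c κ ρ u` up to an additive constant. -/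

/-- The squared distance from `a + u e^{iθ}` to the origin, `ρ = cos θ`. -/
def raySq (a ρ u : ℝ) : ℝ := a ^ 2 + 2 * a * ρ * u + u ^ 2

def rayExponent (a b c κ ρ u : ℝ) : ℝ :=
  Real.log (raySq a ρ u) / 2 - κ * (Real.log (raySq (-b) ρ u) / 2) -
    (c / a + κ * (c / b)) * (Real.log (raySq c ρ u) / 2)

/-- The numerator of the derivative of `rayExponent`. -/
def rayNumerator (a b c κ ρ u : ℝ) : ℝ :=
  (c - a) / a * (a * c * (1 - 2 * ρ ^ 2) - ρ * (a + c) * u - u ^ 2) * raySq (-b) ρ u -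
    κ * (b + c) / b * (b * c * (1 - 2 * ρ ^ 2) + ρ * (c - b) * u + u ^ 2) * raySq a ρ u

section Descent

variable {a b c κ ρ u U : ℝ}

lemma raySq_eq : raySq a ρ u = (u + a * ρ) ^ 2 + a ^ 2 * (1 - ρ ^ 2) := by
  rw [raySq]; ring

lemma raySq_pos (ha : a ≠ 0) (hρ : ρ ^ 2 < 1) : 0 < raySq a ρ u := by
  rw [raySq_eq]
  have : 0 < 1 - ρ ^ 2 := by linarith
  positivity

lemma hasDerivAt_log_raySq (ha : a ≠ 0) (hρ : ρ ^ 2 < 1) :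
    HasDerivAt (fun u => Real.log (raySq a ρ u) / 2) ((a * ρ + u) / raySq a ρ u) u := by
  have h1 : HasDerivAt (fun u => raySq a ρ u) (2 * a * ρ + 2 * u) u := by
    have := (((hasDerivAt_id u).const_mul (2 * a * ρ)).const_add (a ^ 2)).add
      ((hasDerivAt_id u).pow 2)
    exact this.congr_deriv (by simp)
  have h0 := (raySq_pos (u := u) ha hρ).ne'
  refine ((h1.log h0).div_const 2).congr_deriv ?_
  field_simp

/-- Since `c` is critical, the derivative along the ray vanishes at `u = 0`. Pulling out this factor
`u` and the positive denominators leaves `rayNumerator`. -/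
lemma strictAntiOn_rayExponent (ha : 0 < a) (hb : 0 < b) (hc : 0 < c) (hρ : ρ ^ 2 < 1)
    (hneg : ∀ u ∈ Set.Ioc 0 U, rayNumerator a b c κ ρ u < 0) :
    StrictAntiOn (rayExponent a b c κ ρ) (Set.Icc 0 U) := by
  have hd : ∀ u, HasDerivAt (rayExponent a b c κ ρ)
      (u / (raySq a ρ u * raySq (-b) ρ u * raySq c ρ u) * rayNumerator a b c κ ρ u) u := by
    intro u
    have h1 := hasDerivAt_log_raySq (u := u) ha.ne' hρ
    have h2 := hasDerivAt_log_raySq (u := u) (neg_ne_zero.2 hb.ne') hρ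
    have h3 := hasDerivAt_log_raySq (u := u) hc.ne' hρ
    refine ((h1.sub (h2.const_mul κ)).sub (h3.const_mul (c / a + κ * (c / b)))).congr_deriv ?_
    have e1 := (raySq_pos (u := u) ha.ne' hρ).ne'
    have e2 := (raySq_pos (u := u) (neg_ne_zero.2 hb.ne') hρ).ne'
    have e3 := (raySq_pos (u := u) hc.ne' hρ).ne'
    -- Each of the other two logarithms is paired with its own share of `log |z|`, so that each pair
    -- vanishes at `u = 0` separately.
    have k1 : (a * ρ + u) / raySq a ρ u - c / a * ((c * ρ + u) / raySq c ρ u) =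
        u / (raySq a ρ u * raySq c ρ u) *
          ((c - a) / a * (a * c * (1 - 2 * ρ ^ 2) - ρ * (a + c) * u - u ^ 2)) := by
      field_simp
      simp only [raySq]
      ring
    have k2 : (-b * ρ + u) / raySq (-b) ρ u + c / b * ((c * ρ + u) / raySq c ρ u) =
        u / (raySq (-b) ρ u * raySq c ρ u) *
          ((b + c) / b * (b * c * (1 - 2 * ρ ^ 2) + ρ * (c - b) * u + u ^ 2)) := by
      field_simp
      simp only [raySq]
      ring
    calc _ = ((a * ρ + u) / raySq a ρ u - c / a * ((c * ρ + u) / raySq c ρ u)) -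
          κ * ((-b * ρ + u) / raySq (-b) ρ u + c / b * ((c * ρ + u) / raySq c ρ u)) := by ring
      _ = _ := by
        rw [k1, k2, rayNumerator]
        generalize raySq a ρ u = X at *
        generalize raySq (-b) ρ u = Y at *
        generalize raySq c ρ u = Z at *
        field_simp
  refine strictAntiOn_of_deriv_neg (convex_Icc _ _)
    (fun u _ => (hd u).continuousAt.continuousWithinAt) fun u hu => ?_
  rw [interior_Icc] at hu
  rw [(hd u).deriv]
  refine mul_neg_of_pos_of_neg (div_pos hu.1 ?_) (hneg u ⟨hu.1, hu.2.le⟩)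
  exact mul_pos (mul_pos (raySq_pos ha.ne' hρ) (raySq_pos (neg_ne_zero.2 hb.ne') hρ))
    (raySq_pos hc.ne' hρ)

/-- Here the angle is fixed by `1 - 2ρ² = m` with `m` small. The part of order `m` is negative at `u
= 0` by `hd`; its possible growth in `u²` is beaten by the term `-(c - a)/a · u²`, and `b ≤ c` gives
the remaining term its sign. -/
lemma exists_rayNumerator_neg_of_le (ha : 0 < a) (hb : 0 < b) (hc : 0 < c) (hac : a < c)
    (hκ : 0 < κ) (hbc : b ≤ c) (hd : (c - a) * b ^ 2 < κ * (b + c) * a ^ 2) :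
    ∃ ρ : ℝ, 0 < ρ ∧ ρ ^ 2 < 1 / 2 ∧ ∀ u > 0, rayNumerator a b c κ ρ u < 0 := by
  -- The first bound keeps `(1 - m) / 2` positive; the second gives `m c ≤ b² / (2a)`, exactly what
  -- absorbs the growth in `u²`.
  set m : ℝ := min (1 / 2) (b ^ 2 / (2 * a * c)) with hm
  have hm0 : 0 < m := lt_min (by norm_num) (by positivity)
  have hm1 : m ≤ 1 / 2 := min_le_left _ _
  have hm2 : m * c ≤ b ^ 2 / (2 * a) := by
    calc m * c ≤ b ^ 2 / (2 * a * c) * c := by gcongr; exact min_le_right _ _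
      _ = b ^ 2 / (2 * a) := by field_simp
  have hsq : √((1 - m) / 2) ^ 2 = (1 - m) / 2 := Real.sq_sqrt (by linarith)
  have hpos : 0 < √((1 - m) / 2) := Real.sqrt_pos.2 (by linarith)
  refine ⟨√((1 - m) / 2), hpos, by rw [hsq]; linarith, fun u hu => ?_⟩
  set ρ := √((1 - m) / 2) with hρ
  have hmρ : 1 - 2 * ρ ^ 2 = m := by rw [hsq]; ring
  have hA : a ^ 2 ≤ raySq a ρ u := by
    rw [raySq]
    have : 0 ≤ 2 * a * ρ * u + u ^ 2 := by positivity
    linarith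
  have hB : b ^ 2 / 2 ≤ raySq (-b) ρ u := by
    rw [raySq_eq]
    have : (0 : ℝ) ≤ b ^ 2 * m / 2 := by positivity
    nlinarith [sq_nonneg (u + -b * ρ)]
  have hB' : raySq (-b) ρ u ≤ b ^ 2 + u ^ 2 := by
    rw [raySq]
    have : 0 ≤ 2 * b * ρ * u := by positivity
    linarith
  have hca : 0 < c - a := by linarith
  have hcb : 0 ≤ c - b := by linarith
  have e : rayNumerator a b c κ ρ u =
      m * c * ((c - a) * raySq (-b) ρ u - κ * (b + c) * raySq a ρ u) -
      (c - a) / a * (ρ * (a + c) * u + u ^ 2) * raySq (-b) ρ u -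
      κ * (b + c) / b * (ρ * (c - b) * u + u ^ 2) * raySq a ρ u := by
    rw [rayNumerator, hmρ]
    field_simp
    ring
  have h1 : m * c * ((c - a) * raySq (-b) ρ u - κ * (b + c) * raySq a ρ u) <
      m * c * ((c - a) * u ^ 2) := by
    gcongr
    have : κ * (b + c) * a ^ 2 ≤ κ * (b + c) * raySq a ρ u := by gcongr
    have : (c - a) * raySq (-b) ρ u ≤ (c - a) * (b ^ 2 + u ^ 2) := by gcongr
    linarith
  have h2 : (c - a) / a * u ^ 2 * (b ^ 2 / 2) ≤
      (c - a) / a * (ρ * (a + c) * u + u ^ 2) * raySq (-b) ρ u := by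
    gcongr
    have : 0 ≤ ρ * (a + c) * u := by positivity
    linarith
  have h3 : 0 ≤ κ * (b + c) / b * (ρ * (c - b) * u + u ^ 2) * raySq a ρ u := by
    have := (sq_nonneg a).trans hA
    positivity
  have h4 : m * c * ((c - a) * u ^ 2) ≤ (c - a) / a * u ^ 2 * (b ^ 2 / 2) := by
    calc _ ≤ b ^ 2 / (2 * a) * ((c - a) * u ^ 2) := by gcongr
      _ = _ := by field_simp
  rw [e]
  linarith

/-- For the vertical ray, `ρ = 0`, the numerator is a polynomial in `u²` whose constant term is
negative by `hd` and whose other coefficients are nonpositive because `c ≤ b`. Compactness of `[0,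
U]` allows a small tilt `ρ > 0`. -/
lemma exists_rayNumerator_neg_of_ge (ha : 0 < a) (hb : 0 < b) (hc : 0 < c) (hac : a < c)
    (hκ : 0 < κ) (hcb : c ≤ b) (hd : (c - a) * b ^ 2 < κ * (b + c) * a ^ 2) (U : ℝ) :
    ∃ ρ : ℝ, 0 < ρ ∧ ρ ^ 2 < 1 / 2 ∧ ∀ u ∈ Set.Icc 0 U, rayNumerator a b c κ ρ u < 0 := by
  have h0 : ∀ u : ℝ, rayNumerator a b c κ 0 u < 0 := by
    intro u
    have hca : 0 < c - a := by linarith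
    have e : rayNumerator a b c κ 0 u =
        c * ((c - a) * b ^ 2 - κ * (b + c) * a ^ 2) +
        u ^ 2 * ((c - a) / a * (a * c - b ^ 2) - κ * (b + c) / b * (b * c + a ^ 2)) -
        u ^ 4 * ((c - a) / a + κ * (b + c) / b) := by
      rw [rayNumerator, raySq, raySq]
      field_simp
      ring
    have h1 : (c - a) / a * (a * c - b ^ 2) ≤ κ * (b + c) / b * (b * c + a ^ 2) := by
      calc (c - a) / a * (a * c - b ^ 2) ≤ (c - a) * b / a ^ 2 * (b * c + a ^ 2) := by
            rw [← sub_nonneg]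
            have : (c - a) * b / a ^ 2 * (b * c + a ^ 2) - (c - a) / a * (a * c - b ^ 2) =
              (c - a) / a ^ 2 * (b ^ 2 * c + a * b ^ 2 + a ^ 2 * (b - c)) := by
              field_simp; ring
            rw [this]
            have : 0 ≤ b - c := by linarith
            positivity
        _ ≤ κ * (b + c) / b * (b * c + a ^ 2) := by
            gcongr ?_ * _
            rw [div_le_div_iff₀ (by positivity) hb]
            linarith
    have h2 : 0 ≤ u ^ 4 * ((c - a) / a + κ * (b + c) / b) := by positivity
    have h3 : u ^ 2 * ((c - a) / a * (a * c - b ^ 2) - κ * (b + c) / b * (b * c + a ^ 2)) ≤ 0 :=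
      mul_nonpos_of_nonneg_of_nonpos (sq_nonneg u) (by linarith)
    have h4 : c * ((c - a) * b ^ 2 - κ * (b + c) * a ^ 2) < 0 :=
      mul_neg_of_pos_of_neg hc (by linarith)
    rw [e]
    linarith
  have hcont : Continuous fun p : ℝ × ℝ => rayNumerator a b c κ p.1 p.2 := by
    unfold rayNumerator raySq
    fun_prop
  have hev : ∀ᶠ ρ in 𝓝 (0 : ℝ), ∀ u ∈ Set.Icc 0 U, rayNumerator a b c κ ρ u < 0 := by
    refine isCompact_Icc.eventually_forall_of_forall_eventually fun u _ => ?_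
    exact hcont.continuousAt.eventually_lt continuousAt_const (h0 u)
  have hev2 : ∀ᶠ ρ in 𝓝 (0 : ℝ), ρ ^ 2 < 1 / 2 := by
    have : ContinuousAt (fun ρ : ℝ => ρ ^ 2) 0 := by fun_prop
    exact this.eventually_lt continuousAt_const (by norm_num)
  obtain ⟨ρ, ⟨h1, h2⟩, h3⟩ := (((hev.and hev2).filter_mono nhdsWithin_le_nhds).and
    (self_mem_nhdsWithin : Set.Ioi (0 : ℝ) ∈ 𝓝[>] 0)).exists
  exact ⟨ρ, h3, h2, h1⟩

end Descent

/-! ### Existence of admissible pairs -/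

section Existence

variable {q c κ θ u : ℝ}

lemma sq_norm_rayPoint_sub (d : ℝ) :
    ‖rayPoint c θ u - d‖ ^ 2 = raySq (c - d) (Real.cos θ) u := by
  rw [Complex.sq_norm, Complex.normSq_apply, Complex.sub_re, Complex.sub_im, rayPoint_re,
    rayPoint_im, raySq, Complex.ofReal_re, Complex.ofReal_im]
  linear_combination u ^ 2 * Real.sin_sq_add_cos_sq θ

lemma S2_re_rayPoint (h : IsParam q c) (hθ : Real.cos θ ^ 2 < 1) :
    (S2 q c κ (rayPoint c θ u)).re =
      rayExponent (c - q) (q⁻¹ - c) c κ (Real.cos θ) u - κ * Real.log q := by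
  have hq := h.q_pos
  have hb : 0 < q⁻¹ - c := by
    have : q⁻¹ - c = (1 - q * c) / q := by field_simp
    rw [this]; exact div_pos h.one_sub_pos hq
  have n1 := sq_norm_rayPoint_sub (c := c) (θ := θ) (u := u) q
  have n2 := sq_norm_rayPoint_sub (c := c) (θ := θ) (u := u) q⁻¹
  have n3 := sq_norm_rayPoint_sub (c := c) (θ := θ) (u := u) 0
  have p1 := raySq_pos (u := u) h.sub_pos.ne' hθ
  have p2' := raySq_pos (a := c - q⁻¹) (u := u) (by linarith) hθ
  have p3 := raySq_pos (a := c - 0) (u := u) (by simpa using h.c_pos.ne') hθ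
  rw [← n1] at p1
  rw [← n2] at p2'
  rw [← n3] at p3
  rw [Complex.ofReal_zero, sub_zero] at n3 p3
  rw [sub_zero] at n3
  generalize rayPoint c θ u = z at *
  have e1 : 0 < ‖z - q‖ := (norm_nonneg _).lt_of_ne' (sq_pos_iff.1 p1)
  have e2 : 0 < ‖z - (q⁻¹ : ℝ)‖ := (norm_nonneg _).lt_of_ne' (sq_pos_iff.1 p2')
  have e3 : 0 < ‖z‖ := (norm_nonneg _).lt_of_ne' (sq_pos_iff.1 p3)
  have hz0 : z ≠ 0 := norm_pos_iff.1 e3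
  have hqc : (q : ℂ) ≠ 0 := by exact_mod_cast hq.ne'
  have k1 : ‖1 - q / z‖ = ‖z - q‖ / ‖z‖ := by rw [one_sub_div hz0, norm_div]
  have k2 : ‖1 - q * z‖ = q * ‖z - (q⁻¹ : ℝ)‖ := by
    rw [show 1 - q * z = -(q * (z - (q⁻¹ : ℝ))) by push_cast; field_simp; ring, norm_neg, norm_mul,
      Complex.norm_real, Real.norm_of_nonneg hq.le]
  have hS : (S2 q c κ z).re = Real.log ‖1 - q / z‖ - κ * Real.log ‖1 - q * z‖ -
      h2 q c κ * Real.log ‖z‖ := by simp [S2, Complex.log_re]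
  rw [hS, k1, k2, Real.log_div e1.ne' e3.ne', Real.log_mul hq.ne' e2.ne', rayExponent,
    ← n1, neg_sub, ← n2, ← n3, Real.log_pow, Real.log_pow, Real.log_pow]
  have hh : h2 q c κ + 1 = c / (c - q) + κ * (c / (q⁻¹ - c)) := by
    have h1 := h.sub_pos.ne'
    have h2 := h.one_sub_pos.ne'
    rw [TopCurve.h2, p2, show q⁻¹ - c = (1 - q * c) / q by field_simp]
    field_simp
    ring
  rw [← hh]
  push_cast
  ring

lemma h2_pos (h : IsParam q c) (hκ : 0 < κ) : 0 < h2 q c κ := by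
  have := h.p2_pos
  have := div_pos h.q_pos h.sub_pos
  rw [h2]
  positivity

/-- Since `h₂ > 0`, the term `-h₂ log R` dominates for large `R`; `R ≥ 2/q` makes `log |1 - qz|`
nonnegative. -/
lemma exists_radius (h : IsParam q c) (hκ : 0 < κ) :
    ∃ R : ℝ, q⁻¹ < R ∧ ∀ z : ℂ, ‖z‖ = R → (S2bar q c κ z).re ≤ -1 := by
  have hq := h.q_pos
  have hh := h2_pos h hκ
  have hlim : Tendsto (fun R : ℝ => h2 q c κ * Real.log R) atTop atTop :=
    Real.tendsto_log_atTop.const_mul_atTop hh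
  obtain ⟨R, h1, h2⟩ := ((hlim.eventually_ge_atTop
    (Real.log 2 - (S2 q c κ c).re + 1)).and (eventually_ge_atTop (2 / q))).exists
  have hR : q⁻¹ < R := by
    refine lt_of_lt_of_le ?_ h2
    rw [inv_eq_one_div]
    gcongr
    norm_num
  have hq1 : 1 < q⁻¹ := (one_lt_inv₀ hq).2 h.q_lt_one
  refine ⟨R, hR, fun z hz => ?_⟩
  have e1 : Real.log ‖1 - q / z‖ ≤ Real.log 2 := by
    rcases eq_or_ne (1 - q / z) 0 with h0 | h0
    · rw [h0, norm_zero, Real.log_zero]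
      exact Real.log_nonneg (by norm_num)
    · refine Real.log_le_log (norm_pos_iff.2 h0) ((norm_sub_le _ _).trans ?_)
      rw [norm_one, norm_div, hz, Complex.norm_real, Real.norm_of_nonneg hq.le]
      have : q / R ≤ 1 := by
        rw [div_le_one (by linarith)]
        linarith [h.q_lt_one]
      linarith
  have e2 : 0 ≤ Real.log ‖1 - q * z‖ := by
    apply Real.log_nonneg
    rw [norm_sub_rev]
    refine le_trans ?_ (norm_sub_norm_le _ _)
    rw [norm_one, norm_mul, hz, Complex.norm_real, Real.norm_of_nonneg hq.le]
    have : q * (2 / q) ≤ q * R := by gcongr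
    rw [mul_div_cancel₀ _ hq.ne'] at this
    linarith
  have e3 : (S2bar q c κ z).re = Real.log ‖1 - q / z‖ - κ * Real.log ‖1 - q * z‖ -
      TopCurve.h2 q c κ * Real.log ‖z‖ - (S2 q c κ c).re := by
    simp [S2bar, S2, Complex.log_re]
  rw [e3, hz]
  have := mul_nonneg hκ.le e2
  linarith

lemma exists_angle (h : IsParam q c) (hκ : kappa0 q c < κ) (U : ℝ) :
    ∃ θ ∈ Set.Ioo (Real.pi / 4) (Real.pi / 2),
      ∀ u ∈ Set.Ioc 0 U, rayNumerator (c - q) (q⁻¹ - c) c κ (Real.cos θ) u < 0 := by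
  have hq := h.q_pos
  have hb' : q⁻¹ - c = (1 - q * c) / q := by field_simp
  have hb : 0 < q⁻¹ - c := by
    rw [hb']; exact div_pos h.one_sub_pos hq
  have hκ0 : 0 < κ := h.kappa0_pos.trans hκ
  -- With denominators cleared this is `κ₀ < κ`.
  have hd : (c - (c - q)) * (q⁻¹ - c) ^ 2 < κ * (q⁻¹ - c + c) * (c - q) ^ 2 := by
    have h1 := hκ
    rw [kappa0, div_pow, div_lt_iff₀ (pow_pos h.sub_pos 2)] at h1
    rw [hb', show (c - (c - q)) * ((1 - q * c) / q) ^ 2 = (1 - q * c) ^ 2 / q by field_simp; ring,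
      show κ * ((1 - q * c) / q + c) * (c - q) ^ 2 = κ * (c - q) ^ 2 / q by field_simp; ring]
    gcongr
  have hρ : ∃ ρ : ℝ, 0 < ρ ∧ ρ ^ 2 < 1 / 2 ∧
      ∀ u ∈ Set.Ioc 0 U, rayNumerator (c - q) (q⁻¹ - c) c κ ρ u < 0 := by
    rcases le_total (q⁻¹ - c) c with hbc | hbc
    · obtain ⟨ρ, h1, h2, h3⟩ := exists_rayNumerator_neg_of_le h.sub_pos hb h.c_pos
        (by linarith) hκ0 hbc hd
      exact ⟨ρ, h1, h2, fun u hu => h3 u hu.1⟩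
    · obtain ⟨ρ, h1, h2, h3⟩ := exists_rayNumerator_neg_of_ge h.sub_pos hb h.c_pos
        (by linarith) hκ0 hbc hd U
      exact ⟨ρ, h1, h2, fun u hu => h3 u (Set.Ioc_subset_Icc_self hu)⟩
  obtain ⟨ρ, h1, h2, h3⟩ := hρ
  have hcos : Real.cos (Real.arccos ρ) = ρ := Real.cos_arccos (by linarith) (by nlinarith)
  refine ⟨Real.arccos ρ, ⟨?_, Real.arccos_lt_pi_div_two.2 h1⟩, ?_⟩
  · by_contra! hle
    have h4 := Real.cos_le_cos_of_nonneg_of_le_pi (Real.arccos_nonneg ρ)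
      (by linarith [Real.pi_pos]) hle
    rw [hcos, Real.cos_pi_div_four] at h4
    have h5 : (√2 / 2) ^ 2 = (1 / 2 : ℝ) := by
      rw [div_pow, Real.sq_sqrt (by norm_num)]; norm_num
    have : (√2 / 2) ^ 2 ≤ ρ ^ 2 := by gcongr
    linarith
  · rwa [hcos]

theorem exists_isDescentPair (h : IsParam q c) (hκ : kappa0 q c < κ) :
    ∃ θ R : ℝ, IsDescentPair q c κ θ R := by
  have hκ0 : 0 < κ := h.kappa0_pos.trans hκ
  have hq := h.q_pos
  obtain ⟨R, hR, harc⟩ := exists_radius h hκ0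
  have hb : 0 < q⁻¹ - c := by
    rw [show q⁻¹ - c = (1 - q * c) / q by field_simp]; exact div_pos h.one_sub_pos hq
  have hcR : c < R := by linarith
  have hR0 : 0 < R := by linarith [h.c_pos]
  obtain ⟨θ, hθ, hneg⟩ := exists_angle h hκ R
  have hcos : 0 < Real.cos θ :=
    Real.cos_pos_of_mem_Ioo ⟨by linarith [hθ.1, Real.pi_pos], hθ.2⟩
  have hcos1 : Real.cos θ ^ 2 < 1 := by
    have : 0 < Real.sin θ := Real.sin_pos_of_pos_of_lt_pi (by linarith [hθ.1, Real.pi_pos])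
      (by linarith [hθ.2, Real.pi_pos])
    nlinarith [Real.sin_sq_add_cos_sq θ]
  have hanti := strictAntiOn_rayExponent h.sub_pos hb h.c_pos hcos1 hneg
  set f := rayExponent (c - q) (q⁻¹ - c) c κ (Real.cos θ) with hf
  -- The `1` comes from the arc, the difference from monotonicity along the rays. Truncating `ε` at
  -- `R` keeps it in the interval of monotonicity, which contains both rays.
  refine ⟨θ, R, hθ, hR, fun ε => min 1 (f 0 - f (min ε R)), fun ε hε => ⟨?_, ?_⟩⟩
  · refine lt_min one_pos (sub_pos.2 ?_)
    exact hanti ⟨le_rfl, hR0.le⟩ ⟨(lt_min hε hR0).le, min_le_right _ _⟩ (lt_min hε hR0)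
  · have hray : ∀ φ, Real.cos φ = Real.cos θ → ∀ u ∈ Set.Icc 0 R, ε ≤ ‖rayPoint c φ u - c‖ →
        (S2 q c κ (rayPoint c φ u) - S2 q c κ c).re ≤ -min 1 (f 0 - f (min ε R)) := by
      intro φ hφ u hu hεu
      rw [norm_rayPoint_sub hu.1] at hεu
      have hfc : (S2 q c κ c).re = f 0 - κ * Real.log q := by
        rw [← rayPoint_zero (x := c) (θ := θ), S2_re_rayPoint h hcos1]
      rw [Complex.sub_re, S2_re_rayPoint h (by rwa [hφ]), hφ, hfc]
      have h1 : f u ≤ f (min ε R) := hanti.antitoneOn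
        ⟨(lt_min hε hR0).le, min_le_right _ _⟩ hu ((min_le_left _ _).trans hεu)
      have h2 := min_le_right 1 (f 0 - f (min ε R))
      linarith
    have hL := rayLength_pos (θ := θ) h.c_pos hcR
    have hLR := rayLength_le (θ := θ) h.c_pos.le hcos.le hR0.le
    intro z hz hεz
    rcases hz with ((hz | hz) | hz) | hz
    · rw [segment_symm] at hz
      obtain ⟨u, hu, rfl⟩ := exists_rayPoint_of_mem_segment hL.le hz
      exact hray _ (Real.cos_neg θ) u ⟨hu.1, hu.2.trans hLR⟩ hεz
    · rw [rayPoint_zero, rayPoint_zero, segment_same, Set.mem_singleton_iff] at hz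
      rw [hz, sub_self, norm_zero] at hεz
      linarith
    · obtain ⟨u, hu, rfl⟩ := exists_rayPoint_of_mem_segment hL.le hz
      exact hray _ rfl u ⟨hu.1, hu.2.trans hLR⟩ hεz
    · obtain ⟨φ, _, rfl⟩ := hz
      have h1 := harc _ (norm_circlePoint hR0.le φ)
      rw [S2bar] at h1
      linarith [min_le_left 1 (f 0 - f (min ε R))]

end Existence

/-! ### Elementary limits -/

lemma tendsto_sqrt_mul_exp_atTop {E : ℕ → ℝ} (hE : Tendsto E atTop atTop) (K : ℝ) :
    Tendsto (fun N : ℕ => √(N : ℝ) * Real.exp (√(N : ℝ) * (K - E N))) atTop (𝓝 0) := by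
  have h1 : Tendsto (fun N : ℕ => √(N : ℝ) ^ 1 * Real.exp (-√(N : ℝ))) atTop (𝓝 0) :=
    (Real.tendsto_pow_mul_exp_neg_atTop_nhds_zero 1).comp tendsto_sqrt_natCast_atTop
  refine squeeze_zero' (Eventually.of_forall fun N => by positivity) ?_ h1
  filter_upwards [hE.eventually_ge_atTop (K + 1)] with N hN
  rw [pow_one]
  gcongr
  nlinarith [Real.sqrt_nonneg (N : ℝ)]

lemma tendsto_sqrt_mul_exp {δ : ℝ} (hδ : 0 < δ) (K : ℝ) :
    Tendsto (fun N : ℕ => √(N : ℝ) * Real.exp (-(N * δ) + √(N : ℝ) * K)) atTop (𝓝 0) := by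
  refine (tendsto_sqrt_mul_exp_atTop
    (tendsto_sqrt_natCast_atTop.const_mul_atTop hδ) K).congr fun N => ?_
  congr 2
  have := Real.mul_self_sqrt (Nat.cast_nonneg (α := ℝ) N)
  linear_combination (-δ) * this

/-- At `N = 0` both sides are `0`. -/
lemma natCast_rpow_neg_half (N : ℕ) : (N : ℝ) ^ (-(1 / 2) : ℝ) = (√(N : ℝ))⁻¹ := by
  rw [Real.rpow_neg (Nat.cast_nonneg N), Real.sqrt_eq_rpow]

/-! ### The exponential weight -/

/-- The modulus of `exp(N S̄₂(κ, z) - σ₂ x N^{1/2} log(z/c))`. -/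
def weight (q c κ : ℝ) (N : ℕ) (x : ℝ) (z : ℂ) : ℝ :=
  Real.exp (N * (S2bar q c κ z).re - scale q c N * x * Real.log ‖z / c‖)

section Weight

variable {q c κ θ R x X : ℝ} {N : ℕ} {z : ℂ}

lemma weight_le (h : IsParam q c) (hx : |x| ≤ X) (hz : c ≤ ‖z‖) :
    weight q c κ N x z ≤
      Real.exp (N * (S2bar q c κ z).re + √(N : ℝ) * (sigma2 q c * X / c * ‖z - c‖)) := by
  rw [weight]
  refine Real.exp_le_exp.2 ?_
  have h1 : -(scale q c N * x * Real.log ‖z / c‖) ≤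
      √(N : ℝ) * (sigma2 q c * X / c * ‖z - c‖) := by
    refine (neg_le_abs _).trans ?_
    rw [scale, abs_mul, abs_mul, abs_mul, abs_of_nonneg (Real.sqrt_nonneg _),
      abs_of_pos h.sigma2_pos]
    have h2 := log_norm_div_le h.c_pos hz
    have h3 := h.sigma2_pos.le
    have h4 : 0 ≤ X := (abs_nonneg x).trans hx
    calc sigma2 q c * √(N : ℝ) * |x| * |Real.log ‖z / c‖|
        ≤ sigma2 q c * √(N : ℝ) * X * (‖z - c‖ / c) := by gcongr
      _ = _ := by ring
  linarith

/-- The second derivative of `S₂(κ, ·)` at `c`. -/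
def curvature (q c κ : ℝ) : ℝ := sigma2 q c ^ 2 / c ^ 2 * (κ - kappa0 q c)

lemma curvature_pos (h : IsParam q c) (hκ : kappa0 q c < κ) : 0 < curvature q c κ :=
  mul_pos (div_pos (pow_pos h.sigma2_pos 2) (pow_pos h.c_pos 2)) (by linarith)

lemma cos_two_mul_neg (hθ : θ ∈ Set.Ioo (Real.pi / 4) (Real.pi / 2)) :
    Real.cos (2 * θ) < 0 :=
  Real.cos_neg_of_pi_div_two_lt_of_lt (by linarith [hθ.1]) (by linarith [hθ.2, Real.pi_pos])

lemma cos_pos_of_mem (hθ : θ ∈ Set.Ioo (Real.pi / 4) (Real.pi / 2)) : 0 < Real.cos θ :=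
  Real.cos_pos_of_mem_Ioo ⟨by linarith [hθ.1, Real.pi_pos], hθ.2⟩

lemma sin_pos_of_mem (hθ : θ ∈ Set.Ioo (Real.pi / 4) (Real.pi / 2)) : 0 < Real.sin θ :=
  Real.sin_pos_of_pos_of_lt_pi (by linarith [hθ.1, Real.pi_pos]) (by linarith [hθ.2, Real.pi_pos])

/-- Near `c`, the function `S̄₂` differs from its quadratic approximation by a small multiple of
`|z - c|²`. -/
lemma exists_ball_S2bar_quadratic (h : IsParam q c) (hκ : kappa0 q c < κ) {m : ℝ} (hm : 0 < m) :
    ∃ δ > 0, Metric.ball (c : ℂ) δ ⊆ regularDomain q ∧ ∀ z ∈ Metric.ball (c : ℂ) δ,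
      ‖S2bar q c κ z - curvature q c κ / 2 * (z - c) ^ 2‖ ≤
        curvature q c κ / 4 * min m 1 * ‖z - c‖ ^ 2 := by
  have hA := curvature_pos h hκ
  have h1 := eventually_S2bar_quadratic (κ := κ) h
    (η := curvature q c κ / 4 * min m 1) (mul_pos (by linarith) (lt_min hm one_pos))
  obtain ⟨δ, hδ, hb⟩ := Metric.eventually_nhds_iff_ball.1
    (h1.and ((isOpen_regularDomain q).eventually_mem h.mem_regularDomain))
  exact ⟨δ, hδ, fun z hz => (hb z hz).2, fun z hz => (hb z hz).1⟩

lemma re_quadratic (A : ℝ) (z : ℂ) :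
    ((A : ℂ) / 2 * (z - c) ^ 2).re = A / 2 * ((z.re - c) ^ 2 - z.im ^ 2) := by
  rw [show (A : ℂ) / 2 = ((A / 2 : ℝ) : ℂ) by push_cast; rfl, Complex.re_ofReal_mul, sq,
    Complex.mul_re]
  simp only [Complex.sub_re, Complex.sub_im, Complex.ofReal_re, Complex.ofReal_im]
  ring

lemma S2bar_re_le_of_close {A η : ℝ}
    (hz : ‖S2bar q c κ z - A / 2 * (z - c) ^ 2‖ ≤ η) :
    (S2bar q c κ z).re ≤ A / 2 * ((z.re - c) ^ 2 - z.im ^ 2) + η := by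
  have h1 := (Complex.re_le_norm _).trans hz
  rw [Complex.sub_re, re_quadratic] at h1
  linarith

/-- On the two rays of an admissible contour `Re S̄₂` decays quadratically. -/
lemma exists_ray_quadratic_bound (h : IsParam q c) (hκ : kappa0 q c < κ)
    (hd : IsDescentPair q c κ θ R) :
    ∃ a > 0, ∀ φ, φ = θ ∨ φ = -θ → ∀ u ∈ Set.Icc 0 (rayLength c θ R),
      (S2bar q c κ (rayPoint c φ u)).re ≤ -(a * u ^ 2) := by
  obtain ⟨hθ, hR, ψ, hψ⟩ := hd
  have hcos2 := cos_two_mul_neg hθ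
  have hA := curvature_pos h hκ
  -- On the rays the quadratic term is `(A/2) u² cos 2θ` with `cos 2θ < 0`; this choice of `m` makes
  -- the error at most half of it.
  obtain ⟨δ, hδ, -, hb⟩ := exists_ball_S2bar_quadratic h hκ (m := -Real.cos (2 * θ)) (by linarith)
  obtain ⟨hψ0, hψδ⟩ := hψ δ hδ
  have hcq := h.lt_inv
  set L := rayLength c θ R with hL
  have hL0 : 0 < L := rayLength_pos h.c_pos (hcq.trans hR)
  refine ⟨min (curvature q c κ / 4 * -Real.cos (2 * θ)) (ψ δ / L ^ 2),
    lt_min (mul_pos (by linarith) (by linarith)) (by positivity), fun φ hφ u hu => ?_⟩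
  rcases lt_or_ge u δ with hlt | hge
  · have hmem : rayPoint c φ u ∈ Metric.ball (c : ℂ) δ := by
      rw [Metric.mem_ball, dist_eq_norm, norm_rayPoint_sub hu.1]
      exact hlt
    have h1 := S2bar_re_le_of_close (hb _ hmem)
    rw [rayPoint_re, rayPoint_im, norm_rayPoint_sub hu.1] at h1
    have h2 : (c + u * Real.cos φ - c) ^ 2 - (u * Real.sin φ) ^ 2 = u ^ 2 * Real.cos (2 * θ) := by
      rw [Real.cos_two_mul']
      rcases hφ with rfl | rfl
      · ring
      · rw [Real.cos_neg, Real.sin_neg]; ring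
    rw [h2] at h1
    have h3 : curvature q c κ / 4 * min (-Real.cos (2 * θ)) 1 * u ^ 2 ≤
        curvature q c κ / 4 * -Real.cos (2 * θ) * u ^ 2 := by
      gcongr
      exact min_le_left _ _
    have h4 : min (curvature q c κ / 4 * -Real.cos (2 * θ)) (ψ δ / L ^ 2) * u ^ 2 ≤
        curvature q c κ / 4 * -Real.cos (2 * θ) * u ^ 2 := by
      gcongr
      exact min_le_left _ _
    linarith
  -- Away from `c` the uniform gap `ψ δ` dominates `(ψ δ / L²) u²`, since `u ≤ L`.
  · have hmem : rayPoint c φ u ∈ contourSet c θ R 0 := by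
      have hseg : ∀ φ, rayPoint c φ u ∈ segment ℝ (rayPoint c φ 0) (rayPoint c φ L) := by
        intro φ
        rw [segment_eq_image']
        refine ⟨u / L, ⟨div_nonneg hu.1 hL0.le, (div_le_one hL0).2 hu.2⟩, ?_⟩
        have : (L : ℂ) ≠ 0 := by exact_mod_cast hL0.ne'
        simp only [rayPoint, Complex.real_smul]
        push_cast
        field_simp
        ring
      rcases hφ with rfl | rfl
      · exact Or.inl (Or.inr (hseg _))
      · refine Or.inl (Or.inl (Or.inl ?_))
        rw [segment_symm]
        exact hseg _
    have h1 := hψδ _ hmem (by rwa [norm_rayPoint_sub hu.1])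
    have h2 : min (curvature q c κ / 4 * -Real.cos (2 * θ)) (ψ δ / L ^ 2) * u ^ 2 ≤
        ψ δ / L ^ 2 * L ^ 2 := by
      have := hu.1
      have := hu.2
      gcongr
      exact min_le_right _ _
    rw [div_mul_cancel₀ _ (by positivity)] at h2
    rw [S2bar]
    linarith

lemma exists_arc_bound (h : IsParam q c) (hd : IsDescentPair q c κ θ R) :
    ∃ δ > 0, ∀ z ∈ circlePoint R ''
        Set.Icc (zetaPlus c θ R).arg (2 * Real.pi - (zetaPlus c θ R).arg),
      (S2bar q c κ z).re ≤ -δ := by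
  obtain ⟨hθ, hR, ψ, hψ⟩ := hd
  have hcq := h.lt_inv
  -- Every point of the arc is at distance at least `R - c` from `c`.
  obtain ⟨h1, h2⟩ := hψ (R - c) (by linarith)
  refine ⟨ψ (R - c), h1, fun z hz => h2 z (Or.inr hz) ?_⟩
  obtain ⟨φ, -, rfl⟩ := hz
  refine le_trans ?_ (norm_sub_norm_le _ _)
  rw [norm_circlePoint (by linarith [h.c_pos]), Complex.norm_real, Real.norm_of_nonneg h.c_pos.le]

end Weight

/-! ### Integrals over `Γ_{κ,N}` -/

section Gamma

variable {q c κ θ R : ℝ}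

lemma segmentIntegral_rayPoint (f : ℂ → ℂ) (x φ u₁ u₂ : ℝ) :
    segmentIntegral f (rayPoint x φ u₁) (rayPoint x φ u₂) =
      ∫ u in u₁..u₂, f (rayPoint x φ u) * Complex.exp (φ * Complex.I) :=
  segmentIntegral_ray f x (Complex.exp (φ * Complex.I)) u₁ u₂

lemma segmentIntegral_symm (f : ℂ → ℂ) (a b : ℂ) :
    segmentIntegral f b a = -segmentIntegral f a b := by
  have h1 := segmentIntegral_ray f a (b - a) 0 1
  have h2 := segmentIntegral_ray f a (b - a) 1 0
  simp only [Complex.ofReal_zero, zero_mul, add_zero, Complex.ofReal_one, one_mul,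
    add_sub_cancel] at h1 h2
  rw [h1, h2, intervalIntegral.integral_symm]

lemma norm_segmentIntegral_rayPoint_le {f : ℂ → ℂ} {φ u₁ u₂ B a : ℝ} (hB : 0 ≤ B) (ha : 0 < a)
    (hu : u₁ ≤ u₂)
    (hf : ∀ u ∈ Set.Icc u₁ u₂, ‖f (rayPoint c φ u)‖ ≤ B * Real.exp (-a * u ^ 2)) :
    ‖segmentIntegral f (rayPoint c φ u₁) (rayPoint c φ u₂)‖ ≤ B * √(Real.pi / a) := by
  rw [segmentIntegral_rayPoint]
  have hint := (integrable_exp_neg_mul_sq ha).const_mul B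
  refine (intervalIntegral.norm_integral_le_of_norm_le hu
    (g := fun u => B * Real.exp (-a * u ^ 2)) ?_ hint.intervalIntegrable).trans ?_
  · refine Eventually.of_forall fun u hu' => ?_
    rw [norm_mul, Complex.norm_exp_ofReal_mul_I, mul_one]
    exact hf u (Set.Ioc_subset_Icc_self hu')
  · rw [intervalIntegral.integral_of_le hu, ← integral_gaussian, ← MeasureTheory.integral_const_mul]
    exact MeasureTheory.setIntegral_le_integral hint (Eventually.of_forall fun u => by positivity)

lemma isDescentPair_lt (h : IsParam q c) (hd : IsDescentPair q c κ θ R) : c < R := by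
  exact h.lt_inv.trans hd.2.1

lemma tendsto_corner (θ : ℝ) :
    Tendsto (fun N : ℕ => (Real.cos θ)⁻¹ * (N : ℝ) ^ (-(1 / 2) : ℝ)) atTop (𝓝 0) := by
  have h1 : Tendsto (fun N : ℕ => (√(N : ℝ))⁻¹) atTop (𝓝 0) :=
    tendsto_inv_atTop_zero.comp tendsto_sqrt_natCast_atTop
  simp_rw [natCast_rpow_neg_half]
  simpa using h1.const_mul (Real.cos θ)⁻¹

set_option maxHeartbeats 800000 in
/-- The integral of the weight along `Γ_{κ,N}` is `O(N^{-1/2})`. -/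
theorem exists_norm_intGamma_le (h : IsParam q c) (hκ : kappa0 q c < κ)
    (hd : IsDescentPair q c κ θ R) (X : ℝ) :
    ∃ M, 0 ≤ M ∧ ∀ᶠ N : ℕ in atTop, ∀ x, |x| ≤ X → ∀ (f : ℂ → ℂ) (B : ℝ), 0 ≤ B →
      (∀ z, c ≤ ‖z‖ → ‖z‖ ≤ c + R → ‖f z‖ ≤ B * weight q c κ N x z) →
      ‖intGamma c θ R N f‖ ≤ B * (M / √(N : ℝ)) := by
  have hcR := isDescentPair_lt h hd
  have hc := h.c_pos
  have hR0 : 0 < R := by linarith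
  have hθ := hd.1
  have hcos := cos_pos_of_mem hθ
  have hA := curvature_pos h hκ
  obtain ⟨a, ha, hray⟩ := exists_ray_quadratic_bound h hκ hd
  obtain ⟨δ, hδ, harc⟩ := exists_arc_bound h hd
  obtain ⟨ε, hε, -, hball⟩ := exists_ball_S2bar_quadratic h hκ (m := 1) one_pos
  have hL := rayLength_pos (θ := θ) hc hcR
  have hLR := rayLength_le (θ := θ) hc.le hcos.le hR0.le
  set L := rayLength c θ R with hLdef
  set K := sigma2 q c * X / c with hK
  -- The exponential is the cost of completing the square against the factor carrying `x`; the root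
  -- is the Gaussian integral with half of the decay rate `a`.
  set Cray := Real.exp (K ^ 2 / (2 * a)) * √(Real.pi / (a / 2)) with hCray
  -- The middle segment lies within `ρ = sec θ / √N` of `c`, so its exponent is merely bounded; the
  -- gain `1/√N` is its length.
  set Cmid := Real.exp (curvature q c κ * (Real.cos θ)⁻¹ ^ 2 + K * (Real.cos θ)⁻¹) *
    (2 * (Real.cos θ)⁻¹) with hCmid
  refine ⟨Cray + Cmid + Cray + R * (4 * Real.pi), by positivity, ?_⟩
  -- The absolute value is there because `0 ≤ X` is known only once some `x` with `|x| ≤ X` is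
  -- given. The bound by `1` makes the arc contribute at most a multiple of `1/√N`.
  have hsmall := (tendsto_sqrt_mul_exp hδ (|K| * (R + c))).eventually_lt_const one_pos
  filter_upwards [hsmall, eventually_gt_atTop 0,
    (tendsto_corner θ).eventually_lt_const (lt_min hL hε)] with N hN hN0 hcorner
  intro x hx f B hB hf
  set t : ℝ := √(N : ℝ) with ht
  have htpos : 0 < t := Real.sqrt_pos.2 (by exact_mod_cast hN0)
  have htsq : t ^ 2 = N := Real.sq_sqrt (Nat.cast_nonneg N)
  set ρ : ℝ := (Real.cos θ)⁻¹ * (N : ℝ) ^ (-(1 / 2) : ℝ) with hρ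
  have hρt : ρ * t = (Real.cos θ)⁻¹ := by
    rw [hρ, natCast_rpow_neg_half, mul_assoc, inv_mul_cancel₀ htpos.ne', mul_one]
  have hρ0 : 0 < ρ := by rw [hρ, natCast_rpow_neg_half]; positivity
  have hρL : ρ ≤ L := (hcorner.trans_le (min_le_left _ _)).le
  have hρε : ρ < ε := hcorner.trans_le (min_le_right _ _)
  have hX0 : 0 ≤ X := (abs_nonneg x).trans hx
  have hK0 : 0 ≤ K := by
    have := h.sigma2_pos
    positivity
  have hrayφ : ∀ φ, φ = θ ∨ φ = -θ → ‖segmentIntegral f (rayPoint c φ ρ) (rayPoint c φ L)‖ ≤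
      B * (Cray / t) := by
    intro φ hφ
    have hcosφ : 0 ≤ Real.cos φ := by
      rcases hφ with rfl | rfl
      · exact hcos.le
      · rw [Real.cos_neg]; exact hcos.le
    refine (norm_segmentIntegral_rayPoint_le (B := B * Real.exp (K ^ 2 / (2 * a)))
      (a := a / 2 * N) (by positivity) (by positivity) hρL fun u hu => ?_).trans (le_of_eq ?_)
    · have hu0 : 0 ≤ u := hρ0.le.trans hu.1
      have hcz : c ≤ ‖rayPoint c φ u‖ := le_norm_rayPoint hu0 hcosφ
      have hzR : ‖rayPoint c φ u‖ ≤ c + R := by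
        have h1 := norm_le_norm_add_norm_sub' (rayPoint c φ u) (c : ℂ)
        rw [norm_rayPoint_sub hu0, Complex.norm_real, Real.norm_of_nonneg hc.le] at h1
        linarith [hu.2]
      refine (hf _ hcz hzR).trans ?_
      rw [mul_assoc, ← Real.exp_add]
      gcongr
      refine (weight_le h hx hcz).trans (Real.exp_le_exp.2 ?_)
      rw [norm_rayPoint_sub hu0, ← hK]
      have h1 := mul_le_mul_of_nonneg_left (hray φ hφ u ⟨hu0, hu.2⟩) (Nat.cast_nonneg (α := ℝ) N)
      have h2 : 0 ≤ (a * (t * u) - K) ^ 2 / (2 * a) := by positivity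
      have h3 : (a * (t * u) - K) ^ 2 / (2 * a) =
          a / 2 * N * u ^ 2 - t * (K * u) + K ^ 2 / (2 * a) := by
        rw [← htsq]
        field_simp
        ring
      linarith
    · rw [hCray, ← htsq, ← div_div Real.pi, Real.sqrt_div (by positivity) (t ^ 2),
        Real.sqrt_sq htpos.le]
      ring
  have hmid : ‖segmentIntegral f (rayPoint c (-θ) ρ) (rayPoint c θ ρ)‖ ≤ B * (Cmid / t) := by
    refine (norm_segmentIntegral_le (C := B * Real.exp (curvature q c κ * (Real.cos θ)⁻¹ ^ 2 +
      K * (Real.cos θ)⁻¹)) fun z hz => ?_).trans ?_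
    · have hzρ : ‖z - c‖ ≤ ρ := by
        have hsub := (convex_closedBall (c : ℂ) ρ).segment_subset
          (x := rayPoint c (-θ) ρ) (y := rayPoint c θ ρ)
          (by rw [Metric.mem_closedBall, dist_eq_norm, norm_rayPoint_sub hρ0.le])
          (by rw [Metric.mem_closedBall, dist_eq_norm, norm_rayPoint_sub hρ0.le]) hz
        rwa [Metric.mem_closedBall, dist_eq_norm] at hsub
      have hcz : c ≤ ‖z‖ := by
        have hsub := (convex_halfSpace_re_ge c).segment_subset
          (x := rayPoint c (-θ) ρ) (y := rayPoint c θ ρ)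
          (by simp only [Set.mem_ofPred_eq, rayPoint_re, Real.cos_neg]; nlinarith)
          (by simp only [Set.mem_ofPred_eq, rayPoint_re]; nlinarith) hz
        exact le_trans hsub (Complex.re_le_norm z)
      have hzR : ‖z‖ ≤ c + R := by
        have h1 := norm_le_norm_add_norm_sub' z (c : ℂ)
        rw [Complex.norm_real, Real.norm_of_nonneg hc.le] at h1
        linarith
      refine (hf z hcz hzR).trans ?_
      gcongr
      refine (weight_le h hx hcz).trans (Real.exp_le_exp.2 ?_)
      have hzball : z ∈ Metric.ball (c : ℂ) ε := by
        rw [Metric.mem_ball, dist_eq_norm]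
        linarith
      have h1 : (S2bar q c κ z).re ≤ curvature q c κ * ρ ^ 2 := by
        have h2 := S2bar_re_le_of_close (hball z hzball)
        have h3 : (z.re - c) ^ 2 - z.im ^ 2 ≤ ‖z - c‖ ^ 2 := by
          rw [Complex.sq_norm, Complex.normSq_apply]
          simp only [Complex.sub_re, Complex.sub_im, Complex.ofReal_re, Complex.ofReal_im]
          nlinarith [sq_nonneg z.im]
        have h4 : ‖z - c‖ ^ 2 ≤ ρ ^ 2 := by gcongr
        rw [min_self] at h2
        have h5 : curvature q c κ / 2 * ((z.re - c) ^ 2 - z.im ^ 2) ≤ curvature q c κ / 2 * ρ ^ 2 :=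
          mul_le_mul_of_nonneg_left (h3.trans h4) (by linarith)
        have h6 : curvature q c κ / 4 * ‖z - c‖ ^ 2 ≤ curvature q c κ / 4 * ρ ^ 2 :=
          mul_le_mul_of_nonneg_left h4 (by linarith)
        have h7 : 0 ≤ curvature q c κ * ρ ^ 2 := by positivity
        linarith
      rw [← hK]
      calc N * (S2bar q c κ z).re + t * (K * ‖z - c‖)
          ≤ N * (curvature q c κ * ρ ^ 2) + t * (K * ρ) := by gcongr
        _ = curvature q c κ * (ρ * t) ^ 2 + K * (ρ * t) := by rw [← htsq]; ring
        _ = _ := by rw [hρt]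
    · have h1 : ‖rayPoint c θ ρ - rayPoint c (-θ) ρ‖ ≤ 2 * ρ := by
        have := norm_sub_le (rayPoint c θ ρ - c) (rayPoint c (-θ) ρ - c)
        rw [norm_rayPoint_sub hρ0.le, norm_rayPoint_sub hρ0.le, sub_sub_sub_cancel_right] at this
        linarith
      have h2 : ρ = (Real.cos θ)⁻¹ / t := by rw [← hρt]; field_simp
      calc _ ≤ B * Real.exp (curvature q c κ * (Real.cos θ)⁻¹ ^ 2 + K * (Real.cos θ)⁻¹) *
            (2 * ρ) := by gcongr
        _ = _ := by rw [h2, hCmid]; ring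
  have harc' : ‖arcIntegral f R (zetaPlus c θ R).arg (2 * Real.pi - (zetaPlus c θ R).arg)‖ ≤
      B * (R * (4 * Real.pi) / t) := by
    refine (norm_arcIntegral_le (C := B * (1 / t)) hR0.le
      (Complex.abs_arg_le_pi _) fun z hz => ?_).trans (le_of_eq (by ring))
    have hzn : ‖z‖ = R := by
      obtain ⟨φ, -, rfl⟩ := hz
      exact norm_circlePoint hR0.le φ
    refine (hf z (by linarith) (by linarith)).trans ?_
    gcongr
    refine (weight_le h hx (by linarith)).trans ?_
    rw [le_div_iff₀ htpos, mul_comm]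
    refine le_trans ?_ hN.le
    gcongr
    · have := mul_le_mul_of_nonneg_left (harc z hz) (Nat.cast_nonneg (α := ℝ) N)
      linarith
    · exact le_abs_self K
    · refine (norm_sub_le _ _).trans ?_
      rw [hzn, Complex.norm_real, Real.norm_of_nonneg hc.le]
  rw [intGamma, contourIntegral, ← hρ]
  have hminus : ‖segmentIntegral f (zetaMinus c θ R) (rayPoint c (-θ) ρ)‖ ≤ B * (Cray / t) := by
    rw [segmentIntegral_symm, norm_neg]
    exact hrayφ (-θ) (Or.inr rfl)
  refine (norm_add_le _ _).trans ?_
  refine (add_le_add ((norm_add_le _ _).trans (add_le_add ((norm_add_le _ _).trans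
    (add_le_add hminus hmid)) (hrayφ θ (Or.inl rfl)))) harc').trans (le_of_eq (by ring))

end Gamma

/-! ### Moduli of the integrands -/

section Norms

variable {q c s t x y r ρ : ℝ} {N : ℕ} {z w : ℂ}

lemma S2bar_self : S2bar q c s c = 0 := sub_self _

lemma weight_pos : 0 < weight q c s N x z := Real.exp_pos _

lemma weight_self (h : IsParam q c) : weight q c s N x c = 1 := by
  simp [weight, S2bar_self, h.ofReal_ne.1]

lemma norm_F11 : ‖F11 q c N s x t y z w‖ = weight q c s N x z * weight q c t N y w := by
  rw [F11, norm_mul, Complex.norm_exp, Complex.norm_exp, weight, weight, ← Real.exp_add,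
    ← Real.exp_add]
  congr 1
  simp [Complex.log_re]
  ring

lemma norm_F12 : ‖F12 q c N s x t y z w‖ = weight q c s N x z * (weight q c t N y w)⁻¹ := by
  rw [F12, norm_mul, Complex.norm_exp, Complex.norm_exp, weight, weight, ← Real.exp_neg,
    ← Real.exp_add, ← Real.exp_add]
  congr 1
  simp [Complex.log_re]
  ring

lemma norm_F22 : ‖F22 q c N s x t y z w‖ =
    (weight q c s N x z)⁻¹ * (weight q c t N y w)⁻¹ := by
  rw [F22, norm_mul, Complex.norm_exp, Complex.norm_exp, weight, weight, ← Real.exp_neg,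
    ← Real.exp_neg, ← Real.exp_add, ← Real.exp_add]
  congr 1
  simp [Complex.log_re]
  ring

lemma norm_scale (h : IsParam q c) : ‖(scale q c N : ℂ)‖ = sigma2 q c * √(N : ℝ) := by
  rw [Complex.norm_real, scale, Real.norm_of_nonneg]
  have := h.sigma2_pos
  positivity

lemma norm_div_le_div {a b : ℂ} {A B : ℝ} (hB : 0 < B) (ha : ‖a‖ ≤ A) (hb : B ≤ ‖b‖) :
    ‖a / b‖ ≤ A / B := by
  rw [norm_div]
  exact div_le_div₀ ((norm_nonneg a).trans ha) ha hB hb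

lemma norm_fracPow_le_of_norm_le (hq : 0 < q) (hz : ‖z‖ ≤ ρ) :
    ‖fracPow q s N z‖ ≤ 1 + q * ρ := by
  have h1 : ‖1 - q * z‖ ≤ 1 + q * ρ := by
    refine (norm_sub_le _ _).trans ?_
    rw [norm_one, norm_mul, Complex.norm_real, Real.norm_of_nonneg hq.le]
    gcongr
  refine (norm_fracPow_le h1).trans (le_of_eq (max_eq_right ?_))
  have : 0 ≤ ρ := (norm_nonneg z).trans hz
  have : 0 ≤ q * ρ := by positivity
  linarith

lemma le_norm_fracPow_of_norm_le (h : IsParam q c) (hz : ‖z‖ ≤ c) :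
    1 - q * c ≤ ‖fracPow q s N z‖ := by
  have hq := h.q_pos
  have h1 : 1 - q * c ≤ ‖1 - q * z‖ := by
    have h2 := norm_sub_norm_le (1 : ℂ) (q * z)
    rw [norm_one, norm_mul, Complex.norm_real, Real.norm_of_nonneg hq.le] at h2
    have : q * ‖z‖ ≤ q * c := by gcongr
    linarith
  refine le_trans (le_of_eq (min_eq_right ?_).symm) (le_norm_fracPow h.one_sub_pos h1)
  have := mul_pos hq h.c_pos
  linarith

lemma le_norm_fracPow_self (h : IsParam q c) : 1 - q * c ≤ ‖fracPow q s N c‖ :=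
  le_norm_fracPow_of_norm_le h (by rw [Complex.norm_real, Real.norm_of_nonneg h.c_pos.le])

lemma norm_fracPow_self_le (h : IsParam q c) : ‖fracPow q s N c‖ ≤ 1 + q * c :=
  norm_fracPow_le_of_norm_le h.q_pos (by rw [Complex.norm_real, Real.norm_of_nonneg h.c_pos.le])

lemma le_norm_mul_sub_one {b : ℝ} (hb : 0 ≤ b) (hz : b ≤ ‖z‖) (hw : b ≤ ‖w‖) :
    b ^ 2 - 1 ≤ ‖z * w - 1‖ := by
  refine le_trans ?_ (norm_sub_norm_le _ _)
  rw [norm_one, norm_mul, sq]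
  gcongr

/-- The poles `±1` and `zw = 1` are avoided because both variables have modulus at least `c > 1`. -/
lemma norm_H11_le (h : IsParam q c) (hz : c ≤ ‖z‖) (hzρ : ‖z‖ ≤ ρ) (hw : c ≤ ‖w‖) (hwρ : ‖w‖ ≤ ρ) :
    ‖H11 q c N s t z w‖ ≤ sigma2 q c * √(N : ℝ) *
      ((2 * ρ * 2 * 2 * (1 + q * ρ) * (1 + q * ρ)) /
        ((c ^ 2 - 1) * (c ^ 2 - 1) * (c ^ 2 - 1) * (1 - q * c) * (1 - q * c))) := by
  have hc := h.c_pos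
  have hσ := h.sigma2_pos
  have hc1 : 0 < c ^ 2 - 1 := by nlinarith [h.one_lt]
  have hd := h.one_sub_pos
  have hρ : 0 < ρ := by linarith
  have hq := h.q_pos
  have hdiv : ∀ z : ℂ, c ≤ ‖z‖ → ‖1 - c / z‖ ≤ 2 := by
    intro z hz
    refine (norm_sub_le _ _).trans ?_
    rw [norm_one, norm_div, Complex.norm_real, Real.norm_of_nonneg hc.le]
    have : c / ‖z‖ ≤ 1 := (div_le_one (by linarith)).2 hz
    linarith
  rw [H11, norm_mul, norm_scale h]
  gcongr
  refine norm_div_le_div (by positivity) ?_ ?_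
  · simp only [norm_mul]
    gcongr
    · exact (norm_sub_le _ _).trans (by linarith)
    · exact hdiv z hz
    · exact hdiv w hw
    · exact norm_fracPow_le_of_norm_le hq hzρ
    · exact norm_fracPow_le_of_norm_le hq hwρ
  · simp only [norm_mul]
    gcongr
    · rw [sq z]; exact le_norm_mul_sub_one hc.le hz hz
    · rw [sq w]; exact le_norm_mul_sub_one hc.le hw hw
    · exact le_norm_mul_sub_one hc.le hz hw
    · exact le_norm_fracPow_self h
    · exact le_norm_fracPow_self h

/-- The gap `c - r` between the two contours controls both `z - w` and `w - c`. -/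
lemma norm_H12_le (h : IsParam q c) (hr : r < c) (hz : c ≤ ‖z‖) (hzρ : ‖z‖ ≤ ρ) (hw : ‖w‖ = r) :
    ‖H12 q c N s t z w‖ ≤ sigma2 q c * √(N : ℝ) *
      (((ρ * r + 1) * (ρ + c) * (1 + q * ρ) * (1 + q * c)) /
        (c * (c - r) * (c ^ 2 - 1) * (c - r) * (1 - q * c) * (1 - q * c))) := by
  have hc := h.c_pos
  have hσ := h.sigma2_pos
  have hc1 : 0 < c ^ 2 - 1 := by nlinarith [h.one_lt]
  have hd := h.one_sub_pos
  have hρ : 0 < ρ := by linarith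
  have hq := h.q_pos
  have hr0 : 0 ≤ r := hw ▸ norm_nonneg w
  have hcr : 0 < c - r := by linarith
  have hcn : ‖(c : ℂ)‖ = c := by rw [Complex.norm_real, Real.norm_of_nonneg hc.le]
  rw [H12, norm_mul, norm_scale h]
  gcongr
  refine norm_div_le_div (by positivity) ?_ ?_
  · simp only [norm_mul]
    gcongr
    · refine (norm_sub_le _ _).trans ?_
      rw [norm_mul, norm_one, hw]
      gcongr
    · refine (norm_sub_le _ _).trans ?_
      rw [hcn]
      gcongr
    · exact norm_fracPow_le_of_norm_le hq hzρ
    · exact norm_fracPow_self_le h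
  · simp only [norm_mul]
    gcongr
    · refine le_trans ?_ (norm_sub_norm_le _ _)
      rw [hw]; linarith
    · rw [sq z]; exact le_norm_mul_sub_one hc.le hz hz
    · rw [norm_sub_rev]
      refine le_trans ?_ (norm_sub_norm_le _ _)
      rw [hw, hcn]
    · exact le_norm_fracPow_of_norm_le h (by linarith)
    · exact le_norm_fracPow_self h

lemma norm_H22_le (h : IsParam q c) {r' : ℝ} (hr1 : 1 < r) (hr : r < c) (hr1' : 1 < r')
    (hr' : r' < c) (hz : ‖z‖ = r) (hw : ‖w‖ = r') :
    ‖H22 q c N s t z w‖ ≤ sigma2 q c * √(N : ℝ) *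
      (((r + r') * (1 + q * c) * (1 + q * c)) /
        ((r * r' - 1) * (c - r) * (c - r') * (1 - q * c) * (1 - q * c))) := by
  have hc := h.c_pos
  have hσ := h.sigma2_pos
  have hd := h.one_sub_pos
  have hq := h.q_pos
  have hcr : 0 < c - r := by linarith
  have hcr' : 0 < c - r' := by linarith
  have hrr : 0 < r * r' - 1 := by nlinarith
  have hcn : ‖(c : ℂ)‖ = c := by rw [Complex.norm_real, Real.norm_of_nonneg hc.le]
  rw [H22, norm_mul, norm_scale h]
  gcongr
  refine norm_div_le_div (by positivity) ?_ ?_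
  · simp only [norm_mul]
    gcongr
    · refine (norm_sub_le _ _).trans ?_
      rw [hz, hw]
    · exact norm_fracPow_self_le h
    · exact norm_fracPow_self_le h
  · simp only [norm_mul]
    gcongr
    · refine le_trans ?_ (norm_sub_norm_le _ _)
      rw [norm_mul, norm_one, hz, hw]
    · rw [norm_sub_rev]
      refine le_trans ?_ (norm_sub_norm_le _ _)
      rw [hz, hcn]
    · rw [norm_sub_rev]
      refine le_trans ?_ (norm_sub_norm_le _ _)
      rw [hw, hcn]
    · exact le_norm_fracPow_of_norm_le h (by linarith)
    · exact le_norm_fracPow_of_norm_le h (by linarith)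

/-- The inverse weight is exponentially small on the small circles. -/
lemma exists_weight_inv_le (h : IsParam q c) (ht : kappa0 q c < t) (ht1 : t < 1) (Y : ℝ) :
    ∃ δ > 0, ∃ K : ℝ, ∀ (N : ℕ) (y : ℝ) (w : ℂ), |y| ≤ Y → ‖w‖ = zc q t →
      (weight q c t N y w)⁻¹ ≤ Real.exp (-(N * δ) + √(N : ℝ) * K) := by
  obtain ⟨δ, hδ, hS⟩ := exists_le_S2bar_re_circle h ht ht1
  refine ⟨δ, hδ, sigma2 q c * Y * |Real.log (zc q t / c)|, fun N y w hy hw => ?_⟩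
  rw [weight, ← Real.exp_neg]
  refine Real.exp_le_exp.2 ?_
  have h1 := mul_le_mul_of_nonneg_left (hS w hw) (Nat.cast_nonneg (α := ℝ) N)
  have h2 : scale q c N * y * Real.log ‖w / c‖ ≤
      √(N : ℝ) * (sigma2 q c * Y * |Real.log (zc q t / c)|) := by
    rw [norm_div, hw, Complex.norm_real, Real.norm_of_nonneg h.c_pos.le]
    refine (le_abs_self _).trans ?_
    rw [scale, abs_mul, abs_mul, abs_mul, abs_of_nonneg (Real.sqrt_nonneg _),
      abs_of_pos h.sigma2_pos]
    have := h.sigma2_pos.le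
    calc sigma2 q c * √(N : ℝ) * |y| * |Real.log (zc q t / c)|
        ≤ sigma2 q c * √(N : ℝ) * Y * |Real.log (zc q t / c)| := by gcongr
      _ = _ := by ring
  linarith

lemma norm_intSmall_le (hr : 0 ≤ zc q t) {f : ℂ → ℂ} {C : ℝ}
    (hf : ∀ w, ‖w‖ = zc q t → ‖f w‖ ≤ C) : ‖intSmall q t f‖ ≤ 2 * Real.pi * zc q t * C :=
  circleIntegral.norm_integral_le_of_norm_le_const hr fun w hw => hf w (by simpa using hw)

end Norms

/-! ### The vanishing terms -/

section Vanishing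

variable {q c s t X : ℝ} {θ R : ℝ → ℝ} {xs ys : ℕ → ℝ}

/-- Each of the two integrals contributes `N^{-1/2}` against a prefactor `N^{1/2}`. The inner bound
is proportional to the weight of the outer variable, so the same estimate applies twice. -/
theorem tendsto_I11 (h : IsParam q c) (hs : kappa0 q c < s) (ht : kappa0 q c < t)
    (hds : IsDescentPair q c s (θ s) (R s)) (hdt : IsDescentPair q c t (θ t) (R t))
    (hxs : ∀ N, |xs N| ≤ X) (hys : ∀ N, |ys N| ≤ X) :
    Tendsto (fun N => I11 q c θ R N s (xs N) t (ys N)) atTop (𝓝 0) := by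
  obtain ⟨M₁, hM₁, hev₁⟩ := exists_norm_intGamma_le h hs hds X
  obtain ⟨M₂, hM₂, hev₂⟩ := exists_norm_intGamma_le h ht hdt X
  set ρ := c + max (R s) (R t) with hρ
  set C := sigma2 q c * ((2 * ρ * 2 * 2 * (1 + q * ρ) * (1 + q * ρ)) /
        ((c ^ 2 - 1) * (c ^ 2 - 1) * (c ^ 2 - 1) * (1 - q * c) * (1 - q * c))) with hC
  have hc := h.c_pos
  have hρ0 : 0 < ρ := by
    have := isDescentPair_lt h hds
    have := le_max_left (R s) (R t)
    linarith
  have hC0 : 0 ≤ C := by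
    have := h.sigma2_pos
    have := h.q_pos
    have := h.one_sub_pos
    have hc1 : 0 < c ^ 2 - 1 := by nlinarith [h.one_lt]
    positivity
  have hbound : ∀ᶠ N : ℕ in atTop, ‖I11 q c θ R N s (xs N) t (ys N)‖ ≤
      ‖(1 / (2 * Real.pi * Complex.I) ^ 2 : ℂ)‖ * (C * M₂ * M₁ * (√(N : ℝ))⁻¹) := by
    filter_upwards [hev₁, hev₂, eventually_gt_atTop 0] with N h₁ h₂ hN
    have htpos : 0 < √(N : ℝ) := Real.sqrt_pos.2 (by exact_mod_cast hN)
    rw [I11, norm_mul]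
    gcongr
    refine (h₁ (xs N) (hxs N) _ (C * M₂) (by positivity) fun z hz hzR => ?_).trans
      (le_of_eq (by ring))
    refine (h₂ (ys N) (hys N) _ (C * √(N : ℝ) * weight q c s N (xs N) z)
      (mul_nonneg (by positivity) weight_pos.le) fun w hw hwR => ?_).trans (le_of_eq ?_)
    · rw [norm_mul, norm_F11]
      have hH := norm_H11_le (N := N) (s := s) (t := t) (ρ := ρ) h hz
        (by linarith [le_max_left (R s) (R t)]) hw (by linarith [le_max_right (R s) (R t)])
      calc _ ≤ weight q c s N (xs N) z * weight q c t N (ys N) w * _ :=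
            mul_le_mul_of_nonneg_left hH (mul_nonneg weight_pos.le weight_pos.le)
        _ = _ := by rw [hC]; ring
    · field_simp
  refine squeeze_zero_norm' hbound ?_
  have h1 : Tendsto (fun N : ℕ => (√(N : ℝ))⁻¹) atTop (𝓝 0) :=
    tendsto_inv_atTop_zero.comp tendsto_sqrt_natCast_atTop
  simpa only [mul_zero] using (h1.const_mul (C * M₂ * M₁)).const_mul ‖(1 / (2 * Real.pi * Complex.I) ^ 2 : ℂ)‖

theorem tendsto_I12 (h : IsParam q c) (hs : kappa0 q c < s) (ht : kappa0 q c < t) (ht1 : t < 1)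
    (hds : IsDescentPair q c s (θ s) (R s))
    (hxs : ∀ N, |xs N| ≤ X) (hys : ∀ N, |ys N| ≤ X) :
    Tendsto (fun N => I12 q c θ R N s (xs N) t (ys N)) atTop (𝓝 0) := by
  obtain ⟨M, hM, hev⟩ := exists_norm_intGamma_le h hs hds X
  obtain ⟨δ, hδ, K, hW⟩ := exists_weight_inv_le h ht ht1 X
  set ρ := c + R s with hρ
  set r := zc q t with hr
  have hr1 : 1 < r := one_lt_zc h ht1
  have hrc : r < c := zc_lt h ht
  set C := sigma2 q c * (((ρ * r + 1) * (ρ + c) * (1 + q * ρ) * (1 + q * c)) /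
        (c * (c - r) * (c ^ 2 - 1) * (c - r) * (1 - q * c) * (1 - q * c))) with hC
  have hc := h.c_pos
  have hρ0 : 0 < ρ := by
    have := isDescentPair_lt h hds
    linarith
  have hC0 : 0 ≤ C := by
    have := h.sigma2_pos
    have := h.q_pos
    have := h.one_sub_pos
    have hc1 : 0 < c ^ 2 - 1 := by nlinarith [h.one_lt]
    have : 0 < c - r := by linarith
    positivity
  have hbound : ∀ᶠ N : ℕ in atTop, ‖I12 q c θ R N s (xs N) t (ys N)‖ ≤
      ‖(1 / (2 * Real.pi * Complex.I) ^ 2 : ℂ)‖ * (2 * Real.pi * r * C * M *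
        ((√(N : ℝ) * Real.exp (-(N * δ) + √(N : ℝ) * K)) * (√(N : ℝ))⁻¹)) := by
    filter_upwards [hev] with N h₁
    rw [I12, norm_mul]
    gcongr
    refine (h₁ (xs N) (hxs N) _ (2 * Real.pi * r * (C * √(N : ℝ) *
      Real.exp (-(N * δ) + √(N : ℝ) * K))) (by positivity) fun z hz hzR => ?_).trans
      (le_of_eq (by ring))
    refine (norm_intSmall_le (by linarith) (C := C * √(N : ℝ) *
      Real.exp (-(N * δ) + √(N : ℝ) * K) * weight q c s N (xs N) z) fun w hw => ?_).trans
      (le_of_eq (by ring))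
    rw [norm_mul, norm_F12]
    have hH := norm_H12_le (N := N) (s := s) (t := t) h hrc hz hzR hw
    have hw0 : 0 ≤ weight q c s N (xs N) z := weight_pos.le
    calc _ ≤ weight q c s N (xs N) z * Real.exp (-(N * δ) + √(N : ℝ) * K) * _ :=
          mul_le_mul (mul_le_mul_of_nonneg_left (hW N _ w (hys N) hw) hw0) hH
            (norm_nonneg _) (by positivity)
      _ = _ := by rw [hC]; ring
  refine squeeze_zero_norm' hbound ?_
  have h1 : Tendsto (fun N : ℕ => (√(N : ℝ))⁻¹) atTop (𝓝 0) :=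
    tendsto_inv_atTop_zero.comp tendsto_sqrt_natCast_atTop
  have h2 := (tendsto_sqrt_mul_exp hδ K).mul h1
  simpa only [mul_zero] using (h2.const_mul (2 * Real.pi * r * C * M)).const_mul
    ‖(1 / (2 * Real.pi * Complex.I) ^ 2 : ℂ)‖

theorem tendsto_I22 (h : IsParam q c) (hs : kappa0 q c < s) (hs1 : s < 1) (ht : kappa0 q c < t)
    (ht1 : t < 1) (hxs : ∀ N, |xs N| ≤ X) (hys : ∀ N, |ys N| ≤ X) :
    Tendsto (fun N => I22 q c N s (xs N) t (ys N)) atTop (𝓝 0) := by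
  obtain ⟨δ₁, hδ₁, K₁, hW₁⟩ := exists_weight_inv_le h hs hs1 X
  obtain ⟨δ₂, hδ₂, K₂, hW₂⟩ := exists_weight_inv_le h ht ht1 X
  have hr1 := one_lt_zc h hs1
  have hrc := zc_lt h hs
  have hr1' := one_lt_zc h ht1
  have hrc' := zc_lt h ht
  set r := zc q s with hr
  set r' := zc q t with hr'
  set C := sigma2 q c * (((r + r') * (1 + q * c) * (1 + q * c)) /
        ((r * r' - 1) * (c - r) * (c - r') * (1 - q * c) * (1 - q * c))) with hC
  have hbound : ∀ N : ℕ, ‖I22 q c N s (xs N) t (ys N)‖ ≤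
      ‖(1 / (2 * Real.pi * Complex.I) ^ 2 : ℂ)‖ * (2 * Real.pi * r * (2 * Real.pi * r') * C *
        (√(N : ℝ) * Real.exp (-(N * (δ₁ + δ₂)) + √(N : ℝ) * (K₁ + K₂)))) := by
    intro N
    rw [I22, norm_mul]
    gcongr
    refine (norm_intSmall_le (by linarith) (C := 2 * Real.pi * r' * (C * (√(N : ℝ) *
      Real.exp (-(N * (δ₁ + δ₂)) + √(N : ℝ) * (K₁ + K₂))))) fun z hz => ?_).trans
      (le_of_eq (by ring))
    refine norm_intSmall_le (by linarith) fun w hw => ?_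
    rw [norm_mul, norm_F22]
    have hH := norm_H22_le (N := N) (s := s) (t := t) h hr1 hrc hr1' hrc' hz hw
    have e : Real.exp (-(N * (δ₁ + δ₂)) + √(N : ℝ) * (K₁ + K₂)) =
        Real.exp (-(N * δ₁) + √(N : ℝ) * K₁) * Real.exp (-(N * δ₂) + √(N : ℝ) * K₂) := by
      rw [← Real.exp_add]; congr 1; ring
    calc _ ≤ Real.exp (-(N * δ₁) + √(N : ℝ) * K₁) * Real.exp (-(N * δ₂) + √(N : ℝ) * K₂) * _ :=
          mul_le_mul (mul_le_mul (hW₁ N _ z (hxs N) hz) (hW₂ N _ w (hys N) hw)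
            (inv_nonneg.2 weight_pos.le) (Real.exp_pos _).le) hH
            (norm_nonneg _) (by positivity)
      _ = _ := by rw [e, hC]; ring
  refine squeeze_zero_norm hbound ?_
  have h2 := tendsto_sqrt_mul_exp (add_pos hδ₁ hδ₂) (K₁ + K₂)
  simpa only [mul_zero] using (h2.const_mul (2 * Real.pi * r * (2 * Real.pi * r') * C)).const_mul
    ‖(1 / (2 * Real.pi * Complex.I) ^ 2 : ℂ)‖

/-- Only the modulus of `f` is prescribed, so the lemma serves both terms of `R22`: setting one
variable to `c` gives it weight `1`. -/
lemma tendsto_scale_mul_intSmall (h : IsParam q c) (ht : kappa0 q c < t)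
    (ht1 : t < 1) (hys : ∀ N, |ys N| ≤ X) {f : ℕ → ℂ → ℂ}
    (hf : ∀ N w, ‖f N w‖ = (weight q c t N (ys N) w)⁻¹) :
    Tendsto (fun N : ℕ => scale q c N / (2 * Real.pi * Complex.I) * intSmall q t fun w =>
      (f N w * fracPow q t N c) / ((c * w - 1) * fracPow q t N w)) atTop (𝓝 0) := by
  obtain ⟨δ, hδ, K, hW⟩ := exists_weight_inv_le h ht ht1 X
  have hr1 := one_lt_zc h ht1
  have hrc := zc_lt h ht
  set r := zc q t with hr
  set C := (1 + q * c) / ((r ^ 2 - 1) * (1 - q * c)) with hC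
  have hrr : 0 < r ^ 2 - 1 := by nlinarith
  have hd := h.one_sub_pos
  have hq := h.q_pos
  have hc := h.c_pos
  have hbound : ∀ N : ℕ, ‖scale q c N / (2 * Real.pi * Complex.I) * intSmall q t fun w =>
      (f N w * fracPow q t N c) / ((c * w - 1) * fracPow q t N w)‖ ≤
      sigma2 q c * (2 * Real.pi)⁻¹ * (2 * Real.pi * r) * C *
        (√(N : ℝ) * Real.exp (-(N * δ) + √(N : ℝ) * K)) := by
    intro N
    have e : ‖(scale q c N / (2 * Real.pi * Complex.I) : ℂ)‖ =
        sigma2 q c * √(N : ℝ) * (2 * Real.pi)⁻¹ := by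
      rw [norm_div, norm_scale h]
      simp [abs_of_pos Real.pi_pos, div_eq_mul_inv]
    rw [norm_mul, e]
    have := h.sigma2_pos
    calc _ ≤ sigma2 q c * √(N : ℝ) * (2 * Real.pi)⁻¹ * (2 * Real.pi * r *
          (Real.exp (-(N * δ) + √(N : ℝ) * K) * (1 + q * c) / ((r ^ 2 - 1) * (1 - q * c)))) := by
          gcongr
          refine norm_intSmall_le (by linarith) fun w hw => ?_
          refine norm_div_le_div (by positivity) ?_ ?_
          · rw [norm_mul, hf]
            gcongr
            · exact hW N _ w (hys N) hw
            · exact norm_fracPow_self_le h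
          · rw [norm_mul]
            gcongr
            · refine le_norm_mul_sub_one (by linarith) ?_ (by rw [hw])
              rw [Complex.norm_real, Real.norm_of_nonneg hc.le]
              exact hrc.le
            · exact le_norm_fracPow_of_norm_le h (by linarith)
      _ = _ := by rw [hC]; ring
  refine squeeze_zero_norm hbound ?_
  simpa using (tendsto_sqrt_mul_exp hδ K).const_mul
    (sigma2 q c * (2 * Real.pi)⁻¹ * (2 * Real.pi * r) * C)

theorem tendsto_R22 (h : IsParam q c) (hs : kappa0 q c < s) (hs1 : s < 1) (ht : kappa0 q c < t)
    (ht1 : t < 1) (hxs : ∀ N, |xs N| ≤ X) (hys : ∀ N, |ys N| ≤ X) :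
    Tendsto (fun N => R22 q c N s (xs N) t (ys N)) atTop (𝓝 0) := by
  have h1 := tendsto_scale_mul_intSmall h hs hs1 hxs
    (f := fun N z => F22 q c N s (xs N) t (ys N) z c)
    (fun N z => by rw [norm_F22, weight_self h, inv_one, mul_one])
  have h2 := tendsto_scale_mul_intSmall h ht ht1 hys
    (f := fun N w => F22 q c N s (xs N) t (ys N) c w)
    (fun N z => by rw [norm_F22, weight_self h, inv_one, one_mul])
  simpa [R22] using h1.sub h2

end Vanishing

/-! ### Deformation of `Γ_{κ,N}` to a vertical segment through `c` -/

section Deformation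

variable {q c κ θ R : ℝ}

/-- The rays leave the real axis at once at `c < q⁻¹`, hence never meet the cut of `log (1 - q z)`.
-/
lemma rayPoint_mem_regularDomain (h : IsParam q c) {φ u : ℝ} (hcos : 0 ≤ Real.cos φ)
    (hsin : Real.sin φ ≠ 0) (hu : 0 ≤ u) : rayPoint c φ u ∈ regularDomain q := by
  have h1 := h.one_lt
  have h2 := mul_nonneg hu hcos
  refine ⟨by rw [rayPoint_re]; linarith, ?_⟩
  rcases hu.eq_or_lt with rfl | hu
  · right
    rw [rayPoint_re, zero_mul, add_zero]
    exact h.mul_lt_one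
  · left
    rw [rayPoint_im]
    exact mul_ne_zero hu.ne' hsin

lemma segmentIntegral_rayPoint_add (h : IsParam q c) {f : ℂ → ℂ}
    (hf : ContinuousOn f (regularDomain q)) {φ u₁ u₂ u₃ : ℝ} (hcos : 0 ≤ Real.cos φ)
    (hsin : Real.sin φ ≠ 0) (h₁ : 0 ≤ u₁) (h₂ : 0 ≤ u₂) (h₃ : 0 ≤ u₃) :
    segmentIntegral f (rayPoint c φ u₁) (rayPoint c φ u₂) +
      segmentIntegral f (rayPoint c φ u₂) (rayPoint c φ u₃) =
    segmentIntegral f (rayPoint c φ u₁) (rayPoint c φ u₃) := by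
  have hint : ∀ a b : ℝ, 0 ≤ a → 0 ≤ b → IntervalIntegrable
      (fun u : ℝ => f (rayPoint c φ u) * Complex.exp (φ * Complex.I)) MeasureTheory.volume a b := by
    intro a b ha hb
    apply ContinuousOn.intervalIntegrable
    refine ContinuousOn.mul (hf.comp ?_ fun u hu => ?_) continuousOn_const
    · unfold rayPoint
      exact Continuous.continuousOn (by fun_prop)
    · refine rayPoint_mem_regularDomain h hcos hsin ?_
      exact (le_min ha hb).trans hu.1
  simp only [segmentIntegral_rayPoint]
  exact intervalIntegral.integral_add_adjacent_intervals (hint _ _ h₁ h₂) (hint _ _ h₂ h₃)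

/-- Cauchy's theorem in the disc around `c`: the corner of `Γ` is replaced by the vertical segment
at the height where the rays reach distance `η`, joined to them by two horizontal segments. The
outer parts of the rays and the arc are untouched. -/
lemma intGamma_eq_vertical_add (h : IsParam q c) (hθ : θ ∈ Set.Ioo (Real.pi / 4) (Real.pi / 2))
    {f : ℂ → ℂ} (hf : DifferentiableOn ℂ f (regularDomain q)) {δ η : ℝ}
    (hδ : Metric.ball (c : ℂ) δ ⊆ regularDomain q) (hη : 0 < η) (hηδ : η < δ) (hcR : c < R)
    {N : ℕ} (hN : (Real.cos θ)⁻¹ * (N : ℝ) ^ (-(1 / 2) : ℝ) ≤ η) :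
    intGamma c θ R N f =
      segmentIntegral f (c + (-(η * Real.sin θ) : ℝ) * Complex.I)
        (c + (η * Real.sin θ : ℝ) * Complex.I) +
      (segmentIntegral f (zetaMinus c θ R) (rayPoint c (-θ) η) +
        segmentIntegral f (rayPoint c (-θ) η) (c + (-(η * Real.sin θ) : ℝ) * Complex.I) +
        segmentIntegral f (c + (η * Real.sin θ : ℝ) * Complex.I) (rayPoint c θ η) +
        segmentIntegral f (rayPoint c θ η) (zetaPlus c θ R) +
        arcIntegral f R (zetaPlus c θ R).arg (2 * Real.pi - (zetaPlus c θ R).arg)) := by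
  have hcos := cos_pos_of_mem hθ
  have hsin := sin_pos_of_mem hθ
  have hL := rayLength_pos (θ := θ) h.c_pos hcR
  obtain ⟨F, hF⟩ := exists_segmentIntegral_eq_sub (hf.mono hδ)
  have hρ0 : 0 ≤ (Real.cos θ)⁻¹ * (N : ℝ) ^ (-(1 / 2) : ℝ) := by positivity
  have hray : ∀ φ u, 0 ≤ u → u ≤ η → rayPoint c φ u ∈ Metric.ball (c : ℂ) δ := by
    intro φ u hu huη
    rw [Metric.mem_ball, dist_eq_norm, norm_rayPoint_sub hu]
    linarith
  have hvert : ∀ v : ℝ, |v| = η * Real.sin θ → (c : ℂ) + v * Complex.I ∈ Metric.ball (c : ℂ) δ := by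
    intro v hv
    rw [Metric.mem_ball, dist_eq_norm, add_sub_cancel_left, norm_mul, Complex.norm_I, mul_one,
      Complex.norm_real, Real.norm_eq_abs, hv]
    nlinarith [Real.sin_le_one θ]
  have hp := hvert (η * Real.sin θ) (abs_of_pos (by positivity))
  have hm := hvert (-(η * Real.sin θ)) (by rw [abs_neg, abs_of_pos (by positivity)])
  have e1 := segmentIntegral_rayPoint_add h hf.continuousOn (φ := -θ) (u₁ := rayLength c θ R)
    (u₂ := η) (u₃ := (Real.cos θ)⁻¹ * (N : ℝ) ^ (-(1 / 2) : ℝ)) (by rw [Real.cos_neg]; exact hcos.le)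
    (by rw [Real.sin_neg]; linarith) hL.le hη.le hρ0
  have e2 := segmentIntegral_rayPoint_add h hf.continuousOn (φ := θ)
    (u₁ := (Real.cos θ)⁻¹ * (N : ℝ) ^ (-(1 / 2) : ℝ)) (u₂ := η) (u₃ := rayLength c θ R) hcos.le
    hsin.ne' hρ0 hη.le hL.le
  rw [intGamma, contourIntegral, zetaMinus, zetaPlus, ← e1, ← e2]
  rw [hF _ (hray (-θ) η hη.le le_rfl) _ (hray (-θ) _ hρ0 hN),
    hF _ (hray (-θ) _ hρ0 hN) _ (hray θ _ hρ0 hN), hF _ (hray θ _ hρ0 hN) _ (hray θ η hη.le le_rfl),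
    hF _ hm _ hp, hF _ (hray (-θ) η hη.le le_rfl) _ hm, hF _ hp _ (hray θ η hη.le le_rfl)]
  ring

/-- The pieces that the deformation leaves over stay where `Re S̄₂` is negative. -/
lemma exists_tail_bound (h : IsParam q c) (hκ : kappa0 q c < κ) (hd : IsDescentPair q c κ θ R)
    {δ η : ℝ} (hη : 0 < η) (hηδ : η < δ) (hηL : η ≤ rayLength c θ R)
    (hball : ∀ z ∈ Metric.ball (c : ℂ) δ,
      ‖S2bar q c κ z - curvature q c κ / 2 * (z - c) ^ 2‖ ≤
        curvature q c κ / 4 * min (-Real.cos (2 * θ)) 1 * ‖z - c‖ ^ 2) :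
    ∃ ε > 0, ∃ Λ : ℝ, 0 ≤ Λ ∧ ∀ (f : ℂ → ℂ) (B : ℝ),
      (∀ z, c ≤ ‖z‖ → ‖z‖ ≤ c + R → (S2bar q c κ z).re ≤ -ε → ‖f z‖ ≤ B) →
      ‖segmentIntegral f (zetaMinus c θ R) (rayPoint c (-θ) η) +
        segmentIntegral f (rayPoint c (-θ) η) (c + (-(η * Real.sin θ) : ℝ) * Complex.I) +
        segmentIntegral f (c + (η * Real.sin θ : ℝ) * Complex.I) (rayPoint c θ η) +
        segmentIntegral f (rayPoint c θ η) (zetaPlus c θ R) +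
        arcIntegral f R (zetaPlus c θ R).arg (2 * Real.pi - (zetaPlus c θ R).arg)‖ ≤ B * Λ := by
  have hθ := hd.1
  have hcos := cos_pos_of_mem hθ
  have hsin := sin_pos_of_mem hθ
  have hcos2 := cos_two_mul_neg hθ
  have hA := curvature_pos h hκ
  have hc := h.c_pos
  have hcR := isDescentPair_lt h hd
  have hR0 : 0 < R := by linarith
  have hLR := rayLength_le (θ := θ) hc.le hcos.le hR0.le
  obtain ⟨a, ha, hray⟩ := exists_ray_quadratic_bound h hκ hd
  obtain ⟨ε₁, hε₁, harc⟩ := exists_arc_bound h hd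
  set ε := min ε₁ (min (a * η ^ 2) (curvature q c κ / 4 * -Real.cos (2 * θ) * η ^ 2)) with hε
  have hε0 : 0 < ε := by
    have : 0 < -Real.cos (2 * θ) := by linarith
    refine lt_min hε₁ (lt_min (by positivity) (by positivity))
  have hle₁ : ε ≤ ε₁ := min_le_left _ _
  have hle₂ : ε ≤ a * η ^ 2 := (min_le_right _ _).trans (min_le_left _ _)
  have hle₃ : ε ≤ curvature q c κ / 4 * -Real.cos (2 * θ) * η ^ 2 :=
    (min_le_right _ _).trans (min_le_right _ _)
  refine ⟨ε, hε0, ‖rayPoint c (-θ) η - zetaMinus c θ R‖ +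
    ‖c + (-(η * Real.sin θ) : ℝ) * Complex.I - rayPoint c (-θ) η‖ +
    ‖rayPoint c θ η - (c + (η * Real.sin θ : ℝ) * Complex.I)‖ +
    ‖zetaPlus c θ R - rayPoint c θ η‖ + R * (4 * Real.pi), by positivity, fun f B hf => ?_⟩
  have hrays : ∀ φ, φ = θ ∨ φ = -θ → ∀ z ∈ segment ℝ (rayPoint c φ η)
      (rayPoint c φ (rayLength c θ R)), ‖f z‖ ≤ B := by
    intro φ hφ z hz
    have hcosφ : 0 ≤ Real.cos φ := by
      rcases hφ with rfl | rfl
      · exact hcos.le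
      · rw [Real.cos_neg]; exact hcos.le
    obtain ⟨u, hu, rfl⟩ := exists_rayPoint_of_mem_segment hηL hz
    have hu0 : 0 ≤ u := hη.le.trans hu.1
    refine hf _ (le_norm_rayPoint hu0 hcosφ) ?_ ?_
    · have h1 := norm_le_norm_add_norm_sub' (rayPoint c φ u) (c : ℂ)
      rw [norm_rayPoint_sub hu0, Complex.norm_real, Real.norm_of_nonneg hc.le] at h1
      linarith [hu.2]
    · have h1 := hray φ hφ u ⟨hu0, hu.2⟩
      have h2 : a * η ^ 2 ≤ a * u ^ 2 := by
        gcongr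
        exact hu.1
      linarith
  -- On the horizontal connectors the height is `±η sin θ` and the real part exceeds `c` by at most
  -- `η cos θ`, so `Re (z - c)² ≤ η² cos 2θ < 0`: the quadratic term is already negative.
  have hhor : ∀ φ v, φ = θ ∧ v = η * Real.sin θ ∨ φ = -θ ∧ v = -(η * Real.sin θ) →
      ∀ z ∈ segment ℝ (rayPoint c φ η) (c + (v : ℝ) * Complex.I), ‖f z‖ ≤ B := by
    intro φ v hφ z hz
    have hv : v = η * Real.sin φ ∧ Real.cos φ = Real.cos θ ∧ Real.sin φ ^ 2 = Real.sin θ ^ 2 := by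
      rcases hφ with ⟨rfl, rfl⟩ | ⟨rfl, rfl⟩
      · exact ⟨rfl, rfl, rfl⟩
      · exact ⟨by rw [Real.sin_neg]; ring, Real.cos_neg θ, by rw [Real.sin_neg]; ring⟩
    obtain ⟨hv, hcosφ, hsinφ⟩ := hv
    rw [segment_eq_image'] at hz
    obtain ⟨τ, hτ, rfl⟩ := hz
    set z := rayPoint c φ η + τ • ((c : ℂ) + (v : ℝ) * Complex.I - rayPoint c φ η) with hz
    have hre : z.re = c + (1 - τ) * (η * Real.cos θ) := by
      simp only [hz, Complex.add_re, Complex.smul_re, Complex.sub_re, rayPoint_re, hcosφ,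
        Complex.ofReal_re, Complex.re_ofReal_mul, Complex.I_re, smul_eq_mul]
      ring
    have him : z.im = η * Real.sin φ := by
      simp only [hz, Complex.add_im, Complex.smul_im, Complex.sub_im, rayPoint_im, hv,
        Complex.ofReal_im, Complex.im_ofReal_mul, Complex.I_im, smul_eq_mul]
      ring
    have hτ1 : 0 ≤ 1 - τ := by linarith [hτ.2]
    have hx0 : 0 ≤ (1 - τ) * (η * Real.cos θ) := by positivity
    have hx1 : (1 - τ) * (η * Real.cos θ) ≤ η * Real.cos θ :=
      mul_le_of_le_one_left (by positivity) (by linarith [hτ.1])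
    have hxsq : ((1 - τ) * (η * Real.cos θ)) ^ 2 ≤ (η * Real.cos θ) ^ 2 := by gcongr
    have hnsq : ‖z - c‖ ^ 2 ≤ η ^ 2 := by
      rw [Complex.sq_norm, Complex.normSq_apply, Complex.sub_re, Complex.sub_im, hre, him,
        Complex.ofReal_re, Complex.ofReal_im]
      have h1 := Real.sin_sq_add_cos_sq θ
      have h2 : (η * Real.sin φ) ^ 2 = η ^ 2 * Real.sin θ ^ 2 := by rw [mul_pow, hsinφ]
      nlinarith
    have hn : ‖z - c‖ ≤ η := by
      have := abs_le_of_sq_le_sq hnsq hη.le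
      exact (le_abs_self _).trans this
    refine hf z ?_ ?_ ?_
    · exact le_trans (by rw [hre]; linarith) (Complex.re_le_norm z)
    · have h1 := norm_le_norm_add_norm_sub' z (c : ℂ)
      rw [Complex.norm_real, Real.norm_of_nonneg hc.le] at h1
      linarith
    · have hzb : z ∈ Metric.ball (c : ℂ) δ := by
        rw [Metric.mem_ball, dist_eq_norm]
        linarith
      have h1 := S2bar_re_le_of_close (hball z hzb)
      have h2 : (z.re - c) ^ 2 - z.im ^ 2 ≤ η ^ 2 * Real.cos (2 * θ) := by
        rw [hre, him, mul_pow η (Real.sin φ), hsinφ, Real.cos_two_mul']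
        nlinarith
      have h3 : curvature q c κ / 2 * ((z.re - c) ^ 2 - z.im ^ 2) ≤
          curvature q c κ / 2 * (η ^ 2 * Real.cos (2 * θ)) :=
        mul_le_mul_of_nonneg_left h2 (by linarith)
      have h4 : curvature q c κ / 4 * min (-Real.cos (2 * θ)) 1 * ‖z - c‖ ^ 2 ≤
          curvature q c κ / 4 * -Real.cos (2 * θ) * η ^ 2 := by
        have : 0 ≤ -Real.cos (2 * θ) := by linarith
        gcongr
        exact min_le_left _ _
      linarith
  have s1 : ‖segmentIntegral f (zetaMinus c θ R) (rayPoint c (-θ) η)‖ ≤ B * _ :=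
    norm_segmentIntegral_le fun z hz => hrays (-θ) (Or.inr rfl) z (by rwa [segment_symm])
  have s2 : ‖segmentIntegral f (rayPoint c (-θ) η)
      (c + (-(η * Real.sin θ) : ℝ) * Complex.I)‖ ≤ B * _ :=
    norm_segmentIntegral_le fun z hz => hhor _ _ (Or.inr ⟨rfl, rfl⟩) z hz
  have s3 : ‖segmentIntegral f (c + (η * Real.sin θ : ℝ) * Complex.I) (rayPoint c θ η)‖ ≤ B * _ :=
    norm_segmentIntegral_le fun z hz => hhor _ _ (Or.inl ⟨rfl, rfl⟩) z (by rwa [segment_symm])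
  have s4 : ‖segmentIntegral f (rayPoint c θ η) (zetaPlus c θ R)‖ ≤ B * _ :=
    norm_segmentIntegral_le fun z hz => hrays θ (Or.inl rfl) z hz
  have s5 : ‖arcIntegral f R (zetaPlus c θ R).arg (2 * Real.pi - (zetaPlus c θ R).arg)‖ ≤
      B * R * (4 * Real.pi) := by
    refine norm_arcIntegral_le hR0.le (Complex.abs_arg_le_pi _) fun z hz => ?_
    have h1 := harc z hz
    obtain ⟨φ, -, rfl⟩ := hz
    have h2 := norm_circlePoint hR0.le φ
    exact hf _ (by linarith) (by linarith) (by linarith)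
  refine (norm_add_le _ _).trans ((add_le_add ((norm_add_le _ _).trans (add_le_add
    ((norm_add_le _ _).trans (add_le_add ((norm_add_le _ _).trans (add_le_add s1 s2)) s3))
    s4)) s5).trans (le_of_eq (by ring)))

end Deformation

/-! ### The Gaussian limits -/

section Gaussian

variable {q c s t τ X x y : ℝ} {N : ℕ} {z : ℂ} {xs ys : ℕ → ℝ}

lemma heatKernel_eq_laplace {σ : ℝ} (hσ : 0 < σ) (hc : 0 < c) (hτ : 0 < τ) (x : ℝ) :
    σ / (2 * Real.pi) * (√(2 * Real.pi / (σ ^ 2 / c ^ 2 * τ)) *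
      Real.exp (-(σ * x / c) ^ 2 / (2 * (σ ^ 2 / c ^ 2 * τ)))) * c⁻¹ = heatKernel τ x := by
  have hπ := Real.pi_pos
  have e1 : √(2 * Real.pi / (σ ^ 2 / c ^ 2 * τ)) = c / σ * (2 * Real.pi) / √(2 * Real.pi * τ) := by
    rw [Real.sqrt_eq_iff_mul_self_eq (by positivity) (by positivity), div_mul_div_comm,
      Real.mul_self_sqrt (by positivity)]
    field_simp
  have e2 : -(σ * x / c) ^ 2 / (2 * (σ ^ 2 / c ^ 2 * τ)) = -x ^ 2 / (2 * τ) := by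
    field_simp
  rw [e1, e2, heatKernel]
  field_simp

/-- The Laplace method, normalized as in the kernel. -/
lemma tendsto_segmentIntegral_heatKernel (h : IsParam q c) (hτ : 0 < τ) {φ : ℂ → ℂ}
    {g : ℕ → ℂ → ℂ} {δ M : ℝ} {ℓ : ℕ → ℝ} (hδ : 0 ≤ δ)
    (hφ : ∀ η > 0, ∀ᶠ z in 𝓝 (c : ℂ),
      ‖φ z - (sigma2 q c ^ 2 / c ^ 2 * τ : ℝ) / 2 * (z - c) ^ 2‖ ≤ η * ‖z - c‖ ^ 2)
    (hφδ : ∀ z ∈ Metric.closedBall (c : ℂ) δ,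
      ‖φ z - (sigma2 q c ^ 2 / c ^ 2 * τ : ℝ) / 2 * (z - c) ^ 2‖ ≤
        (sigma2 q c ^ 2 / c ^ 2 * τ) / 4 * ‖z - c‖ ^ 2)
    (hℓ : ∀ᶠ N in atTop, ℓ N ≤ δ) (hℓ' : Tendsto (fun N : ℕ => ℓ N * √(N : ℝ)) atTop atTop)
    (hx : Tendsto xs atTop (𝓝 x))
    (hg : ∀ N, ∀ z ∈ Metric.closedBall (c : ℂ) δ, ‖g N z‖ ≤ M)
    (hg₀ : ∀ zs : ℕ → ℂ, Tendsto zs atTop (𝓝 (c : ℂ)) →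
      Tendsto (fun N => g N (zs N)) atTop (𝓝 (c : ℂ)⁻¹))
    (hcont : ∀ N : ℕ, ContinuousOn (fun z => Complex.exp ((N : ℝ) * φ z -
      (scale q c N * xs N : ℝ) * Complex.log (z / c)) * g N z) (Metric.closedBall (c : ℂ) δ)) :
    Tendsto (fun N : ℕ => scale q c N / (2 * Real.pi * Complex.I) *
      segmentIntegral (fun z => Complex.exp ((N : ℝ) * φ z -
        (scale q c N * xs N : ℝ) * Complex.log (z / c)) * g N z)
        (c + (-ℓ N : ℝ) * Complex.I) (c + (ℓ N : ℝ) * Complex.I)) atTop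
      (𝓝 (heatKernel τ x : ℂ)) := by
  have hσ := h.sigma2_pos
  have hc := h.c_pos
  have hlim : ∀ v : ℝ, Tendsto (fun N : ℕ => (c : ℂ) + (v / √(N : ℝ) : ℝ) * Complex.I) atTop
      (𝓝 (c : ℂ)) := by
    intro v
    have h2 : Continuous fun y : ℝ => (c : ℂ) + (y : ℂ) * Complex.I := by fun_prop
    exact (h2.tendsto' 0 c (by simp)).comp (tendsto_sqrt_natCast_atTop.const_div_atTop v)
  have key := tendsto_laplace_vertical (σ := sigma2 q c) hc
    (show 0 < sigma2 q c ^ 2 / c ^ 2 * τ by positivity) hδ hφ hφδ hℓ hℓ' hx hg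
    (fun v => hg₀ _ (hlim v)) hcont
  have key2 := key.const_mul (sigma2 q c / (2 * Real.pi) : ℂ)
  rw [← heatKernel_eq_laplace hσ hc hτ x]
  convert key2 using 2 with N
  · rw [segmentIntegral_ray, intervalIntegral.integral_mul_const, scale]
    have := Real.pi_ne_zero
    push_cast
    field_simp
  · push_cast
    ring

lemma differentiableOn_exp_mul (h : IsParam q c) {φ g : ℂ → ℂ}
    (hφ : DifferentiableOn ℂ φ (regularDomain q)) (hg : DifferentiableOn ℂ g (regularDomain q))
    (n a : ℝ) : DifferentiableOn ℂ
      (fun z => Complex.exp (n * φ z - a * Complex.log (z / c)) * g z) (regularDomain q) := by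
  have hlog : DifferentiableOn ℂ (fun z : ℂ => Complex.log (z / c)) (regularDomain q) := by
    intro z hz
    refine ((differentiableAt_id.div_const (c : ℂ)).clog ?_).differentiableWithinAt
    left
    have h1 : (z / c).re = z.re / c := Complex.div_ofReal_re z c
    change 0 < (z / c).re
    rw [h1]
    exact div_pos (by linarith [hz.1]) h.c_pos
  exact (((hφ.const_mul (n : ℂ)).sub (hlog.const_mul (a : ℂ))).cexp).mul hg

lemma differentiableOn_S2bar (h : IsParam q c) :
    DifferentiableOn ℂ (S2bar q c s) (regularDomain q) := fun _ hz =>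
  ((hasDerivAt_S2 h hz).differentiableAt.sub_const _).differentiableWithinAt

lemma differentiableOn_G2bar (h : IsParam q c) :
    DifferentiableOn ℂ (G2bar q c) (regularDomain q) := fun _ hz =>
  ((hasDerivAt_G2 h hz).differentiableAt.sub_const _).differentiableWithinAt

/-! #### The integral over `Γ_{s,N}` -/

/-- The rational factor of the single integral over `Γ_{s,N}`. -/
def gammaFactor (q c s : ℝ) (N : ℕ) (z : ℂ) : ℂ :=
  ((z * c - 1) * fracPow q s N z) / (z * (z ^ 2 - 1) * fracPow q s N c)

/-- The lower bound `b` is free because points near `c` can have modulus below `c`; they only need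
to stay away from the pole at `1`. -/
lemma norm_gammaFactor_le (h : IsParam q c) {b ρ : ℝ} (hb : 1 < b) (hz : b ≤ ‖z‖) (hzρ : ‖z‖ ≤ ρ) :
    ‖gammaFactor q c s N z‖ ≤
      ((ρ * c + 1) * (1 + q * ρ)) / (b * (b ^ 2 - 1) * (1 - q * c)) := by
  have hc := h.c_pos
  have hd := h.one_sub_pos
  have hq := h.q_pos
  have hb1 : 0 < b ^ 2 - 1 := by nlinarith
  have hρ : 0 < ρ := by linarith
  refine norm_div_le_div (by positivity) ?_ ?_
  · rw [norm_mul]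
    gcongr
    · refine (norm_sub_le _ _).trans ?_
      rw [norm_mul, norm_one, Complex.norm_real, Real.norm_of_nonneg hc.le]
      gcongr
    · exact norm_fracPow_le_of_norm_le hq hzρ
  · rw [norm_mul, norm_mul]
    gcongr
    · rw [sq z]; exact le_norm_mul_sub_one (by linarith) hz hz
    · exact le_norm_fracPow_self h

lemma differentiableOn_gammaFactor (h : IsParam q c) :
    DifferentiableOn ℂ (gammaFactor q c s N) (regularDomain q) := by
  refine DifferentiableOn.div (((differentiableOn_id.mul_const _).sub_const _).mul
    (differentiableOn_fracPow h.q_pos)) ((differentiableOn_id.mul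
    ((differentiableOn_id.pow 2).sub_const 1)).mul_const _) fun z hz => ?_
  exact mul_ne_zero (mul_ne_zero (ne_zero_of_mem hz)
    (sq_sub_one_ne_zero (one_lt_norm_of_mem hz))) (fracPow_ne_zero h.q_pos h.mem_regularDomain)

/-- At `z = w = c` the factor `zc - 1` cancels `z² - 1`, leaving `1 / c`. -/
lemma tendsto_gammaFactor (h : IsParam q c) {zs : ℕ → ℂ} (hz : Tendsto zs atTop (𝓝 (c : ℂ))) :
    Tendsto (fun N => gammaFactor q c s N (zs N)) atTop (𝓝 (c : ℂ)⁻¹) := by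
  have hc0 := h.ofReal_ne.1
  have hc1 : (c : ℂ) ^ 2 - 1 ≠ 0 := sq_sub_one_ne_zero (by
    rw [Complex.norm_real, Real.norm_of_nonneg h.c_pos.le]; exact h.one_lt)
  have h1 := (((hz.mul_const (c : ℂ)).sub_const 1).div (hz.mul ((hz.pow 2).sub_const 1))
    (mul_ne_zero hc0 hc1)).mul (tendsto_fracPow_div (s := s) h hz)
  have e : ((c : ℂ) * c - 1) / (c * (c ^ 2 - 1)) * 1 = (c : ℂ)⁻¹ := by
    rw [← sq]
    field_simp
  rw [e] at h1
  refine h1.congr fun N => ?_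
  simp only [Pi.div_apply, gammaFactor]
  rw [div_mul_div_comm]

theorem tendsto_intGamma_heatKernel (h : IsParam q c) (hs : kappa0 q c < s) {θ R : ℝ}
    (hd : IsDescentPair q c s θ R) (hx : Tendsto xs atTop (𝓝 x)) (hxs : ∀ N, |xs N| ≤ X) :
    Tendsto (fun N : ℕ => scale q c N / (2 * Real.pi * Complex.I) *
      intGamma c θ R N (fun z => Complex.exp ((N : ℝ) * S2bar q c s z -
        (scale q c N * xs N : ℝ) * Complex.log (z / c)) * gammaFactor q c s N z)) atTop
      (𝓝 (heatKernel (s - kappa0 q c) x : ℂ)) := by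
  have hθ := hd.1
  have hcos := cos_pos_of_mem hθ
  have hsin := sin_pos_of_mem hθ
  have hcos2 := cos_two_mul_neg hθ
  have hA := curvature_pos h hs
  have hc := h.c_pos
  have hcR := isDescentPair_lt h hd
  have hL := rayLength_pos (θ := θ) hc hcR
  have hc1 := h.one_lt
  have hσ := h.sigma2_pos
  have hX0 : 0 ≤ X := (abs_nonneg _).trans (hxs 0)
  obtain ⟨δ, hδ, hreg, hball⟩ := exists_ball_S2bar_quadratic h hs (m := -Real.cos (2 * θ)) (by linarith)
  -- The three bounds keep the pieces near `c` in the Taylor disc, on the rays before they reach the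
  -- arc, and at modulus at least `(1 + c) / 2 > 1`.
  set η := min (δ / 2) (min (rayLength c θ R) ((c - 1) / 2)) with hη
  have hη0 : 0 < η := lt_min (by linarith) (lt_min hL (by linarith))
  have hηδ : η < δ := (min_le_left _ _).trans_lt (by linarith)
  have hηL : η ≤ rayLength c θ R := (min_le_right _ _).trans (min_le_left _ _)
  have hηc : η ≤ (c - 1) / 2 := (min_le_right _ _).trans (min_le_right _ _)
  have hηs : η * Real.sin θ ≤ η := mul_le_of_le_one_right hη0.le (Real.sin_le_one θ)
  have hsub : Metric.closedBall (c : ℂ) (η * Real.sin θ) ⊆ Metric.ball (c : ℂ) δ :=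
    Metric.closedBall_subset_ball (by linarith)
  obtain ⟨ε, hε, Λ, hΛ, htail⟩ := exists_tail_bound h hs hd hη0 hηδ hηL hball
  set f : ℕ → ℂ → ℂ := fun N z => Complex.exp ((N : ℝ) * S2bar q c s z -
        (scale q c N * xs N : ℝ) * Complex.log (z / c)) * gammaFactor q c s N z with hf
  set b := (1 + c) / 2 with hb
  have hb1 : 1 < b := by rw [hb]; linarith
  set Cg := (((c + R) * c + 1) * (1 + q * (c + R))) / (b * (b ^ 2 - 1) * (1 - q * c)) with hCg
  set K := sigma2 q c * X / c * (2 * c + R) with hK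
  have hdiff : ∀ N, DifferentiableOn ℂ (f N) (regularDomain q) := fun N =>
    differentiableOn_exp_mul h (differentiableOn_S2bar h) (differentiableOn_gammaFactor h) _ _
  have hmain : Tendsto (fun N : ℕ => scale q c N / (2 * Real.pi * Complex.I) *
      segmentIntegral (f N) (c + (-(η * Real.sin θ) : ℝ) * Complex.I)
        (c + (η * Real.sin θ : ℝ) * Complex.I)) atTop (𝓝 (heatKernel (s - kappa0 q c) x : ℂ)) := by
    refine tendsto_segmentIntegral_heatKernel (ℓ := fun _ => η * Real.sin θ)
      (δ := η * Real.sin θ) (M := Cg) h (by linarith) (by positivity)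
      (fun η hη => eventually_S2bar_quadratic h hη) (fun z hz => ?_)
      (Eventually.of_forall fun _ => le_rfl)
      (tendsto_sqrt_natCast_atTop.const_mul_atTop (by positivity)) hx (fun N z hz => ?_)
      (fun zs hzs => tendsto_gammaFactor h hzs)
      (fun N => (hdiff N).continuousOn.mono (hsub.trans hreg))
    · refine (hball z (hsub hz)).trans ?_
      rw [← curvature]
      gcongr
      exact mul_le_of_le_one_right (by positivity) (min_le_right _ _)
    · rw [Metric.mem_closedBall, dist_eq_norm] at hz
      have hcn : ‖(c : ℂ)‖ = c := by rw [Complex.norm_real, Real.norm_of_nonneg hc.le]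
      refine norm_gammaFactor_le h hb1 ?_ ?_
      · have h1 := norm_sub_norm_le (c : ℂ) z
        rw [norm_sub_rev, hcn] at h1
        rw [hb]
        linarith
      · have h1 := norm_le_norm_add_norm_sub' z (c : ℂ)
        rw [hcn] at h1
        linarith
  have hrest : Tendsto (fun N : ℕ => scale q c N / (2 * Real.pi * Complex.I) *
      (segmentIntegral (f N) (zetaMinus c θ R) (rayPoint c (-θ) η) +
        segmentIntegral (f N) (rayPoint c (-θ) η) (c + (-(η * Real.sin θ) : ℝ) * Complex.I) +
        segmentIntegral (f N) (c + (η * Real.sin θ : ℝ) * Complex.I) (rayPoint c θ η) +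
        segmentIntegral (f N) (rayPoint c θ η) (zetaPlus c θ R) +
        arcIntegral (f N) R (zetaPlus c θ R).arg (2 * Real.pi - (zetaPlus c θ R).arg)))
      atTop (𝓝 0) := by
    have hCg0 : 0 ≤ Cg :=
      (norm_nonneg _).trans (norm_gammaFactor_le (s := s) (N := 0) (z := c) (ρ := c + R) h hb1
        (by rw [Complex.norm_real, Real.norm_of_nonneg hc.le, hb]; linarith)
        (by rw [Complex.norm_real, Real.norm_of_nonneg hc.le]; linarith))
    refine squeeze_zero_norm (a := fun N : ℕ => sigma2 q c * (2 * Real.pi)⁻¹ * Cg * Λ *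
      (√(N : ℝ) * Real.exp (-(N * ε) + √(N : ℝ) * K))) (fun N => ?_) ?_
    · have e : ‖(scale q c N / (2 * Real.pi * Complex.I) : ℂ)‖ =
          sigma2 q c * √(N : ℝ) * (2 * Real.pi)⁻¹ := by
        rw [norm_div, norm_scale h]
        simp [abs_of_pos Real.pi_pos, div_eq_mul_inv]
      rw [norm_mul, e]
      have := htail (f N) (Cg * Real.exp (-(N * ε) + √(N : ℝ) * K)) fun z hz hzR hzε => by
        have hw : ‖f N z‖ = weight q c s N (xs N) z * ‖gammaFactor q c s N z‖ := by
          rw [hf]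
          simp only
          rw [norm_mul, norm_exp_weight, weight]
        have h1 : ‖z - c‖ ≤ 2 * c + R := by
          refine (norm_sub_le _ _).trans ?_
          rw [Complex.norm_real, Real.norm_of_nonneg hc.le]
          linarith
        rw [hw, mul_comm]
        refine mul_le_mul (norm_gammaFactor_le h hb1 (by rw [hb]; linarith) hzR) ?_ weight_pos.le hCg0
        refine (weight_le h (hxs N) hz).trans (Real.exp_le_exp.2 ?_)
        have h2 := mul_le_mul_of_nonneg_left hzε (Nat.cast_nonneg (α := ℝ) N)
        have h3 : √(N : ℝ) * (sigma2 q c * X / c * ‖z - c‖) ≤ √(N : ℝ) * K := by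
          rw [hK]
          gcongr
        linarith
      calc _ ≤ sigma2 q c * √(N : ℝ) * (2 * Real.pi)⁻¹ *
            (Cg * Real.exp (-(N * ε) + √(N : ℝ) * K) * Λ) := by gcongr
        _ = _ := by ring
    · simpa only [mul_zero] using (tendsto_sqrt_mul_exp hε K).const_mul
        (sigma2 q c * (2 * Real.pi)⁻¹ * Cg * Λ)
  have hsum := hmain.add hrest
  rw [add_zero] at hsum
  refine hsum.congr' ?_
  filter_upwards [(tendsto_corner θ).eventually_le_const hη0] with N hN
  rw [← mul_add, intGamma_eq_vertical_add h hθ (hdiff N) hreg hη0 hηδ hcR hN]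

/-! #### The integral over `γ̃_N` -/

/-- The rational factor of the integral over `γ̃_N`. -/
def tildeFactor (q c s t : ℝ) (N : ℕ) (z : ℂ) : ℂ :=
  (fracPow q s N z * fracPow q t N c) / (z * fracPow q t N z * fracPow q s N c)

lemma norm_tildeFactor_le (h : IsParam q c) {b ρ : ℝ} (hb : 0 < b) (hb1 : b ≤ 1) (hz : 1 ≤ ‖z‖)
    (hzρ : ‖z‖ ≤ ρ) (hbz : b ≤ ‖1 - q * z‖) :
    ‖tildeFactor q c s t N z‖ ≤ ((1 + q * ρ) * (1 + q * c)) / (1 * b * (1 - q * c)) := by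
  have hc := h.c_pos
  have hd := h.one_sub_pos
  have hq := h.q_pos
  have hρ : 0 < ρ := by linarith
  refine norm_div_le_div (by positivity) ?_ ?_
  · rw [norm_mul]
    gcongr
    · exact norm_fracPow_le_of_norm_le hq hzρ
    · exact norm_fracPow_self_le h
  · rw [norm_mul, norm_mul]
    gcongr
    · exact le_trans (le_of_eq (min_eq_right hb1).symm) (le_norm_fracPow hb hbz)
    · exact le_norm_fracPow_self h

lemma differentiableOn_tildeFactor (h : IsParam q c) :
    DifferentiableOn ℂ (tildeFactor q c s t N) (regularDomain q) := by
  refine DifferentiableOn.div ((differentiableOn_fracPow h.q_pos).mul_const _)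
    ((differentiableOn_id.mul (differentiableOn_fracPow h.q_pos)).mul_const _) fun z hz => ?_
  exact mul_ne_zero (mul_ne_zero (ne_zero_of_mem hz) (fracPow_ne_zero h.q_pos hz))
    (fracPow_ne_zero h.q_pos h.mem_regularDomain)

lemma tendsto_tildeFactor (h : IsParam q c) {zs : ℕ → ℂ} (hz : Tendsto zs atTop (𝓝 (c : ℂ))) :
    Tendsto (fun N => tildeFactor q c s t N (zs N)) atTop (𝓝 (c : ℂ)⁻¹) := by
  have h1 := ((tendsto_fracPow_div (s := s) h hz).div (tendsto_fracPow_div (s := t) h hz)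
    one_ne_zero).div hz h.ofReal_ne.1
  rw [div_one, one_div] at h1
  refine h1.congr fun N => ?_
  simp only [Pi.div_apply, tildeFactor]
  rw [div_div_div_eq, div_div]
  congr 1
  ring

/-- The half-length `N^{-1/12}` of the vertical segment of `γ̃_N`. -/
def tildeLength (N : ℕ) : ℝ := √((N : ℝ) ^ (-(1 / 6) : ℝ))

lemma tildeLength_sq (N : ℕ) : tildeLength N ^ 2 = (N : ℝ) ^ (-(1 / 6) : ℝ) :=
  Real.sq_sqrt (by positivity)

lemma tendsto_tildeLength : Tendsto tildeLength atTop (𝓝 0) := by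
  have h1 : Tendsto (fun N : ℕ => (N : ℝ) ^ (-(1 / 6) : ℝ)) atTop (𝓝 0) :=
    (tendsto_rpow_neg_atTop (by norm_num)).comp tendsto_natCast_atTop_atTop
  have h2 := h1.sqrt
  rwa [Real.sqrt_zero] at h2

/-- The quantity equals `N^{1/3}`. It measures how much the decay `N ℓ²` on the arc of `γ̃_N`
exceeds the growth of order `√N` of the factor carrying `x`. -/
lemma tendsto_sqrt_mul_tildeLength_sq :
    Tendsto (fun N : ℕ => √(N : ℝ) * tildeLength N ^ 2) atTop atTop := by
  have h1 : Tendsto (fun N : ℕ => (N : ℝ) ^ (1 / 3 : ℝ)) atTop atTop :=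
    (tendsto_rpow_atTop (by norm_num)).comp tendsto_natCast_atTop_atTop
  refine h1.congr' ?_
  filter_upwards [eventually_gt_atTop 0] with N hN
  rw [tildeLength_sq, Real.sqrt_eq_rpow, ← Real.rpow_add (by exact_mod_cast hN)]
  norm_num

lemma tendsto_tildeLength_mul_sqrt :
    Tendsto (fun N : ℕ => tildeLength N * √(N : ℝ)) atTop atTop := by
  refine tendsto_atTop_mono' _ ?_ tendsto_sqrt_mul_tildeLength_sq
  filter_upwards [tendsto_tildeLength.eventually_le_const one_pos] with N hN
  have h0 : 0 ≤ tildeLength N := Real.sqrt_nonneg _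
  rw [mul_comm, sq]
  gcongr
  exact mul_le_of_le_one_left h0 hN

lemma rayPoint_pi_div_two (u : ℝ) : rayPoint c (Real.pi / 2) u = c + u * Complex.I := by
  rw [rayPoint]
  push_cast
  rw [Complex.exp_pi_div_two_mul_I]

lemma rayPoint_neg_pi_div_two (u : ℝ) :
    rayPoint c (-(Real.pi / 2)) u = c + (-u : ℝ) * Complex.I := by
  rw [rayPoint]
  push_cast
  rw [neg_mul, Complex.exp_neg, Complex.exp_pi_div_two_mul_I, Complex.inv_I]
  ring

lemma rayLength_tilde (N : ℕ) :
    rayLength c (Real.pi / 2) √(c ^ 2 + (N : ℝ) ^ (-(1 / 6) : ℝ)) = tildeLength N := by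
  rw [rayLength, Real.cos_pi_div_two, Real.sin_pi_div_two, Real.sq_sqrt (by positivity),
    tildeLength, mul_zero, neg_zero, zero_add]
  congr 1
  ring

/-- The part of the circle `|z| = |c + iℓ|` beyond the vertical segment lies in `Re z ≤ c`. -/
lemma re_le_of_mem_arc {ℓ r : ℝ} (hℓ : 0 ≤ ℓ) (hr : ‖(c : ℂ) + ℓ * Complex.I‖ = r)
    (hz : z ∈ circlePoint r '' Set.Icc ((c : ℂ) + ℓ * Complex.I).arg
      (2 * Real.pi - ((c : ℂ) + ℓ * Complex.I).arg)) : z.re ≤ c := by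
  obtain ⟨φ, hφ, rfl⟩ := hz
  set α := ((c : ℂ) + ℓ * Complex.I).arg with hα
  have hα0 : 0 ≤ α := Complex.arg_nonneg_iff.2 (by simpa using hℓ)
  have hr0 : 0 ≤ r := hr ▸ norm_nonneg _
  have h1 : Real.cos φ ≤ Real.cos α := by
    rcases le_total φ Real.pi with hle | hle
    · exact Real.cos_le_cos_of_nonneg_of_le_pi hα0 hle hφ.1
    · rw [← Real.cos_two_pi_sub φ]
      exact Real.cos_le_cos_of_nonneg_of_le_pi hα0 (by linarith) (by linarith [hφ.2])
  have h2 : r * Real.cos α = c := by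
    rw [← hr, hα, Complex.norm_mul_cos_arg]
    simp
  calc (circlePoint r φ).re = r * Real.cos φ := by
        rw [circlePoint, Complex.re_ofReal_mul, Complex.exp_ofReal_mul_I_re]
    _ ≤ r * Real.cos α := by gcongr
    _ = c := h2

/-- `‖1 - qz‖` on the arc of `γ̃_N`. -/
lemma le_norm_one_sub_sq (hq : 0 < q) {ℓ : ℝ} (hre : z.re ≤ c) (hz : ‖z‖ ^ 2 = c ^ 2 + ℓ ^ 2) :
    (1 - q * c) ^ 2 + q ^ 2 * ℓ ^ 2 ≤ ‖1 - q * z‖ ^ 2 := by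
  have h1 : ‖1 - q * z‖ ^ 2 = 1 - 2 * q * z.re + q ^ 2 * ‖z‖ ^ 2 := by
    rw [Complex.sq_norm, Complex.normSq_apply, Complex.sq_norm, Complex.normSq_apply]
    simp only [Complex.sub_re, Complex.sub_im, Complex.one_re, Complex.one_im,
      Complex.re_ofReal_mul, Complex.im_ofReal_mul]
    ring
  rw [h1, hz]
  nlinarith

/-- Both parts of `Re G₂` decrease: `|z| ≥ c`, while `|1 - qz|²` gains at least `q²ℓ²`. The
inequality `log y ≥ 1 - 1/y` makes the gain quantitative. -/
lemma G2bar_re_le_of_arc (h : IsParam q c) {ℓ : ℝ} (hℓ : |ℓ| ≤ 1) (hre : z.re ≤ c)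
    (hz : ‖z‖ ^ 2 = c ^ 2 + ℓ ^ 2) :
    (G2bar q c z).re ≤ -(q ^ 2 / (2 * ((1 - q * c) ^ 2 + q ^ 2)) * ℓ ^ 2) := by
  have hd := h.one_sub_pos
  have hc := h.c_pos
  have hq := h.q_pos
  have hℓ1 : ℓ ^ 2 ≤ 1 := by rw [← sq_abs]; exact pow_le_one₀ (abs_nonneg _) hℓ
  have h1 := le_norm_one_sub_sq hq hre hz
  have hc2 : ‖1 - (q : ℂ) * c‖ = 1 - q * c := by
    have : (1 - (q : ℂ) * c) = ((1 - q * c : ℝ) : ℂ) := by push_cast; rfl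
    rw [this, Complex.norm_real, Real.norm_of_nonneg hd.le]
  have hc3 : ‖(c : ℂ)‖ = c := by rw [Complex.norm_real, Real.norm_of_nonneg hc.le]
  have hcz : c ≤ ‖z‖ := by
    refine (abs_le_of_sq_le_sq' ?_ (norm_nonneg z)).2
    rw [hz]
    nlinarith [sq_nonneg ℓ]
  have h2 : p2 q c * Real.log c ≤ p2 q c * Real.log ‖z‖ :=
    mul_le_mul_of_nonneg_left (Real.log_le_log hc hcz) h.p2_pos.le
  set X := ‖1 - q * z‖ with hX
  set P := (1 - q * c) ^ 2 + q ^ 2 * ℓ ^ 2 with hP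
  have hP0 : 0 < P := by positivity
  have hX2 : 0 < X ^ 2 := hP0.trans_le h1
  have h3 : 1 - ((1 - q * c) ^ 2) / P ≤ 2 * Real.log X - 2 * Real.log (1 - q * c) := by
    have e1 : Real.log P ≤ 2 * Real.log X := by
      have := Real.log_le_log hP0 h1
      rwa [Real.log_pow, Nat.cast_ofNat] at this
    have e2 := Real.one_sub_inv_le_log_of_pos (x := P / (1 - q * c) ^ 2) (by positivity)
    rw [inv_div, Real.log_div hP0.ne' (by positivity), Real.log_pow, Nat.cast_ofNat] at e2
    linarith
  have h4 : 2 * (q ^ 2 / (2 * ((1 - q * c) ^ 2 + q ^ 2)) * ℓ ^ 2) ≤ 1 - ((1 - q * c) ^ 2) / P := by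
    have e1 : 1 - ((1 - q * c) ^ 2) / P = q ^ 2 * ℓ ^ 2 / P := by
      rw [one_sub_div hP0.ne', hP]
      ring
    have e2 : 2 * (q ^ 2 / (2 * ((1 - q * c) ^ 2 + q ^ 2)) * ℓ ^ 2) =
        q ^ 2 * ℓ ^ 2 / ((1 - q * c) ^ 2 + q ^ 2) := by field_simp
    rw [e1, e2]
    gcongr
    rw [hP]
    nlinarith [sq_nonneg q]
  rw [G2bar_re, hc2, hc3]
  linarith

/-- The contour is vertical at `c` already, so no deformation is needed. The vertical segment gives
the heat kernel, and the decay `exp(-const · N^{5/6})` on the arc removes the rest. -/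
theorem tendsto_intTilde_heatKernel (h : IsParam q c) (hst : t < s)
    (hx : Tendsto xs atTop (𝓝 x)) (hxs : ∀ N, |xs N| ≤ X) :
    Tendsto (fun N : ℕ => scale q c N / (2 * Real.pi * Complex.I) *
      intTilde c N (fun z => Complex.exp ((N : ℝ) * ((s - t : ℝ) * G2bar q c z) -
        (scale q c N * xs N : ℝ) * Complex.log (z / c)) * tildeFactor q c s t N z)) atTop
      (𝓝 (heatKernel (s - t) x : ℂ)) := by
  have hc := h.c_pos
  have hq := h.q_pos
  have hc1 := h.one_lt
  have hσ := h.sigma2_pos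
  have hd := h.one_sub_pos
  have hX0 : 0 ≤ X := (abs_nonneg _).trans (hxs 0)
  have hτ : 0 < s - t := by linarith
  have hcn : ‖(c : ℂ)‖ = c := by rw [Complex.norm_real, Real.norm_of_nonneg hc.le]
  set A := sigma2 q c ^ 2 / c ^ 2 * (s - t) with hA
  have hA0 : 0 < A := by positivity
  have hquad : ∀ η > 0, ∀ᶠ z in 𝓝 (c : ℂ),
      ‖(s - t : ℝ) * G2bar q c z - (A : ℝ) / 2 * (z - c) ^ 2‖ ≤ η * ‖z - c‖ ^ 2 := by
    intro η hη
    filter_upwards [eventually_G2bar_quadratic h (div_pos hη hτ)] with z hz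
    have e : (s - t : ℝ) * G2bar q c z - (A : ℝ) / 2 * (z - c) ^ 2 = ((s - t : ℝ) : ℂ) *
        (G2bar q c z - (sigma2 q c ^ 2 / c ^ 2 : ℝ) / 2 * (z - c) ^ 2) := by
      rw [hA]; push_cast; ring
    rw [e, norm_mul, Complex.norm_real, Real.norm_of_nonneg hτ.le]
    calc _ ≤ (s - t) * (η / (s - t) * ‖z - c‖ ^ 2) := by gcongr
      _ = _ := by field_simp
  -- In `tildeFactor` the power `fracPow q t N z` is in the denominator, so `1 - q z` must be
  -- bounded away from `0`.
  have hnear : ∀ᶠ z : ℂ in 𝓝 (c : ℂ), (1 - q * c) / 2 < ‖1 - q * z‖ := by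
    have hcont : ContinuousAt (fun z : ℂ => ‖1 - q * z‖) (c : ℂ) := by fun_prop
    refine continuousAt_const.eventually_lt hcont ?_
    have : (1 - (q : ℂ) * c) = ((1 - q * c : ℝ) : ℂ) := by push_cast; rfl
    rw [this, Complex.norm_real, Real.norm_of_nonneg hd.le]
    linarith
  obtain ⟨δ, hδ, hball⟩ := Metric.eventually_nhds_iff_ball.1 (((hquad (A / 4) (by positivity)).and
    hnear).and ((isOpen_regularDomain q).eventually_mem h.mem_regularDomain))
  have hreg : Metric.ball (c : ℂ) δ ⊆ regularDomain q := fun z hz => (hball z hz).2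
  have hsub : Metric.closedBall (c : ℂ) (δ / 2) ⊆ Metric.ball (c : ℂ) δ :=
    Metric.closedBall_subset_ball (by linarith)
  set f : ℕ → ℂ → ℂ := fun N z => Complex.exp ((N : ℝ) * ((s - t : ℝ) * G2bar q c z) -
        (scale q c N * xs N : ℝ) * Complex.log (z / c)) * tildeFactor q c s t N z with hf
  have hdiff : ∀ N, DifferentiableOn ℂ (f N) (regularDomain q) := fun N =>
    differentiableOn_exp_mul h ((differentiableOn_G2bar h).const_mul _)
      (differentiableOn_tildeFactor h) _ _
  set b := (1 - q * c) / 2 with hb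
  have hb0 : 0 < b := by positivity
  have hqc : 0 < q * c := by positivity
  have hb1 : b ≤ 1 := by rw [hb]; linarith
  set C₁ := ((1 + q * (c + δ)) * (1 + q * c)) / (1 * b * (1 - q * c)) with hC₁
  have hmain : Tendsto (fun N : ℕ => scale q c N / (2 * Real.pi * Complex.I) *
      segmentIntegral (f N) (c + (-tildeLength N : ℝ) * Complex.I)
        (c + (tildeLength N : ℝ) * Complex.I)) atTop (𝓝 (heatKernel (s - t) x : ℂ)) := by
    refine tendsto_segmentIntegral_heatKernel (δ := δ / 2) (M := C₁) h hτ (by positivity)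
      hquad (fun z hz => (hball z (hsub hz)).1.1)
      (tendsto_tildeLength.eventually_le_const (by positivity)) tendsto_tildeLength_mul_sqrt
      hx (fun N z hz => ?_) (fun zs hzs => tendsto_tildeFactor h hzs)
      (fun N => (hdiff N).continuousOn.mono (hsub.trans hreg))
    refine norm_tildeFactor_le h hb0 hb1 (one_lt_norm_of_mem (hreg (hsub hz))).le ?_
      (hball z (hsub hz)).1.2.le
    have h1 := norm_le_norm_add_norm_sub' z (c : ℂ)
    rw [Metric.mem_closedBall, dist_eq_norm] at hz
    rw [hcn] at h1
    linarith
  set rad : ℕ → ℝ := fun N => √(c ^ 2 + (N : ℝ) ^ (-(1 / 6) : ℝ)) with hrad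
  have hradsq : ∀ N, rad N ^ 2 = c ^ 2 + tildeLength N ^ 2 := by
    intro N
    rw [hrad, tildeLength_sq]
    exact Real.sq_sqrt (by positivity)
  set a := q ^ 2 / (2 * ((1 - q * c) ^ 2 + q ^ 2)) with ha
  have ha0 : 0 < a := by positivity
  set C₂ := ((1 + q * (c + 1)) * (1 + q * c)) / (1 * b * (1 - q * c)) with hC₂
  have hC₂0 : 0 ≤ C₂ := by positivity
  set K := sigma2 q c * X * ((2 * c + 1) / c) with hK
  have hζ : ∀ N, zetaPlus c (Real.pi / 2) (rad N) = c + tildeLength N * Complex.I := by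
    intro N
    rw [zetaPlus, hrad, rayLength_tilde, rayPoint_pi_div_two]
  have hrest : Tendsto (fun N : ℕ => scale q c N / (2 * Real.pi * Complex.I) *
      arcIntegral (f N) (rad N) (zetaPlus c (Real.pi / 2) (rad N)).arg
        (2 * Real.pi - (zetaPlus c (Real.pi / 2) (rad N)).arg)) atTop (𝓝 0) := by
    refine squeeze_zero_norm' (a := fun N : ℕ => sigma2 q c * (2 * Real.pi)⁻¹ * C₂ * (c + 1) *
      (4 * Real.pi) * (√(N : ℝ) * Real.exp (√(N : ℝ) *
        (K - (s - t) * a * (√(N : ℝ) * tildeLength N ^ 2))))) ?_ ?_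
    · filter_upwards [tendsto_tildeLength.eventually_le_const one_pos] with N hN
      have hℓ0 : 0 ≤ tildeLength N := Real.sqrt_nonneg _
      have hrad0 : 0 ≤ rad N := Real.sqrt_nonneg _
      have hrad1 : rad N ≤ c + 1 := by
        refine (abs_le_of_sq_le_sq' ?_ (by linarith)).2
        rw [hradsq]
        nlinarith
      have hradc : c ≤ rad N := by
        refine (abs_le_of_sq_le_sq' ?_ hrad0).2
        rw [hradsq]
        nlinarith [sq_nonneg (tildeLength N)]
      have e : ‖(scale q c N / (2 * Real.pi * Complex.I) : ℂ)‖ =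
          sigma2 q c * √(N : ℝ) * (2 * Real.pi)⁻¹ := by
        rw [norm_div, norm_scale h]
        simp [abs_of_pos Real.pi_pos, div_eq_mul_inv]
      rw [norm_mul, e]
      have hbound := norm_arcIntegral_le (f := f N) (C := C₂ * Real.exp (√(N : ℝ) *
        (K - (s - t) * a * (√(N : ℝ) * tildeLength N ^ 2)))) hrad0
        (Complex.abs_arg_le_pi (zetaPlus c (Real.pi / 2) (rad N))) fun z hz => by
          have hzn : ‖z‖ = rad N := by
            obtain ⟨φ, -, rfl⟩ := hz
            exact norm_circlePoint hrad0 φ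
          have hzsq : ‖z‖ ^ 2 = c ^ 2 + tildeLength N ^ 2 := by rw [hzn, hradsq]
          rw [hζ] at hz
          have hnorm : ‖(c : ℂ) + tildeLength N * Complex.I‖ = rad N := by
            rw [Complex.norm_add_mul_I, hrad, tildeLength_sq]
          have hre : z.re ≤ c := re_le_of_mem_arc hℓ0 hnorm hz
          have hG := G2bar_re_le_of_arc h (by rwa [abs_of_nonneg hℓ0]) hre hzsq
          rw [← ha] at hG
          have hbz : b ≤ ‖1 - q * z‖ := by
            refine (abs_le_of_sq_le_sq' ?_ (norm_nonneg _)).2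
            refine le_trans ?_ (le_norm_one_sub_sq hq hre hzsq)
            have : b ^ 2 ≤ (1 - q * c) ^ 2 := by
              gcongr
              rw [hb]
              linarith
            have : 0 ≤ q ^ 2 * tildeLength N ^ 2 := by positivity
            linarith
          have hw := norm_exp_weight (c := c) (N : ℝ) (scale q c N * xs N)
            (fun z => (s - t : ℝ) * G2bar q c z) z
          rw [hf]
          simp only
          rw [norm_mul, hw, mul_comm]
          refine mul_le_mul (norm_tildeFactor_le h hb0 hb1 (by linarith) (by linarith) hbz) ?_
            (Real.exp_pos _).le hC₂0
          refine Real.exp_le_exp.2 ?_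
          rw [Complex.re_ofReal_mul]
          have h1 : (N : ℝ) * ((s - t) * (G2bar q c z).re) ≤
              N * ((s - t) * -(a * tildeLength N ^ 2)) := by gcongr
          have h2 : -(scale q c N * xs N * Real.log ‖z / c‖) ≤ √(N : ℝ) * K := by
            refine (neg_le_abs _).trans ?_
            have h3 := log_norm_div_le hc (hradc.trans_eq hzn.symm)
            have h4 : ‖z - c‖ / c ≤ (2 * c + 1) / c := by
              gcongr
              refine (norm_sub_le _ _).trans ?_
              rw [hcn]
              linarith
            rw [scale, abs_mul, abs_mul, abs_mul, abs_of_nonneg (Real.sqrt_nonneg _),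
              abs_of_pos hσ]
            calc sigma2 q c * √(N : ℝ) * |xs N| * |Real.log ‖z / c‖|
                ≤ sigma2 q c * √(N : ℝ) * X * ((2 * c + 1) / c) := by
                  gcongr
                  · exact hxs N
                  · exact h3.trans h4
              _ = _ := by rw [hK]; ring
          have h5 := Real.mul_self_sqrt (Nat.cast_nonneg (α := ℝ) N)
          have h6 : √(N : ℝ) * (K - (s - t) * a * (√(N : ℝ) * tildeLength N ^ 2)) =
              √(N : ℝ) * K + N * ((s - t) * -(a * tildeLength N ^ 2)) := by
            linear_combination (-(s - t) * a * tildeLength N ^ 2) * h5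
          rw [h6]
          linarith
      calc _ ≤ sigma2 q c * √(N : ℝ) * (2 * Real.pi)⁻¹ * (C₂ * Real.exp (√(N : ℝ) *
            (K - (s - t) * a * (√(N : ℝ) * tildeLength N ^ 2))) * (c + 1) * (4 * Real.pi)) := by
            gcongr
            refine hbound.trans ?_
            gcongr
        _ = _ := by ring
    · simpa only [mul_zero] using (tendsto_sqrt_mul_exp_atTop
        (tendsto_sqrt_mul_tildeLength_sq.const_mul_atTop (mul_pos hτ ha0)) K).const_mul
        (sigma2 q c * (2 * Real.pi)⁻¹ * C₂ * (c + 1) * (4 * Real.pi))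
  have hsum := hmain.add hrest
  rw [add_zero] at hsum
  refine hsum.congr' ?_
  filter_upwards [tendsto_tildeLength.eventually_lt_const hδ] with N hN
  have hℓ0 : 0 ≤ tildeLength N := Real.sqrt_nonneg _
  obtain ⟨F, hF⟩ := exists_segmentIntegral_eq_sub ((hdiff N).mono hreg)
  have hmem : ∀ v : ℝ, |v| ≤ tildeLength N → (c : ℂ) + v * Complex.I ∈ Metric.ball (c : ℂ) δ := by
    intro v hv
    rw [Metric.mem_ball, dist_eq_norm, add_sub_cancel_left, norm_mul, Complex.norm_I, mul_one,
      Complex.norm_real, Real.norm_eq_abs]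
    linarith
  have hp := hmem (tildeLength N) (abs_of_nonneg hℓ0).le
  have hm := hmem (-tildeLength N) (by rw [abs_neg]; exact (abs_of_nonneg hℓ0).le)
  have h0 : (c : ℂ) ∈ Metric.ball (c : ℂ) δ := Metric.mem_ball_self hδ
  have hζm : zetaMinus c (Real.pi / 2) (rad N) = c + (-tildeLength N : ℝ) * Complex.I := by
    rw [zetaMinus, hrad, rayLength_tilde, rayPoint_neg_pi_div_two]
  rw [intTilde, contourIntegral, ← mul_add]
  congr 1
  change _ = segmentIntegral (f N) (zetaMinus c (Real.pi / 2) (rad N)) _ + _ +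
    segmentIntegral (f N) _ (zetaPlus c (Real.pi / 2) (rad N)) +
    arcIntegral (f N) (rad N) (zetaPlus c (Real.pi / 2) (rad N)).arg
      (2 * Real.pi - (zetaPlus c (Real.pi / 2) (rad N)).arg)
  rw [hζm, rayPoint_zero, rayPoint_zero]
  congr 1
  -- With `r = 0` the middle segment degenerates to the point `c`, and the other two add up to the
  -- vertical one.
  rw [hζ, hF _ hm _ hp, hF _ hm _ h0, hF _ h0 _ h0, hF _ h0 _ hp]
  ring

theorem tendsto_R12 (h : IsParam q c) (hs : kappa0 q c < s) {θ R : ℝ → ℝ}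
    (hd : IsDescentPair q c s (θ s) (R s)) (hx : Tendsto xs atTop (𝓝 x))
    (hy : Tendsto ys atTop (𝓝 y)) (hxs : ∀ N, |xs N| ≤ X) (hys : ∀ N, |ys N| ≤ X) :
    Tendsto (fun N => R12 q c θ R N s (xs N) t (ys N)) atTop
      (𝓝 (kernelBM (s - kappa0 q c) x (t - kappa0 q c) y : ℂ)) := by
  have h1 := tendsto_intGamma_heatKernel h hs hd hx hxs
  have e1 : ∀ N : ℕ, (fun z => (F12 q c N s (xs N) t (ys N) z c * (z * c - 1) * fracPow q s N z) /
      (z * (z ^ 2 - 1) * fracPow q s N c)) = fun z => Complex.exp ((N : ℝ) * S2bar q c s z -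
        (scale q c N * xs N : ℝ) * Complex.log (z / c)) * gammaFactor q c s N z := by
    intro N
    ext z
    -- At `w = c` the exponent in `w` vanishes, so `y` and `t` drop out.
    rw [F12, S2bar_self, div_self h.ofReal_ne.1, Complex.log_one, ← Complex.exp_add, gammaFactor,
      mul_assoc, mul_div_assoc]
    congr 2
    push_cast
    ring
  have h2 : Tendsto (fun N : ℕ => -(if t < s then 1 else 0) * scale q c N /
      (2 * Real.pi * Complex.I) * (intTilde c N fun z =>
      Complex.exp (((s - t) * N : ℝ) * G2bar q c z) *
      Complex.exp (scale q c N * (-xs N + ys N) * Complex.log (z / c)) *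
      ((fracPow q s N z * fracPow q t N c) / (z * fracPow q t N z * fracPow q s N c)))) atTop
      (𝓝 (-((if t < s then 1 else 0) * heatKernel (s - t) (x - y) : ℝ) : ℂ)) := by
    split_ifs with hst
    · have h3 := (tendsto_intTilde_heatKernel (X := X + X) h hst (hx.sub hy)
        (fun N => (abs_sub _ _).trans (add_le_add (hxs N) (hys N)))).neg
      rw [one_mul]
      refine h3.congr fun N => ?_
      rw [neg_mul, one_mul, neg_div, neg_mul]
      congr 3
      ext z
      rw [← Complex.exp_add, tildeFactor]
      congr 2
      push_cast
      ring
    · simp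
  have h3 := h2.add h1
  have e2 : -(((if t < s then 1 else 0) * heatKernel (s - t) (x - y) : ℝ) : ℂ) +
      (heatKernel (s - kappa0 q c) x : ℂ) =
      (kernelBM (s - kappa0 q c) x (t - kappa0 q c) y : ℂ) := by
    rw [kernelBM, sub_sub_sub_cancel_right]
    simp only [sub_lt_sub_iff_right]
    push_cast
    ring
  rw [e2] at h3
  refine h3.congr fun N => ?_
  rw [R12, e1]

end Gaussian

end TopCurve

end

/-! ### Assembly of the limits. -/

theorem mainTheorem6 (q c : ℝ) (hq0 : 0 < q) (hq1 : q < 1) (hc1 : 1 < c) (hc2 : c < q⁻¹)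
    (T : Finset ℝ) (hT : ∀ κ ∈ T, TopCurve.kappa0 q c < κ ∧ κ < 1) :
    (∀ κ ∈ T, ∃ θ R : ℝ, TopCurve.IsDescentPair q c κ θ R) ∧
    ∀ θ R : ℝ → ℝ, (∀ κ ∈ T, TopCurve.IsDescentPair q c κ (θ κ) (R κ)) →
      ∀ s ∈ T, ∀ t ∈ T, ∀ (xs ys : ℕ → ℝ) (x y : ℝ),
        Tendsto xs atTop (𝓝 x) → Tendsto ys atTop (𝓝 y) →
        Tendsto (fun N : ℕ => TopCurve.kernel q c θ R N s (xs N) t (ys N) 0 0) atTop (𝓝 0) ∧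
        Tendsto (fun N : ℕ => TopCurve.kernel q c θ R N s (xs N) t (ys N) 1 1) atTop (𝓝 0) ∧
        Tendsto (fun N : ℕ => TopCurve.kernel q c θ R N s (xs N) t (ys N) 0 1) atTop
          (𝓝 (TopCurve.kernelBM (s - TopCurve.kappa0 q c) x
            (t - TopCurve.kappa0 q c) y : ℂ)) := by
  have h : TopCurve.IsParam q c := ⟨hq0, hq1, hc1, by
    calc q * c < q * q⁻¹ := by gcongr
      _ = 1 := mul_inv_cancel₀ hq0.ne'⟩
  refine ⟨fun κ hκ => TopCurve.exists_isDescentPair h (hT κ hκ).1, ?_⟩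
  intro θ R hd s hs t ht xs ys x y hx hy
  obtain ⟨hs0, hs1⟩ := hT s hs
  obtain ⟨ht0, ht1⟩ := hT t ht
  -- Convergent sequences are bounded, so the estimates uniform in `|x| ≤ X` apply along them.
  obtain ⟨X₁, hX₁⟩ := hx.norm.bddAbove_range
  obtain ⟨X₂, hX₂⟩ := hy.norm.bddAbove_range
  have hxs : ∀ N, |xs N| ≤ max X₁ X₂ := fun N => (hX₁ ⟨N, rfl⟩).trans (le_max_left _ _)
  have hys : ∀ N, |ys N| ≤ max X₁ X₂ := fun N => (hX₂ ⟨N, rfl⟩).trans (le_max_right _ _)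
  refine ⟨?_, ?_, ?_⟩
  · simpa [TopCurve.kernel] using
      TopCurve.tendsto_I11 h hs0 ht0 (hd s hs) (hd t ht) hxs hys
  · simpa [TopCurve.kernel] using (TopCurve.tendsto_I22 h hs0 hs1 ht0 ht1 hxs hys).add
      (TopCurve.tendsto_R22 h hs0 hs1 ht0 ht1 hxs hys)
  · simpa [TopCurve.kernel] using (TopCurve.tendsto_I12 h hs0 ht0 ht1 (hd s hs) hxs hys).add
      (TopCurve.tendsto_R12 (t := t) h hs0 (hd s hs) hx hy hxs hys)
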